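/- Let $s>0$ and $\phi_s(r)=\sqrt{s^2+r^2}$. For $d\ge 2$ and $f\in L^2(\mathbb R^d)$ let $\widehat f(\xi)=\int_{\mathbb R^d} e^{-ix\cdot\xi}f(x)\,dx$ (extended to $L^2$), put $$\|\phi_s(D)^\alpha f\|_{L^2(\mathbb R^d)}=(2\pi)^{-d/2}\Big(\int_{\mathbb R^d}\phi_s(|\xi|)^{2\alpha}|\widehat f(\xi)|^2\,d\xi\Big)^{1/2}\in[0,\infty],$$ and let $e^{it\phi_s(D)}f$ be the $L^2$ function with Fourier transform $e^{it\phi_s(|\xi|)}\widehat f(\xi)$. For $\beta\in\mathbb R$ let $|\square|^\beta$, $\square=\partial_t^2-\Delta_x$, be the space-time Fourier multiplier with symbol $|\tau^2-|\xi|^2|^\beta$ on $\mathbb R\times\mathbb R^d$; it is applied to the tempered distribution $|e^{it\phi_s(D)}f|^2$, and $\||\square|^\beta|e^{it\phi_s(D)}f|^2\|_{L^2(\mathbb R^{d+1})}$ is taken to be $\infty$ if the space-time Fourier transform of $|e^{it\phi_s(D)}f|^2$, multiplied by the symbol, is not an $L^2$ function. (1) Let $d\ge2$. For all $f\in L^2(\mathbb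 R^d)$ with $\|\phi_s(D)^{1/2}f\|_{L^2}<\infty$, $$\big\||\square|^{\frac{2-d}4}|e^{it\phi_s(D)}f|^2\big\|_{L^2(\mathbb R^{d+1})}\le\left(\frac{2^{1-d}\pi^{\frac{2-d}2}}{s\,\Gamma(\frac d2)}\right)^{\frac12}\|\phi_s(D)^{\frac12}f\|_{L^2(\mathbb R^d)}^2 .$$ The constant is optimal (the smallest possible), and no $f\neq0$ with $\|\phi_s(D)^{1/2}f\|_{L^2}<\infty$ attains equality. (2) Let $d\ge2$. For all $f\in L^2(\mathbb R^d)$ with $\|\phi_s(D)f\|_{L^2}<\infty$, $$\big\||\square|^{\frac{4-d}4}|e^{it\phi_s(D)}f|^2\big\|_{L^2(\mathbb R^{d+1})}\le\left(\frac{2^{1-d}\pi^{\frac{2-d}2}}{s\,\Gamma(\frac{d+2}2)}\right)^{\frac12}\Big(\|\phi_s(D)f\|_{L^2(\mathbb R^d)}^4-s^2\|\phi_s(D)^{\frac12}f\|_{L^2(\mathbb R^d)}^4\Big)^{\frac12}.$$ The constant is optimal, and no $f\neq0$ with $\|\phi_s(D)f\|_{L^2}<\infty$ attains equality. (3) For $d=4$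 and all $f\in L^2(\mathbb R^4)$ with $\|\phi_s(D)f\|_{L^2}<\infty$, $$\|e^{it\phi_s(D)}f\|_{L^4(\mathbb R^{4+1})}\le(16\pi s)^{-\frac14}\Big(\|\phi_s(D)f\|_{L^2(\mathbb R^4)}^4-s^2\|\phi_s(D)^{\frac12}f\|_{L^2(\mathbb R^4)}^4\Big)^{\frac14}.$$ The constant is optimal, and no $f\neq0$ with $\|\phi_s(D)f\|_{L^2}<\infty$ attains equality. (For $s=1$ the constant is $(16\pi)^{-1/4}$ and the bracket is $\|f\|_{H^1}^4-\|f\|_{H^{1/2}}^4$.) -/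

import Mathlib

open MeasureTheory FourierTransform SchwartzMap
open scoped ENNReal

namespace KleinGordon

noncomputable section

/-- The space `ℝ^d`. -/
abbrev Space (d : ℕ) : Type := EuclideanSpace ℝ (Fin d)

/-- Space-time `ℝ × ℝ^d` (time first), with its Euclidean structure. -/
abbrev SpaceTime (d : ℕ) : Type := WithLp 2 (ℝ × Space d)

/-- Complex-valued `L²(ℝ^d)`. -/
abbrev L2 (d : ℕ) : Type := Lp ℂ 2 (volume : Measure (Space d))

/-- `φ_s(r) = √(s² + r²)`. -/
def phi (s r : ℝ) : ℝ := Real.sqrt (s ^ 2 + r ^ 2)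

/-- The symbol of `φ_s(D)`, `D = √(-Δ)`. The Fourier transform used throughout is the unitary
one, `𝓕 f(ν) = ∫ e^{-2πi x·ν} f(x) dx`, so that `D` is multiplication by `2π|ν|`
(the frequency `ξ` of the convention `∫ e^{-i x·ξ} f(x) dx` is `ξ = 2πν`). -/
def symbol {d : ℕ} (s : ℝ) (ν : Space d) : ℝ := phi s (2 * Real.pi * ‖ν‖)

/-- `‖φ_s(D)^α f‖_{L²(ℝ^d)}`, with value `∞` when `φ_s(D)^α f` is not in `L²`
(by Plancherel's theorem, no constant appears in the unitary normalisation). -/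
def sobolevNorm {d : ℕ} (s α : ℝ) (f : L2 d) : ℝ≥0∞ :=
  eLpNorm (fun ν : Space d => ((symbol s ν ^ α : ℝ) : ℂ) * (𝓕 f : L2 d) ν) 2 volume

theorem memLp_propagator {d : ℕ} (s t : ℝ) (f : L2 d) :
    MemLp (fun ν : Space d => Complex.exp (((t * symbol s ν : ℝ) : ℂ) * Complex.I) *
      (𝓕 f : L2 d) ν) 2 volume := by
  have hc : Continuous fun ν : Space d =>
      Complex.exp (((t * symbol s ν : ℝ) : ℂ) * Complex.I) := by
    unfold symbol phi
    fun_prop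
  refine (Lp.memLp (𝓕 f : L2 d)).of_le
    (hc.aestronglyMeasurable.mul (Lp.aestronglyMeasurable _)) (Filter.Eventually.of_forall ?_)
  intro ν
  rw [norm_mul, Complex.norm_exp_ofReal_mul_I, one_mul]

/-- The Klein--Gordon propagator `e^{itφ_s(D)} f` on `L²(ℝ^d)`, the Fourier multiplier operator
with symbol `e^{itφ_s}`. -/
def propagator {d : ℕ} (s t : ℝ) (f : L2 d) : L2 d :=
  𝓕⁻ (MemLp.toLp _ (memLp_propagator s t f) : L2 d)

/-- The density `|e^{itφ_s(D)} f|²(x)` as a function of `t` and `x`; it is bounded in `t` with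
values in `L¹(ℝ^d)`, hence a tempered distribution on space-time. -/
def density {d : ℕ} (s : ℝ) (f : L2 d) (t : ℝ) (x : Space d) : ℂ :=
  ((‖(propagator s t f : L2 d) x‖ ^ 2 : ℝ) : ℂ)

/-- The space-time Fourier transform of the tempered distribution `G` on `ℝ × ℝ^d` is the locally
integrable function `h`, that is `⟨G, 𝓕 Φ⟩ = ⟨h, Φ⟩` for all test functions `Φ`.
(Such an `h` is unique up to null sets. It is meant for `G` that are bounded in `t` with values in
`L¹(ℝ^d)`, for which `⟨G, Ψ⟩ = ∫ (∫ G(t,x) Ψ(t,x) dx) dt`.) -/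
def HasSpaceTimeFourier {d : ℕ} (G : ℝ → Space d → ℂ) (h : SpaceTime d → ℂ) : Prop :=
  LocallyIntegrable h volume ∧
    ∀ Φ : 𝓢(SpaceTime d, ℂ), HasCompactSupport (Φ : SpaceTime d → ℂ) →
      ∫ t : ℝ, ∫ x : Space d, G t x * (𝓕 Φ : 𝓢(SpaceTime d, ℂ)) (WithLp.toLp 2 (t, x)) =
        ∫ p : SpaceTime d, h p * Φ p

/-- The symbol `|τ² - |ξ|²|^β` of `|□|^β`, `□ = ∂_t² - Δ_x`, at the frequency
`(τ, ξ) = 2π p`. -/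
def boxSymbol {d : ℕ} (β : ℝ) (p : SpaceTime d) : ℝ :=
  |(2 * Real.pi * p.fst) ^ 2 - (2 * Real.pi * ‖p.snd‖) ^ 2| ^ β

/-- `‖|□|^β G‖_{L²(ℝ^{d+1})}`, computed on the Fourier side by Plancherel's theorem. The infimum
is over the (up to null sets unique) Fourier transform of `G`; the value is `∞` if the Fourier
transform of `G` is not a locally integrable function or if `|□|^β G` is not in `L²`. -/
def boxNorm {d : ℕ} (β : ℝ) (G : ℝ → Space d → ℂ) : ℝ≥0∞ :=
  ⨅ (h : SpaceTime d → ℂ) (_ : HasSpaceTimeFourier G h),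
    eLpNorm (fun p : SpaceTime d => ((boxSymbol β p : ℝ) : ℂ) * h p) 2 volume

/-- `‖e^{itφ_s(D)} f‖_{L^q(ℝ × ℝ^d)}`, as an iterated integral. -/
def strichartzNorm {d : ℕ} (s q : ℝ) (f : L2 d) : ℝ≥0∞ :=
  (∫⁻ t : ℝ, ∫⁻ x : Space d, ‖(propagator s t f : L2 d) x‖ₑ ^ q) ^ (1 / q)

/-- `‖φ_s(D) f‖⁴ - s² ‖φ_s(D)^{1/2} f‖⁴`, a nonnegative real number if `φ_s(D) f ∈ L²`. -/
def refinedQuantity {d : ℕ} (s : ℝ) (f : L2 d) : ℝ :=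
  (sobolevNorm s 1 f).toReal ^ 4 - s ^ 2 * (sobolevNorm s (1 / 2) f).toReal ^ 4

/-- `C` is the smallest nonnegative constant with `A f ≤ C * B f` for every `f ∈ L²(ℝ^d)` with
`φ_s(D)^α f ∈ L²(ℝ^d)`. -/
def IsOptimalConstant {d : ℕ} (s α : ℝ) (A : L2 d → ℝ≥0∞) (B : L2 d → ℝ) (C : ℝ) : Prop :=
  IsLeast {C' : ℝ | 0 ≤ C' ∧
    ∀ f : L2 d, sobolevNorm s α f < ∞ → A f ≤ ENNReal.ofReal (C' * B f)} C

/-- No nonzero `f` with `φ_s(D)^α f ∈ L²(ℝ^d)` attains the equality `A f = C * B f`. -/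
def NoExtremisers {d : ℕ} (s α : ℝ) (A : L2 d → ℝ≥0∞) (B : L2 d → ℝ) (C : ℝ) : Prop :=
  ¬ ∃ f : L2 d, f ≠ 0 ∧ sobolevNorm s α f < ∞ ∧ A f = ENNReal.ofReal (C * B f)

/-- `(2^{1-d} π^{(2-d)/2} / (s Γ(z)))^{1/2}`. -/
def sharpConstant (d : ℕ) (s z : ℝ) : ℝ :=
  ((2 : ℝ) ^ (1 - (d : ℝ)) * Real.pi ^ ((2 - (d : ℝ)) / 2) / (s * Real.Gamma z)) ^ (1 / 2 : ℝ)

end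

end KleinGordon

/-! Rescale frequencies by 2π, put m = s/(2π) and e(x) = √(m² + |x|²). By Fourier inversion, the
space-time Fourier transform of |u|² is the push-forward of f̂(x)·conj f̂(y) under (x, y) ↦ (x - y,
e(x) - e(y)) (`integral_density_mul`). This push-forward has a density
(`map_transfer_absolutelyContinuous`). On its support, |□| becomes, up to powers of 2π, the quantity
gap(x, y) = |x - y|² - (e(x) - e(y))² ≥ 0.

The squared norm of |□|^β|u|² is therefore a quadrilinear integral over momenta with x - x' = w' - w
and e(x) - e(x') = e(w') - e(w), that is, over elastic collisions x + w = x' + w'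
(`lintegral_transferDensity_mul`). The product of delta measures is made rigorous by relaxing energy
conservation to a window of width 1/(n + 1) and computing the limit twice. Lebesgue differentiation
in the energy variable gives the pairing of the two push-forward densities. A Lorentz boost to the
centre-of-mass frame turns the window into a thin round shell, and gives an integral over (x, w) and
an outgoing direction ω with density k^(d-2) e(x')e(w')/M, where M is the invariant mass and k the
centre-of-mass momentum.

Replacing f̂ by its modulus g can only increase the norm. The inequality of arithmetic and geometric
means then gives 2 g(x)g(x')g(w')g(w) ≤ g(x)²g(w)² e(x)e(w)/(e(x')e(w')) + (the same with the two
pairs exchanged). Both terms have the same integral, and in the first one the outgoing energies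
cancel against the density. In the centre-of-mass frame gap(x, x') = k²|ω - e₀|² for a unit vector
e₀, so the ω-integral is a constant for each of the two exponents (`lintegral_sphere_norm_sub_rpow`,
`lintegral_sphere_norm_sub_rpow'`). What remains is ∫∫ g(x)²e(x) g(w)²e(w) k^(2j)/M with j = 0 or 1
(`lintegral_gapWeight_mul_sq_le`).

Finally M ≥ 2m, strictly for x ≠ w, which gives a strict inequality for every f ≠ 0
(`momentumForm_lt`). Without the factor 1/M the integral separates: for j = 0 it is a squared norm,
and for j = 1 the identity k² = (e(x)e(w) - x·w - m²)/2 produces the refined quantity minus the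
square of a total momentum. The constants are optimal because g = exp(-a e)/e turns the
arithmetic-geometric step into an equality by energy conservation (`lintegral_gapWeight_mul_sq_eq`),
kills the total momentum by symmetry, and concentrates as a → ∞ at rest, where M = 2m
(`exists_momentumForm_expProfile_ge`). The `L⁴` estimate is the refined one at d = 4, where β = 0,
combined with Plancherel's theorem on space-time (`strichartzNorm_four_eq`). -/

namespace KleinGordon

set_option linter.unusedSectionVars false

/-! ### Relativistic kinematics of two particles of equal mass -/

noncomputable section Kinematics

variable {V : Type*} [NormedAddCommGroup V]

/-- The energy `√(m² + ‖x‖²)` of a particle of mass `m` and momentum `x`. -/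
def energy (m : ℝ) (x : V) : ℝ := Real.sqrt (m ^ 2 + ‖x‖ ^ 2)

theorem energy_sq (m : ℝ) (x : V) : energy m x ^ 2 = m ^ 2 + ‖x‖ ^ 2 :=
  Real.sq_sqrt (by positivity)

theorem energy_nonneg (m : ℝ) (x : V) : 0 ≤ energy m x := Real.sqrt_nonneg _

theorem energy_pos {m : ℝ} (hm : 0 < m) (x : V) : 0 < energy m x :=
  Real.sqrt_pos.2 (by positivity)

theorem mass_le_energy {m : ℝ} (x : V) : m ≤ energy m x :=
  Real.le_sqrt_of_sq_le (by nlinarith [sq_nonneg ‖x‖])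

theorem norm_le_energy (m : ℝ) (x : V) : ‖x‖ ≤ energy m x :=
  Real.le_sqrt_of_sq_le (by nlinarith [sq_nonneg m])

theorem norm_lt_energy {m : ℝ} (hm : 0 < m) (x : V) : ‖x‖ < energy m x :=
  Real.lt_sqrt_of_sq_lt (by nlinarith [pow_pos hm 2])

theorem energy_le {m : ℝ} (hm : 0 ≤ m) (x : V) : energy m x ≤ m + ‖x‖ :=
  Real.sqrt_le_iff.2 ⟨by positivity, by nlinarith [norm_nonneg x]⟩

@[simp] theorem energy_neg (m : ℝ) (x : V) : energy m (-x) = energy m x := by simp [energy]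

@[fun_prop]
theorem continuous_energy (m : ℝ) : Continuous (energy m : V → ℝ) := by
  unfold energy
  fun_prop

@[fun_prop]
theorem measurable_energy [MeasurableSpace V] [BorelSpace V] (m : ℝ) :
    Measurable (energy m : V → ℝ) := (continuous_energy m).measurable

variable [InnerProductSpace ℝ V]

/-- Minus the Lorentz square of the difference of two energy-momentum vectors. -/
def gap (m : ℝ) (x y : V) : ℝ := ‖x - y‖ ^ 2 - (energy m x - energy m y) ^ 2

theorem gap_eq (m : ℝ) (x y : V) :
    gap m x y = 2 * (energy m x * energy m y - inner ℝ x y - m ^ 2) := by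
  have h1 := energy_sq m x
  have h2 := energy_sq m y
  rw [gap, norm_sub_sq_real]
  linarith

@[fun_prop]
theorem Continuous.gap {X : Type*} [TopologicalSpace X] {f g : X → V} {m : ℝ}
    (hf : Continuous f) (hg : Continuous g) : Continuous fun p => gap m (f p) (g p) := by
  unfold KleinGordon.gap
  have := continuous_energy (V := V) m
  fun_prop

/-- Without absolute values, both sides are ‖x‖² - ‖y‖². Cauchy–Schwarz and ‖x + y‖ < e(x) + e(y)
then show that `energy m` contracts distances, so energy-momentum differences are space-like. -/
theorem abs_energy_sub_mul (m : ℝ) (x y : V) :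
    |energy m x - energy m y| * (energy m x + energy m y) = |inner ℝ (x - y) (x + y)| := by
  have h : (energy m x - energy m y) * (energy m x + energy m y) = inner ℝ (x - y) (x + y) := by
    have h1 := energy_sq m x
    have h2 := energy_sq m y
    rw [inner_sub_left, inner_add_right, inner_add_right, real_inner_self_eq_norm_sq,
      real_inner_self_eq_norm_sq, real_inner_comm x y]
    linarith
  rw [← h, abs_mul, abs_of_nonneg (add_nonneg (energy_nonneg m x) (energy_nonneg m y))]

theorem abs_energy_sub_le {m : ℝ} (hm : 0 < m) (x y : V) :
    |energy m x - energy m y| ≤ ‖x - y‖ := by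
  have h := abs_energy_sub_mul m x y
  have h1 := abs_real_inner_le_norm (x - y) (x + y)
  have h2 := norm_add_le x y
  have h3 := norm_le_energy m x
  have h4 := norm_le_energy m y
  have h5 := energy_pos hm x
  have h6 := energy_nonneg m y
  have : |energy m x - energy m y| * (energy m x + energy m y)
      ≤ ‖x - y‖ * (energy m x + energy m y) := by
    rw [h]
    exact h1.trans (by gcongr; linarith)
  exact le_of_mul_le_mul_right this (by linarith)

theorem abs_energy_sub_lt {m : ℝ} (hm : 0 < m) {x y : V} (hxy : x ≠ y) :
    |energy m x - energy m y| < ‖x - y‖ := by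
  have h := abs_energy_sub_mul m x y
  have h1 := abs_real_inner_le_norm (x - y) (x + y)
  have h2 := norm_add_le x y
  have h3 := norm_lt_energy hm x
  have h4 := norm_lt_energy hm y
  have h5 := energy_pos hm x
  have h6 := energy_nonneg m y
  have h7 : 0 < ‖x - y‖ := norm_pos_iff.2 (sub_ne_zero.2 hxy)
  have : |energy m x - energy m y| * (energy m x + energy m y)
      < ‖x - y‖ * (energy m x + energy m y) := by
    rw [h]
    exact h1.trans_lt (by gcongr; linarith)
  exact lt_of_mul_lt_mul_right this (by linarith)

theorem gap_nonneg {m : ℝ} (hm : 0 < m) (x y : V) : 0 ≤ gap m x y := by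
  have := abs_energy_sub_le hm x y
  rw [gap, sub_nonneg, ← sq_abs]
  gcongr

theorem gap_pos {m : ℝ} (hm : 0 < m) {x y : V} (hxy : x ≠ y) : 0 < gap m x y := by
  have := abs_energy_sub_lt hm hxy
  rw [gap, sub_pos, ← sq_abs]
  gcongr

/-- The invariant mass of two particles with momenta `x` and `w`. -/
def invMass (m : ℝ) (x w : V) : ℝ := Real.sqrt (4 * m ^ 2 + gap m x w)

/-- The momentum of either of two particles in their centre-of-mass frame. -/
def cmMomentum (m : ℝ) (x w : V) : ℝ := Real.sqrt (gap m x w) / 2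

theorem invMass_sq {m : ℝ} (hm : 0 < m) (x w : V) :
    invMass m x w ^ 2 = 4 * m ^ 2 + gap m x w :=
  Real.sq_sqrt (by have := gap_nonneg hm x w; positivity)

/-- The Lorentz squares of the sum and of the difference of two energy-momentum vectors of mass m
add up to 4m²; this links the definition through `gap` with the usual E² - |P|². -/
theorem invMass_sq' {m : ℝ} (hm : 0 < m) (x w : V) :
    invMass m x w ^ 2 = (energy m x + energy m w) ^ 2 - ‖x + w‖ ^ 2 := by
  have h1 := energy_sq m x
  have h2 := energy_sq m w
  rw [invMass_sq hm, gap_eq, norm_add_sq_real]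
  linarith

theorem two_mul_mass_le_invMass {m : ℝ} (hm : 0 < m) (x w : V) : 2 * m ≤ invMass m x w :=
  Real.le_sqrt_of_sq_le (by nlinarith [gap_nonneg hm x w])

theorem two_mul_mass_lt_invMass {m : ℝ} (hm : 0 < m) {x w : V} (h : x ≠ w) :
    2 * m < invMass m x w :=
  Real.lt_sqrt_of_sq_lt (by nlinarith [gap_pos hm h])

theorem invMass_pos {m : ℝ} (hm : 0 < m) (x w : V) : 0 < invMass m x w := by
  have := two_mul_mass_le_invMass hm x w
  linarith

theorem invMass_le {m : ℝ} (hm : 0 < m) (x w : V) : invMass m x w ≤ energy m x + energy m w := by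
  have h := invMass_sq' hm x w
  exact abs_le_of_sq_le_sq' (by nlinarith [sq_nonneg ‖x + w‖])
    (add_nonneg (energy_nonneg m x) (energy_nonneg m w)) |>.2

theorem cmMomentum_nonneg (m : ℝ) (x w : V) : 0 ≤ cmMomentum m x w := by
  unfold cmMomentum; positivity

theorem cmMomentum_pos {m : ℝ} (hm : 0 < m) {x w : V} (h : x ≠ w) : 0 < cmMomentum m x w := by
  have := Real.sqrt_pos.2 (gap_pos hm h)
  unfold cmMomentum; positivity

theorem cmMomentum_sq {m : ℝ} (hm : 0 < m) (x w : V) :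
    cmMomentum m x w ^ 2 = gap m x w / 4 := by
  rw [cmMomentum, div_pow, Real.sq_sqrt (gap_nonneg hm x w)]; norm_num

@[fun_prop]
theorem Continuous.invMass {X : Type*} [TopologicalSpace X] {f g : X → V} {m : ℝ}
    (hf : Continuous f) (hg : Continuous g) : Continuous fun p => invMass m (f p) (g p) := by
  unfold KleinGordon.invMass
  fun_prop

@[fun_prop]
theorem Continuous.cmMomentum {X : Type*} [TopologicalSpace X] {f g : X → V} {m : ℝ}
    (hf : Continuous f) (hg : Continuous g) : Continuous fun p => cmMomentum m (f p) (g p) := by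
  unfold KleinGordon.cmMomentum
  fun_prop

/-- The coefficient in the spatial part `boost` of the Lorentz boost. -/
def boostCoeff (m : ℝ) (x w : V) : ℝ :=
  (invMass m x w * (energy m x + energy m w + invMass m x w))⁻¹

/-- The spatial part of the Lorentz boost from the centre-of-mass frame of two particles with
momenta `x` and `w`, restricted to the space-like hyperplane of zero energy. -/
def boost (m : ℝ) (x w z : V) : V :=
  z + (boostCoeff m x w * inner ℝ (x + w) z) • (x + w)

/-- Half of the energy difference of two outgoing particles with centre-of-mass momenta `±z`. -/
def boostTime (m : ℝ) (x w z : V) : ℝ := inner ℝ (x + w) z / invMass m x w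

section

variable {m : ℝ} (hm : 0 < m) (x w z : V)
include hm

/-- With E the total energy, P = x + w and M the invariant mass, |P|² = E² - M² = (E - M)(E + M),
and the coefficient is 1/(M(E + M)). -/
theorem boostCoeff_mul :
    boostCoeff m x w * ‖x + w‖ ^ 2 * invMass m x w = energy m x + energy m w - invMass m x w := by
  have hM := invMass_pos hm x w
  have h := invMass_sq' hm x w
  have he := energy_pos hm x
  have hw := energy_pos hm w
  have h2 : ‖x + w‖ ^ 2 = (energy m x + energy m w) ^ 2 - invMass m x w ^ 2 := by linarith
  have : energy m x + energy m w + invMass m x w ≠ 0 := by positivity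
  rw [boostCoeff, h2]
  field_simp
  ring

theorem inner_boost :
    inner ℝ (x + w) (boost m x w z) = boostTime m x w z * (energy m x + energy m w) := by
  have hM := invMass_pos hm x w
  have h := boostCoeff_mul hm x w
  rw [boost, inner_add_right, inner_smul_right, real_inner_self_eq_norm_sq, boostTime]
  field_simp
  linear_combination (inner ℝ (x + w) z) * h

/-- A Lorentz boost preserves the Minkowski form: the vector with energy 0 and momentum z goes to
the one with energy `boostTime` and momentum `boost`. -/
theorem norm_boost_sq : ‖boost m x w z‖ ^ 2 = ‖z‖ ^ 2 + boostTime m x w z ^ 2 := by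
  have hM := invMass_pos hm x w
  have h := boostCoeff_mul hm x w
  have hE : boostCoeff m x w * (invMass m x w * (energy m x + energy m w + invMass m x w)) = 1 :=
    inv_mul_cancel₀ (by have := energy_pos hm x; have := energy_pos hm w; positivity)
  rw [boost, norm_add_sq_real, inner_smul_right, norm_smul, mul_pow, Real.norm_eq_abs, sq_abs,
    real_inner_comm (x + w) z, boostTime, div_pow]
  set c := boostCoeff m x w
  set M := invMass m x w
  set t := inner ℝ (x + w) z
  set E := energy m x + energy m w
  have : 2 * (c * t * t) + (c * t) ^ 2 * ‖x + w‖ ^ 2 = t ^ 2 / M ^ 2 := by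
    field_simp
    linear_combination t ^ 2 * (c * M * h + hE)
  linarith

/-- The vector (E/2 + `boostTime`, P/2 + `boost`) is the boost of (M/2, z), so its Minkowski square
is M²/4 - ‖z‖², and M²/4 = m² + k². The last summand measures how far z is off the energy shell. -/
theorem energy_boost_add_sq :
    energy m ((2⁻¹ : ℝ) • (x + w) + boost m x w z) ^ 2 =
      ((energy m x + energy m w) / 2 + boostTime m x w z) ^ 2 +
        (‖z‖ ^ 2 - cmMomentum m x w ^ 2) := by
  have h := invMass_sq' hm x w
  rw [energy_sq, norm_add_sq_real, inner_smul_left, inner_boost hm, norm_boost_sq hm,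
    cmMomentum_sq hm, norm_smul, mul_pow]
  rw [invMass_sq hm] at h
  simp
  linarith

theorem boost_neg : boost m x w (-z) = -boost m x w z := by
  simp [boost, add_comm]

theorem boostTime_neg : boostTime m x w (-z) = -boostTime m x w z := by
  simp [boostTime, neg_div]

theorem energy_boost_sub_sq :
    energy m ((2⁻¹ : ℝ) • (x + w) - boost m x w z) ^ 2 =
      ((energy m x + energy m w) / 2 - boostTime m x w z) ^ 2 +
        (‖z‖ ^ 2 - cmMomentum m x w ^ 2) := by
  have := energy_boost_add_sq hm x w (-z)
  rwa [boost_neg hm, boostTime_neg hm, norm_neg, ← sub_eq_add_neg, ← sub_eq_add_neg] at this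

/-- Ensures that E/2 ± `boostTime` are nonnegative, so that square roots can be taken in
`energy_boost_add_sq`. -/
theorem abs_boostTime_le (hz : ‖z‖ = cmMomentum m x w) :
    |boostTime m x w z| ≤ (energy m x + energy m w) / 2 := by
  have hM := invMass_pos hm x w
  have h1 := abs_real_inner_le_norm (x + w) z
  have h2 : ‖x + w‖ ≤ energy m x + energy m w :=
    (norm_add_le _ _).trans (add_le_add (norm_le_energy m x) (norm_le_energy m w))
  have h3 : ‖z‖ ≤ invMass m x w / 2 := by
    rw [hz, cmMomentum, invMass]
    gcongr
    nlinarith [sq_nonneg m]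
  have := energy_nonneg m x
  have := energy_nonneg m w
  rw [boostTime, abs_div, abs_of_pos hM, div_le_iff₀ hM]
  calc _ ≤ _ := h1
    _ ≤ (energy m x + energy m w) * (invMass m x w / 2) := by gcongr
    _ = _ := by ring

theorem energy_boost_add (hz : ‖z‖ = cmMomentum m x w) :
    energy m ((2⁻¹ : ℝ) • (x + w) + boost m x w z) =
      (energy m x + energy m w) / 2 + boostTime m x w z := by
  have h := energy_boost_add_sq hm x w z
  rw [hz, sub_self, add_zero] at h
  have := abs_le.1 (abs_boostTime_le hm x w z hz)
  exact (sq_eq_sq₀ (energy_nonneg _ _) (by linarith)).1 h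

theorem energy_boost_sub (hz : ‖z‖ = cmMomentum m x w) :
    energy m ((2⁻¹ : ℝ) • (x + w) - boost m x w z) =
      (energy m x + energy m w) / 2 - boostTime m x w z := by
  have := energy_boost_add hm x w (-z) (by simpa using hz)
  rwa [boost_neg hm, boostTime_neg hm, ← sub_eq_add_neg, ← sub_eq_add_neg] at this

theorem energy_boost_add_energy_boost (hz : ‖z‖ = cmMomentum m x w) :
    energy m ((2⁻¹ : ℝ) • (x + w) + boost m x w z) +
      energy m ((2⁻¹ : ℝ) • (x + w) - boost m x w z) = energy m x + energy m w := by
  rw [energy_boost_add hm x w z hz, energy_boost_sub hm x w z hz]; ring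

end

/-- The total energy of two outgoing particles with centre-of-mass momenta `±z`, not necessarily
on the energy shell. -/
def outEnergy (m : ℝ) (x w z : V) : ℝ :=
  energy m ((2⁻¹ : ℝ) • (x + w) + boost m x w z) +
    energy m ((2⁻¹ : ℝ) • (x + w) - boost m x w z)

/-- The proportionality factor between the energy defect and the defect of the squared
centre-of-mass momentum. -/
def shellFactor (m : ℝ) (x w z : V) : ℝ :=
  (outEnergy m x w z + (energy m x + energy m w)) / 4 *
    (1 - 4 * boostTime m x w z ^ 2 / outEnergy m x w z ^ 2)

section

variable {m : ℝ} (hm : 0 < m) (x w z : V)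
include hm

theorem outEnergy_pos : 0 < outEnergy m x w z := add_pos (energy_pos hm _) (energy_pos hm _)

theorem two_mul_norm_boost_lt : 2 * ‖boost m x w z‖ < outEnergy m x w z := by
  have h : (2 : ℝ) • boost m x w z = ((2⁻¹ : ℝ) • (x + w) + boost m x w z) -
      ((2⁻¹ : ℝ) • (x + w) - boost m x w z) := by rw [two_smul]; abel
  have h2 : 2 * ‖boost m x w z‖ = ‖(2 : ℝ) • boost m x w z‖ := by simp [norm_smul]
  rw [h2, h, outEnergy]
  exact (norm_sub_le _ _).trans_lt (add_lt_add (norm_lt_energy hm _) (norm_lt_energy hm _))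

/-- Off the energy shell the boost no longer conserves energy, yet the defect stays an explicit
multiple of ‖z‖² - k². If a, b are the outgoing energies, E' = a + b and t is `boostTime`, then (a -
b)E' = 2Et determines a from E' and t, and substituting in `energy_boost_add_sq` gives 4E'²(‖z‖² -
k²) = (E'² - E²)(E'² - 4t²). -/
theorem shell_identity :
    ‖z‖ ^ 2 - cmMomentum m x w ^ 2 =
      (outEnergy m x w z - (energy m x + energy m w)) * shellFactor m x w z := by
  have hE := outEnergy_pos hm x w z
  have h1 := energy_boost_add_sq hm x w z
  have h2 := energy_boost_sub_sq hm x w z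
  rw [shellFactor]
  have ho : outEnergy m x w z = energy m ((2⁻¹ : ℝ) • (x + w) + boost m x w z) +
    energy m ((2⁻¹ : ℝ) • (x + w) - boost m x w z) := rfl
  set a := energy m ((2⁻¹ : ℝ) • (x + w) + boost m x w z)
  set b := energy m ((2⁻¹ : ℝ) • (x + w) - boost m x w z)
  set E := energy m x + energy m w
  set t := boostTime m x w z
  set E' := outEnergy m x w z
  set δ := ‖z‖ ^ 2 - cmMomentum m x w ^ 2
  have h3 : (a - b) * E' = 2 * E * t := by rw [ho]; linear_combination h1 - h2
  have ha : 2 * a * E' = E' ^ 2 + 2 * E * t := by rw [← h3, ho]; ring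
  have h4 : 4 * E' ^ 2 * δ = (E' ^ 2 - E ^ 2) * (E' ^ 2 - 4 * t ^ 2) := by
    have : (2 * a * E') ^ 2 = (E' ^ 2 + 2 * E * t) ^ 2 := by rw [ha]
    linear_combination this - 4 * E' ^ 2 * h1
  field_simp
  linear_combination h4

/-- By `norm_boost_sq`, |`boostTime`| ≤ ‖`boost`‖, and twice the latter is a difference of two
momenta, each smaller than its energy. This makes `shellFactor` positive. -/
theorem boostTime_ratio_lt : 4 * boostTime m x w z ^ 2 / outEnergy m x w z ^ 2 < 1 := by
  have hE := outEnergy_pos hm x w z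
  rw [div_lt_one (by positivity)]
  have h := norm_boost_sq hm x w z
  have h1 := two_mul_norm_boost_lt hm x w z
  have : 4 * ‖boost m x w z‖ ^ 2 < outEnergy m x w z ^ 2 := by
    nlinarith [norm_nonneg (boost m x w z)]
  nlinarith [sq_nonneg ‖z‖]

theorem shellFactor_pos : 0 < shellFactor m x w z := by
  have := boostTime_ratio_lt hm x w z
  have := outEnergy_pos hm x w z
  have := energy_pos hm x
  have := energy_pos hm w
  unfold shellFactor
  exact mul_pos (by positivity) (by linarith)

theorem shellFactor_le :
    shellFactor m x w z ≤ outEnergy m x w z + (energy m x + energy m w) := by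
  have := boostTime_ratio_lt hm x w z
  have h1 := outEnergy_pos hm x w z
  have h2 := energy_pos hm x
  have h3 := energy_pos hm w
  unfold shellFactor
  have h4 : 0 ≤ 4 * boostTime m x w z ^ 2 / outEnergy m x w z ^ 2 := by positivity
  nlinarith

/-- On the shell the factor is (E² - 4t²)/(2E) with t = `boostTime`, and E/2 ± t are the outgoing
energies. This is the source of their product in the collision measure. -/
theorem shellFactor_eq (hz : ‖z‖ = cmMomentum m x w) :
    shellFactor m x w z * (energy m x + energy m w) =
      2 * energy m ((2⁻¹ : ℝ) • (x + w) + boost m x w z) *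
        energy m ((2⁻¹ : ℝ) • (x + w) - boost m x w z) := by
  have h2 := energy_pos hm x
  have h3 := energy_pos hm w
  have h4 : outEnergy m x w z = energy m x + energy m w := energy_boost_add_energy_boost hm x w z hz
  rw [energy_boost_add hm x w z hz, energy_boost_sub hm x w z hz, shellFactor, h4]
  field_simp
  ring

theorem abs_outEnergy_sub_lt_iff {ε : ℝ} :
    |energy m x + energy m w - outEnergy m x w z| < ε ↔
      |‖z‖ ^ 2 - cmMomentum m x w ^ 2| < ε * shellFactor m x w z := by
  have h := shellFactor_pos hm x w z
  rw [shell_identity hm, abs_mul, abs_of_pos h, mul_lt_mul_iff_left₀ h, abs_sub_comm]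

/-- Lorentz invariance of `gap`: in the centre-of-mass frame the two particles have the same energy,
so their difference is purely spatial. This turns the weight into a chord length on a sphere. -/
theorem gap_boost_boost {z₁ z₂ : V} (h₁ : ‖z₁‖ = cmMomentum m x w)
    (h₂ : ‖z₂‖ = cmMomentum m x w) :
    gap m ((2⁻¹ : ℝ) • (x + w) + boost m x w z₁) ((2⁻¹ : ℝ) • (x + w) + boost m x w z₂) =
      ‖z₁ - z₂‖ ^ 2 := by
  have hb : boost m x w z₁ - boost m x w z₂ = boost m x w (z₁ - z₂) := by
    simp only [boost, inner_sub_right]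
    module
  have ht : boostTime m x w z₁ - boostTime m x w z₂ = boostTime m x w (z₁ - z₂) := by
    simp only [boostTime, inner_sub_right]
    ring
  rw [gap, energy_boost_add hm x w _ h₁, energy_boost_add hm x w _ h₂, add_sub_add_left_eq_sub, hb,
    norm_boost_sq hm, add_sub_add_left_eq_sub, ht]
  ring

end

end Kinematics

end KleinGordon

namespace KleinGordon

set_option linter.unusedSectionVars false

/-! ### Polar coordinates and zonal integrals over the sphere -/

section Polar

open Set Metric Module

variable {V : Type*} [NormedAddCommGroup V] [InnerProductSpace ℝ V] [FiniteDimensional ℝ V]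
  [MeasurableSpace V] [BorelSpace V]

theorem lintegral_polar [Nontrivial V] {f : V → ℝ≥0∞} (hf : Measurable f) :
    ∫⁻ x, f x = ∫⁻ ω : sphere (0 : V) 1, (∫⁻ r in Ioi (0 : ℝ),
      ENNReal.ofReal (r ^ (finrank ℝ V - 1)) * f (r • (ω : V))) ∂(volume : Measure V).toSphere := by
  set μ : Measure V := volume
  have h1 : ∫⁻ x, f x ∂μ = ∫⁻ x : ({(0)}ᶜ : Set V), f x ∂(μ.comap (↑)) := by
    rw [lintegral_subtype_comap (measurableSet_singleton _).compl, restrict_compl_singleton]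
  have h2 := μ.measurePreserving_homeomorphUnitSphereProd.lintegral_comp_emb
    (Homeomorph.measurableEmbedding _) (fun p => f (p.2.1 • (p.1 : V)))
  have h3 : ∀ x : ({(0)}ᶜ : Set V), f (((homeomorphUnitSphereProd V x).2.1) •
      ((homeomorphUnitSphereProd V x).1 : V)) = f x := by
    intro x
    have : ‖(x : V)‖ ≠ 0 := norm_ne_zero_iff.2 x.2
    simp [smul_smul, this]
  simp only [h3] at h2
  have hm : Measurable fun p : sphere (0 : V) 1 × Ioi (0 : ℝ) => f (p.2.1 • (p.1 : V)) := by
    fun_prop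
  rw [h1, h2, lintegral_prod _ hm.aemeasurable]
  refine lintegral_congr fun ω => ?_
  rw [Measure.volumeIoiPow, lintegral_withDensity_eq_lintegral_mul _ (by fun_prop) (by fun_prop)]
  simp only [Pi.mul_apply]
  exact lintegral_subtype_comap measurableSet_Ioi
    (fun r : ℝ => ENNReal.ofReal (r ^ (finrank ℝ V - 1)) * f (r • (ω : V)))

theorem lintegral_Ioi_sqrt (g : ℝ → ℝ≥0∞) :
    ∫⁻ r in Ioi (0 : ℝ), g r =
      ∫⁻ v in Ioi (0 : ℝ), ENNReal.ofReal (1 / (2 * Real.sqrt v)) * g (Real.sqrt v) := by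
  have himg : Real.sqrt '' Ioi 0 = Ioi 0 := by
    ext r
    constructor
    · rintro ⟨v, hv, rfl⟩
      exact Real.sqrt_pos.2 hv
    · intro hr
      exact ⟨r ^ 2, by simpa using pow_pos hr 2, Real.sqrt_sq (le_of_lt hr)⟩
  have := lintegral_image_eq_lintegral_abs_deriv_mul (f := Real.sqrt)
    (f' := fun v => 1 / (2 * Real.sqrt v)) measurableSet_Ioi
    (fun v hv => (Real.hasDerivAt_sqrt (ne_of_gt hv)).hasDerivWithinAt)
    (fun a ha b hb hab => (Real.sqrt_inj (le_of_lt ha) (le_of_lt hb)).1 hab) g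
  rw [himg] at this
  rw [this]
  refine setLIntegral_congr_fun measurableSet_Ioi fun v hv => ?_
  rw [abs_of_nonneg (by positivity)]

/-- The radial variable is v = r², since both the energy shells of `shell_identity` and the energy
transfer along a ray are described through the squared radius. -/
theorem lintegral_polar_sq (hd : 2 ≤ finrank ℝ V) {f : V → ℝ≥0∞} (hf : Measurable f) :
    ∫⁻ x, f x = ∫⁻ ω : sphere (0 : V) 1, (∫⁻ v in Ioi (0 : ℝ),
      ENNReal.ofReal (Real.sqrt v ^ (finrank ℝ V - 2) / 2) * f (Real.sqrt v • (ω : V)))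
      ∂(volume : Measure V).toSphere := by
  have : Nontrivial V := Module.nontrivial_of_finrank_pos (R := ℝ) (by omega)
  rw [lintegral_polar hf]
  refine lintegral_congr fun ω => ?_
  rw [lintegral_Ioi_sqrt]
  refine setLIntegral_congr_fun measurableSet_Ioi fun v hv => ?_
  have hv' : 0 < Real.sqrt v := Real.sqrt_pos.2 hv
  rw [← mul_assoc, ← ENNReal.ofReal_mul (by positivity)]
  congr 2
  obtain ⟨k, hk⟩ := Nat.exists_eq_add_of_le hd
  rw [hk, show 2 + k - 1 = k + 1 by omega, show 2 + k - 2 = k by omega]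
  field_simp
  ring

/-- Integration of zonal functions over the unit sphere. -/
theorem lintegral_sphere_zonal (hd : 2 ≤ finrank ℝ V) {e : V} (he : ‖e‖ = 1) :
    ∃ c : ℝ≥0∞, c ≠ 0 ∧ c ≠ ∞ ∧ ∀ F : ℝ → ℝ≥0∞, Measurable F →
      ∫⁻ ω : sphere (0 : V) 1, F (inner ℝ (ω : V) e) ∂(volume : Measure V).toSphere =
        c * ∫⁻ θ in Ioo 0 Real.pi,
          ENNReal.ofReal (Real.sin θ ^ (finrank ℝ V - 2)) * F (Real.cos θ) := by
  obtain ⟨n, hn⟩ := Nat.exists_eq_add_of_le hd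
  have hn' : finrank ℝ V = (n + 1) + 1 := by omega
  have : Nontrivial V := Module.nontrivial_of_finrank_pos (R := ℝ) (by omega)
  -- an orthonormal basis starting with `e`
  obtain ⟨b, hb⟩ : ∃ b : OrthonormalBasis (Fin (n + 1 + 1)) ℝ V, b 0 = e := by
    have hv : Orthonormal ℝ (({0} : Set (Fin (n + 1 + 1))).domRestrict (fun _ => e)) := by
      rw [orthonormal_iff_ite]
      rintro ⟨i, hi⟩ ⟨j, hj⟩
      simp only [mem_singleton_iff] at hi hj
      subst hi hj
      simp [Set.domRestrict, he]
    obtain ⟨b, hb⟩ := hv.exists_orthonormalBasis_extension_of_card_eq (by simp [hn'])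
    exact ⟨b, hb 0 rfl⟩
  set W := EuclideanSpace ℝ (Fin (n + 1))
  -- measure preserving coordinates
  let Ψ : V → ℝ × W := fun x => (b.repr x 0, WithLp.toLp 2 (fun i => b.repr x (Fin.succ i)))
  have hΨ : MeasurePreserving Ψ := by
    have h1 : MeasurePreserving (b.repr : V → EuclideanSpace ℝ (Fin (n + 1 + 1))) :=
      b.measurePreserving_repr
    have h2 := (PiLp.volume_preserving_ofLp (Fin (n + 1 + 1))).comp h1
    have h3 := (volume_preserving_piFinSuccAbove (fun _ : Fin (n + 1 + 1) => ℝ) 0).comp h2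
    have h4 := ((MeasurePreserving.id (volume : Measure ℝ)).prod
      (PiLp.volume_preserving_toLp (Fin (n + 1)))).comp h3
    exact h4
  have hnorm : ∀ x, ‖x‖ ^ 2 = (Ψ x).1 ^ 2 + ‖(Ψ x).2‖ ^ 2 := by
    intro x
    rw [← b.repr.norm_map x, EuclideanSpace.norm_sq_eq, EuclideanSpace.norm_sq_eq,
      Fin.sum_univ_succ]
    simp [Ψ]
  have hinner : ∀ x, inner ℝ x e = (Ψ x).1 := by
    intro x
    rw [real_inner_comm, ← hb]
    exact (b.repr_apply_apply x 0).symm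
  set G : ℝ≥0∞ := ∫⁻ r in Ioi (0 : ℝ), ENNReal.ofReal (r ^ (n + 1)) *
    ENNReal.ofReal (Real.exp (-r ^ 2)) with hG
  -- The radial factor G occurs in both evaluations below; being nonzero and finite, it cancels at
  -- the end.
  have hG0 : G ≠ 0 := by
    rw [hG, Ne, lintegral_eq_zero_iff (by fun_prop)]
    intro h
    have h' := (ae_restrict_iff' measurableSet_Ioi).1 h
    have hall : ∀ᵐ r : ℝ, r ∉ Ioi (0 : ℝ) := by
      filter_upwards [h'] with r hr hr0
      have := hr hr0
      simp only [Pi.zero_apply, mul_eq_zero, ENNReal.ofReal_eq_zero] at this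
      have h1 : 0 < r ^ (n + 1) := pow_pos hr0 _
      have h2 := Real.exp_pos (-r ^ 2)
      rcases this with h | h <;> linarith
    have := measure_eq_zero_iff_ae_notMem.2 hall
    simp at this
  have hG1 : G ≠ ∞ := by
    have h := (integrable_rpow_mul_exp_neg_mul_sq (b := 1) one_pos (s := (n + 1 : ℕ))
      (by push_cast; linarith)).lintegral_lt_top
    refine ne_of_lt (lt_of_le_of_lt ?_ h)
    refine (setLIntegral_mono' measurableSet_Ioi fun r hr => ?_).trans (setLIntegral_le_lintegral _ _)
    rw [← ENNReal.ofReal_mul (by have := mem_Ioi.1 hr; positivity), Real.rpow_natCast]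
    simp
  -- The constant is the area of the unit sphere of one dimension less; its value is never needed,
  -- because all later uses compare two zonal integrals.
  set c : ℝ≥0∞ := (volume : Measure W).toSphere univ with hc
  refine ⟨c, ?_, measure_ne_top _ _, fun F hF => ?_⟩
  · rw [hc, Ne, Measure.measure_univ_eq_zero]
    exact Measure.toSphere_ne_zero _
  -- compute a Gaussian integral in two ways
  have hL : ∫⁻ x : V, F (inner ℝ x e / ‖x‖) * ENNReal.ofReal (Real.exp (-‖x‖ ^ 2)) =
      (∫⁻ ω : sphere (0 : V) 1, F (inner ℝ (ω : V) e) ∂(volume : Measure V).toSphere) * G := by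
    rw [lintegral_polar (by fun_prop), ← lintegral_mul_const _ (by fun_prop)]
    refine lintegral_congr fun ω => ?_
    rw [hG, ← lintegral_const_mul _ (by fun_prop)]
    refine setLIntegral_congr_fun measurableSet_Ioi fun r hr => ?_
    have hr0 : 0 < r := hr
    have hω : ‖(ω : V)‖ = 1 := by simp
    rw [norm_smul, hω, Real.norm_of_nonneg hr0.le, mul_one, inner_smul_left]
    simp only [conj_trivial]
    rw [mul_div_cancel_left₀ _ hr0.ne', hn', show n + 1 + 1 - 1 = n + 1 by omega]
    ring
  have hR : ∫⁻ x : V, F (inner ℝ x e / ‖x‖) * ENNReal.ofReal (Real.exp (-‖x‖ ^ 2)) =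
      (c * ∫⁻ θ in Ioo 0 Real.pi,
          ENNReal.ofReal (Real.sin θ ^ (finrank ℝ V - 2)) * F (Real.cos θ)) * G := by
    let H : ℝ → ℝ → ℝ≥0∞ := fun u ρ => F (u / Real.sqrt (u ^ 2 + ρ ^ 2)) *
      ENNReal.ofReal (Real.exp (-(u ^ 2 + ρ ^ 2)))
    have hH : Measurable (Function.uncurry H) := by
      simp only [H, Function.uncurry_def]; fun_prop
    have h1 : ∀ x : V, F (inner ℝ x e / ‖x‖) * ENNReal.ofReal (Real.exp (-‖x‖ ^ 2)) =
        (fun p : ℝ × W => H p.1 ‖p.2‖) (Ψ x) := by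
      intro x
      simp only [H]
      rw [← hnorm, Real.sqrt_sq (norm_nonneg x), hinner]
    simp_rw [h1]
    rw [hΨ.lintegral_comp (f := fun p : ℝ × W => H p.1 ‖p.2‖)
      (by simp only [H]; fun_prop), Measure.volume_eq_prod,
      lintegral_prod _ (by simp only [H]; fun_prop)]
    have h2 : ∀ u : ℝ, ∫⁻ w : W, H u ‖w‖ =
        c * ∫⁻ ρ in Ioi (0 : ℝ), ENNReal.ofReal (ρ ^ n) * H u ρ := by
      intro u
      have hHu : Measurable (H u) := by simp only [H]; fun_prop
      rw [lintegral_polar (by fun_prop)]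
      have : ∀ ω : sphere (0 : W) 1, (∫⁻ r in Ioi (0 : ℝ),
          ENNReal.ofReal (r ^ (finrank ℝ W - 1)) * H u ‖r • (ω : W)‖) =
          ∫⁻ ρ in Ioi (0 : ℝ), ENNReal.ofReal (ρ ^ n) * H u ρ := by
        intro ω
        refine setLIntegral_congr_fun measurableSet_Ioi fun r hr => ?_
        have hr0 : 0 < r := hr
        have hω : ‖(ω : W)‖ = 1 := by simp
        rw [norm_smul, hω, Real.norm_of_nonneg hr0.le, mul_one, finrank_euclideanSpace,
          Fintype.card_fin, Nat.add_sub_cancel]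
      simp_rw [this]
      rw [lintegral_const, mul_comm]
    simp_rw [h2]
    rw [lintegral_const_mul _ (by
      apply Measurable.lintegral_prod_right'
        (f := fun p : ℝ × ℝ => ENNReal.ofReal (p.2 ^ n) * H p.1 p.2)
      simp only [H]; fun_prop), mul_assoc]
    congr 1
    -- two-dimensional polar coordinates
    let J : ℝ × ℝ → ℝ≥0∞ := fun p =>
      (Ioi (0 : ℝ)).indicator (fun ρ => ENNReal.ofReal (ρ ^ n) * H p.1 ρ) p.2
    have hJ : Measurable J := by
      have : J = {p : ℝ × ℝ | 0 < p.2}.indicator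
          (fun p => ENNReal.ofReal (p.2 ^ n) * H p.1 p.2) := by
        ext p
        simp [J, indicator]
      rw [this]
      refine Measurable.indicator ?_ (measurableSet_lt measurable_const measurable_snd)
      simp only [H]; fun_prop
    have h3 : ∫⁻ u : ℝ, ∫⁻ ρ in Ioi (0 : ℝ), ENNReal.ofReal (ρ ^ n) * H u ρ =
        ∫⁻ p : ℝ × ℝ, J p := by
      rw [Measure.volume_eq_prod, lintegral_prod _ hJ.aemeasurable]
      refine lintegral_congr fun u => ?_
      rw [← lintegral_indicator measurableSet_Ioi]
    rw [h3, ← lintegral_comp_polarCoord_symm, polarCoord_target, Measure.volume_eq_prod,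
      ← Measure.prod_restrict, lintegral_prod_symm _ (by
        apply Measurable.aemeasurable
        simp only [polarCoord_symm_apply, smul_eq_mul]
        fun_prop), ← lintegral_mul_const _ (by fun_prop)]
    have hsub : Ioo (0 : ℝ) Real.pi ⊆ Ioo (-Real.pi) Real.pi :=
      Ioo_subset_Ioo_left (by linarith [Real.pi_pos])
    rw [← lintegral_indicator measurableSet_Ioo, ← lintegral_indicator measurableSet_Ioo]
    refine lintegral_congr fun θ => ?_
    by_cases hθ : θ ∈ Ioo (0 : ℝ) Real.pi
    · rw [indicator_of_mem hθ, indicator_of_mem (hsub hθ), hG, ← lintegral_const_mul _ (by fun_prop)]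
      refine setLIntegral_congr_fun measurableSet_Ioi fun r hr => ?_
      have hr0 : 0 < r := hr
      have hsin := Real.sin_pos_of_mem_Ioo hθ
      have hsq : (r * Real.cos θ) ^ 2 + (r * Real.sin θ) ^ 2 = r ^ 2 := by
        linear_combination r ^ 2 * Real.sin_sq_add_cos_sq θ
      simp only [polarCoord_symm_apply, J, H, smul_eq_mul]
      rw [indicator_of_mem (mem_Ioi.2 (mul_pos hr0 hsin)), hsq, Real.sqrt_sq hr0.le,
        mul_div_cancel_left₀ _ hr0.ne', hn', show n + 1 + 1 - 2 = n by omega, mul_pow,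
        ENNReal.ofReal_mul (by positivity), pow_succ r n, ENNReal.ofReal_mul (by positivity)]
      ring
    · rw [indicator_of_notMem hθ]
      by_cases hθ' : θ ∈ Ioo (-Real.pi) Real.pi
      -- Angles in (-π, 0] point into the closed lower half-plane, where `J` vanishes by definition.
      · rw [indicator_of_mem hθ']
        rw [setLIntegral_congr_fun (g := fun _ => 0) measurableSet_Ioi, lintegral_zero]
        intro r hr
        have hr0 : 0 < r := hr
        have hsin : Real.sin θ ≤ 0 := by
          refine Real.sin_nonpos_of_nonpos_of_neg_pi_le ?_ hθ'.1.le
          by_contra hc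
          exact hθ ⟨not_le.1 hc, hθ'.2⟩
        simp only [polarCoord_symm_apply, J]
        rw [indicator_of_notMem (by
          simp only [mem_Ioi, not_lt]
          exact mul_nonpos_of_nonneg_of_nonpos hr0.le hsin), smul_zero]
      · rw [indicator_of_notMem hθ']
  have := hL.symm.trans hR
  exact (ENNReal.mul_left_inj hG0 hG1).1 this

/-- In the zonal formula the slice becomes a level set of the cosine on (0, π), which has at most
one point. -/
theorem toSphere_inner_eq_const (hd : 2 ≤ finrank ℝ V) {η : V} (hη : η ≠ 0) (t : ℝ) :
    (volume : Measure V).toSphere {ω | inner ℝ (ω : V) η = t} = 0 := by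
  have hn : ‖η‖ ≠ 0 := norm_ne_zero_iff.2 hη
  obtain ⟨c, -, -, hc⟩ := lintegral_sphere_zonal hd (e := ‖η‖⁻¹ • η) (by simp [norm_smul, hn])
  have h := hc (({t / ‖η‖} : Set ℝ).indicator fun _ => 1)
    (measurable_const.indicator (measurableSet_singleton _))
  have hset : MeasurableSet {ω : sphere (0 : V) 1 | inner ℝ (ω : V) η = t} :=
    measurableSet_eq_fun (by fun_prop) measurable_const
  rw [← lintegral_indicator_one hset]
  have h1 : ∀ ω : sphere (0 : V) 1,
      ({ω : sphere (0 : V) 1 | inner ℝ (ω : V) η = t}.indicator 1 ω : ℝ≥0∞) =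
      (({t / ‖η‖} : Set ℝ).indicator fun _ => 1) (inner ℝ (ω : V) (‖η‖⁻¹ • η)) := by
    intro ω
    have : inner ℝ (ω : V) η = t ↔ inner ℝ (ω : V) (‖η‖⁻¹ • η) = t / ‖η‖ := by
      rw [inner_smul_right, eq_div_iff hn]
      field_simp
    simp only [indicator, mem_ofPred_eq, mem_singleton_iff, this, Pi.one_apply]
  rw [lintegral_congr h1, h, mul_eq_zero]
  right
  rw [lintegral_eq_zero_iff (by
    exact ((by fun_prop : Measurable fun θ : ℝ => ENNReal.ofReal (Real.sin θ ^ (finrank ℝ V - 2)))).mul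
      ((measurable_const.indicator (measurableSet_singleton _)).comp Real.measurable_cos))]
  have hsub : ({θ : ℝ | θ ∈ Ioo 0 Real.pi ∧ Real.cos θ = t / ‖η‖}).Subsingleton := by
    rintro a ⟨ha, ha'⟩ b ⟨hb, hb'⟩
    exact Real.injOn_cos (Ioo_subset_Icc_self ha) (Ioo_subset_Icc_self hb) (ha'.trans hb'.symm)
  have h0 : volume {θ : ℝ | θ ∈ Ioo 0 Real.pi ∧ Real.cos θ = t / ‖η‖} = 0 :=
    hsub.measure_zero _
  refine (ae_restrict_iff' measurableSet_Ioo).2 ?_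
  filter_upwards [measure_eq_zero_iff_ae_notMem.1 h0] with θ hθ hθ'
  simp only [Pi.zero_apply]
  rw [indicator_of_notMem, mul_zero]
  exact fun hc => hθ ⟨hθ', hc⟩

theorem integral_cos_half_pow (n : ℕ) :
    ∫ θ in (0 : ℝ)..Real.pi, Real.cos (θ / 2) ^ n = ∫ θ in (0 : ℝ)..Real.pi, Real.sin θ ^ n := by
  rw [intervalIntegral.integral_comp_div (fun θ => Real.cos θ ^ n) two_ne_zero, zero_div,
    EulerSine.integral_cos_pow_eq]
  simp

theorem norm_sub_sq_of_unit {ω e : V} (hω : ‖ω‖ = 1) (he : ‖e‖ = 1) :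
    ‖ω - e‖ ^ 2 = 2 - 2 * inner ℝ ω e := by
  rw [norm_sub_sq_real, hω, he]; ring

/-- The squared chord is 2 - 2 cos θ = (2 sin(θ/2))² and sin θ = 2 sin(θ/2) cos(θ/2), so the
singular half-angle sine cancels exactly. -/
theorem half_angle_rpow {θ : ℝ} (hθ : θ ∈ Ioo 0 Real.pi) (n : ℕ) :
    Real.sin θ ^ n * (2 - 2 * Real.cos θ) ^ (-(n : ℝ) / 2) = Real.cos (θ / 2) ^ n := by
  have h2 : 0 < Real.sin (θ / 2) :=
    Real.sin_pos_of_mem_Ioo ⟨by linarith [hθ.1], by linarith [hθ.2, Real.pi_pos]⟩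
  have h3 : 2 - 2 * Real.cos θ = (2 * Real.sin (θ / 2)) ^ 2 := by
    have := Real.cos_two_mul (θ / 2)
    rw [mul_div_cancel₀ θ two_ne_zero] at this
    nlinarith [Real.sin_sq_add_cos_sq (θ / 2)]
  have h4 : Real.sin θ = 2 * Real.sin (θ / 2) * Real.cos (θ / 2) := by
    rw [← Real.sin_two_mul, mul_div_cancel₀ θ two_ne_zero]
  rw [h3, ← Real.rpow_natCast_mul (by positivity), h4, mul_pow]
  push_cast
  rw [show (2 : ℝ) * (-(n : ℝ) / 2) = -(n : ℝ) by ring, Real.rpow_neg (by positivity),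
    Real.rpow_natCast]
  field_simp

theorem setLIntegral_Ioo_ofReal {f : ℝ → ℝ} (hf : Continuous f)
    (h0 : ∀ θ ∈ Ioo 0 Real.pi, 0 ≤ f θ) :
    ∫⁻ θ in Ioo 0 Real.pi, ENNReal.ofReal (f θ) =
      ENNReal.ofReal (∫ θ in (0 : ℝ)..Real.pi, f θ) := by
  rw [intervalIntegral.integral_of_le Real.pi_pos.le, integral_Ioc_eq_integral_Ioo,
    ofReal_integral_eq_lintegral_ofReal]
  · exact (hf.integrableOn_Icc).mono_set Ioo_subset_Icc_self
  · exact (ae_restrict_iff' measurableSet_Ioo).2 (Filter.Eventually.of_forall h0)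

/-- The exponent is the one for which `half_angle_rpow` leaves cos(θ/2)^(d-2), whose integral equals
that of sin(θ)^(d-2) by `integral_cos_half_pow`; thus the chord weight has mean 1. -/
theorem lintegral_sphere_norm_sub_rpow (hd : 2 ≤ finrank ℝ V) {e : V} (he : ‖e‖ = 1) :
    ∫⁻ ω : sphere (0 : V) 1, ENNReal.ofReal ((‖(ω : V) - e‖ ^ 2) ^ ((2 - (finrank ℝ V : ℝ)) / 2))
      ∂(volume : Measure V).toSphere = (volume : Measure V).toSphere univ := by
  obtain ⟨c, -, -, hc⟩ := lintegral_sphere_zonal hd he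
  have h1 := hc (fun _ => 1) measurable_const
  have h2 := hc (fun u => ENNReal.ofReal ((2 - 2 * u) ^ ((2 - (finrank ℝ V : ℝ)) / 2)))
    (by fun_prop)
  simp only [lintegral_one, mul_one] at h1
  simp_rw [fun ω : sphere (0 : V) 1 => norm_sub_sq_of_unit (ω := (ω : V)) (by simp) he]
  rw [h1, h2]
  congr 1
  obtain ⟨n, hn⟩ := Nat.exists_eq_add_of_le hd
  rw [hn, show 2 + n - 2 = n by omega, setLIntegral_Ioo_ofReal (by fun_prop) fun θ hθ =>
    pow_nonneg (Real.sin_pos_of_mem_Ioo hθ).le _, ← integral_cos_half_pow,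
    ← setLIntegral_Ioo_ofReal (by fun_prop) fun θ hθ =>
    pow_nonneg (Real.cos_nonneg_of_mem_Icc ⟨by linarith [hθ.1, Real.pi_pos],
      by linarith [hθ.2]⟩) _]
  refine setLIntegral_congr_fun measurableSet_Ioo fun θ hθ => ?_
  rw [← half_angle_rpow hθ, ← ENNReal.ofReal_mul (pow_nonneg (Real.sin_pos_of_mem_Ioo hθ).le _)]
  push_cast
  ring_nf

/-- One more power of the squared chord is a further factor 4 sin²(θ/2) = 4 - 4 cos²(θ/2), whose
mean against cos(θ/2)^(d-2) is 4/d by the reduction formula for sine powers. -/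
theorem lintegral_sphere_norm_sub_rpow' (hd : 2 ≤ finrank ℝ V) {e : V} (he : ‖e‖ = 1) :
    ∫⁻ ω : sphere (0 : V) 1, ENNReal.ofReal ((‖(ω : V) - e‖ ^ 2) ^ ((4 - (finrank ℝ V : ℝ)) / 2))
      ∂(volume : Measure V).toSphere =
        ENNReal.ofReal (4 / finrank ℝ V) * (volume : Measure V).toSphere univ := by
  obtain ⟨c, -, -, hc⟩ := lintegral_sphere_zonal hd he
  have h1 := hc (fun _ => 1) measurable_const
  have h2 := hc (fun u => ENNReal.ofReal ((2 - 2 * u) ^ ((4 - (finrank ℝ V : ℝ)) / 2)))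
    (by fun_prop)
  simp only [lintegral_one, mul_one] at h1
  simp_rw [fun ω : sphere (0 : V) 1 => norm_sub_sq_of_unit (ω := (ω : V)) (by simp) he]
  rw [h1, h2, mul_left_comm]
  congr 1
  obtain ⟨n, hn⟩ := Nat.exists_eq_add_of_le hd
  have hcos : ∀ θ ∈ Ioo 0 Real.pi, 0 ≤ Real.cos (θ / 2) := fun θ hθ =>
    Real.cos_nonneg_of_mem_Icc ⟨by linarith [hθ.1, Real.pi_pos], by linarith [hθ.2]⟩
  rw [hn, show 2 + n - 2 = n by omega, setLIntegral_Ioo_ofReal (by fun_prop) fun θ hθ =>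
    pow_nonneg (Real.sin_pos_of_mem_Ioo hθ).le _, ← ENNReal.ofReal_mul (by positivity)]
  have h3 : (4 / ((2 + n : ℕ) : ℝ)) * ∫ θ in (0 : ℝ)..Real.pi, Real.sin θ ^ n =
      ∫ θ in (0 : ℝ)..Real.pi, 4 * (Real.cos (θ / 2) ^ n - Real.cos (θ / 2) ^ (n + 2)) := by
    rw [intervalIntegral.integral_const_mul, intervalIntegral.integral_sub
      (Continuous.intervalIntegrable (by fun_prop) _ _)
      (Continuous.intervalIntegrable (by fun_prop) _ _), integral_cos_half_pow,
      integral_cos_half_pow, integral_sin_pow]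
    simp
    field_simp
    ring
  rw [h3, ← setLIntegral_Ioo_ofReal (by fun_prop) fun θ hθ => by
    have h4 := pow_nonneg (hcos θ hθ) n
    have h5 : Real.cos (θ / 2) ^ n - Real.cos (θ / 2) ^ (n + 2) =
      Real.cos (θ / 2) ^ n * Real.sin (θ / 2) ^ 2 := by rw [Real.sin_sq]; ring
    rw [h5]; positivity]
  refine setLIntegral_congr_fun measurableSet_Ioo fun θ hθ => ?_
  rw [← ENNReal.ofReal_mul (pow_nonneg (Real.sin_pos_of_mem_Ioo hθ).le _)]
  congr 1
  have h6 : 2 - 2 * Real.cos θ = 4 * Real.sin (θ / 2) ^ 2 := by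
    have := Real.cos_two_mul (θ / 2)
    rw [mul_div_cancel₀ θ two_ne_zero] at this
    nlinarith [Real.sin_sq_add_cos_sq (θ / 2)]
  have h7 : 0 < Real.sin (θ / 2) :=
    Real.sin_pos_of_mem_Ioo ⟨by linarith [hθ.1], by linarith [hθ.2, Real.pi_pos]⟩
  have h8 : 0 < 2 - 2 * Real.cos θ := by rw [h6]; positivity
  rw [show (4 - ((2 + n : ℕ) : ℝ)) / 2 = 1 + -(n : ℝ) / 2 by push_cast; ring,
    Real.rpow_add h8, Real.rpow_one, mul_left_comm, half_angle_rpow hθ, h6, Real.sin_sq]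
  ring

end Polar

end KleinGordon

namespace KleinGordon

set_option linter.unusedSectionVars false

attribute [fun_prop] ENNReal.continuous_ofReal

/-! ### Averages over thin spherical shells of variable thickness -/

noncomputable section Shell

open Set Metric Module Filter Topology

variable {V : Type*} [NormedAddCommGroup V] [InnerProductSpace ℝ V] [FiniteDimensional ℝ V]
  [MeasurableSpace V] [BorelSpace V]

theorem lintegral_comp_affine (g : ℝ → ℝ≥0∞) (a : ℝ) {N : ℝ} (hN : 0 < N) :
    ENNReal.ofReal N * ∫⁻ v, g v = ∫⁻ w, g (a + w / N) := by
  have himg : (fun w : ℝ => a + w / N) '' univ = univ := by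
    rw [image_univ, range_eq_univ]
    intro v
    exact ⟨(v - a) * N, by field_simp; ring⟩
  have := lintegral_image_eq_lintegral_abs_deriv_mul (f := fun w : ℝ => a + w / N)
    (f' := fun _ => 1 / N) MeasurableSet.univ
    (fun w _ => (((hasDerivAt_id w).div_const N).const_add a).hasDerivWithinAt)
    (fun b _ c _ hbc => by
      have := add_left_cancel hbc
      field_simp at this
      exact this) g
  rw [himg, setLIntegral_univ, setLIntegral_univ, lintegral_const_mul' _ _ (by simp)] at this
  rw [this, ← mul_assoc, ← ENNReal.ofReal_mul hN.le, abs_of_pos (by positivity)]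
  rw [mul_one_div_cancel hN.ne', ENNReal.ofReal_one, one_mul]

/-- The average of `G` over the shell `|‖z‖² - k²| < c(z) / (n + 1)`. -/
def shellAverage (G c : V → ℝ) (k : ℝ) (n : ℕ) : ℝ≥0∞ :=
  ENNReal.ofReal ((n + 1) / 2) * ∫⁻ z : V, {z : V | |‖z‖ ^ 2 - k ^ 2| < (n + 1 : ℝ)⁻¹ * c z}.indicator
    (fun z => ENNReal.ofReal (G z)) z

/-- The integrand of `shellAverage` in rescaled polar coordinates. -/
def shellIntegrand (G c : V → ℝ) (k : ℝ) (n : ℕ) (p : sphere (0 : V) 1 × ℝ) : ℝ≥0∞ :=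
  {p : sphere (0 : V) 1 × ℝ | 0 < k ^ 2 + p.2 / (n + 1) ∧
    |p.2| < c (Real.sqrt (k ^ 2 + p.2 / (n + 1)) • (p.1 : V))}.indicator
    (fun p => ENNReal.ofReal (Real.sqrt (k ^ 2 + p.2 / (n + 1)) ^ (finrank ℝ V - 2) / 4 *
      G (Real.sqrt (k ^ 2 + p.2 / (n + 1)) • (p.1 : V)))) p

theorem measurable_shellIntegrand {G c : V → ℝ} (hG : Continuous G) (hc : Continuous c)
    (k : ℝ) (n : ℕ) : Measurable (shellIntegrand G c k n) := by
  refine Measurable.indicator (Continuous.measurable (by fun_prop)) ?_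
  rw [ofPred_and]
  refine MeasurableSet.inter (measurableSet_lt measurable_const ?_) (measurableSet_lt ?_ ?_)
  all_goals exact Continuous.measurable (by fun_prop)

/-- Write ‖z‖² = k² + w/(n + 1). The factor n + 1 is absorbed by the change of variables, and the
shell becomes the region |w| < c, which depends on n only through the argument of c. The 4 is the 2
of the average times the 2 of `lintegral_polar_sq`. -/
theorem shellAverage_eq (hd : 2 ≤ finrank ℝ V) {G c : V → ℝ} (hG : Continuous G)
    (hc : Continuous c) (k : ℝ) (n : ℕ) :
    shellAverage G c k n =
      ∫⁻ p, shellIntegrand G c k n p ∂((volume : Measure V).toSphere.prod volume) := by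
  have hN : (0 : ℝ) < n + 1 := by positivity
  have hmeas : MeasurableSet {z : V | |‖z‖ ^ 2 - k ^ 2| < (n + 1 : ℝ)⁻¹ * c z} :=
    measurableSet_lt (by fun_prop) (by fun_prop)
  rw [shellAverage, lintegral_polar_sq hd (Measurable.indicator (by fun_prop) hmeas),
    lintegral_prod _ (measurable_shellIntegrand hG hc k n).aemeasurable,
    ← lintegral_const_mul' _ _ (by simp)]
  refine lintegral_congr fun ω => ?_
  rw [← lintegral_indicator measurableSet_Ioi, div_eq_mul_inv, ENNReal.ofReal_mul hN.le,
    mul_comm (ENNReal.ofReal (n + 1 : ℝ)), mul_assoc, lintegral_comp_affine _ (k ^ 2) hN,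
    ← lintegral_const_mul' _ _ (by simp)]
  refine lintegral_congr fun w => ?_
  simp only [shellIntegrand]
  by_cases h0 : 0 < k ^ 2 + w / (n + 1)
  · have hω : ‖(ω : V)‖ = 1 := by simp
    rw [indicator_of_mem (mem_Ioi.2 h0)]
    have hiff : |‖Real.sqrt (k ^ 2 + w / (n + 1)) • (ω : V)‖ ^ 2 - k ^ 2| <
        (n + 1 : ℝ)⁻¹ * c (Real.sqrt (k ^ 2 + w / (n + 1)) • (ω : V)) ↔
        |w| < c (Real.sqrt (k ^ 2 + w / (n + 1)) • (ω : V)) := by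
      rw [norm_smul, hω, mul_one, Real.norm_of_nonneg (Real.sqrt_nonneg _), Real.sq_sqrt h0.le,
        add_sub_cancel_left, abs_div, abs_of_pos hN, div_eq_inv_mul,
        mul_lt_mul_iff_right₀ (inv_pos.2 hN)]
    by_cases h1 : |w| < c (Real.sqrt (k ^ 2 + w / (n + 1)) • (ω : V))
    · rw [indicator_of_mem (by exact hiff.2 h1), indicator_of_mem (by exact ⟨h0, h1⟩),
        ← ENNReal.ofReal_mul (by positivity), ← ENNReal.ofReal_mul (by positivity)]
      congr 1
      ring
    · rw [indicator_of_notMem (by exact fun h => h1 (hiff.1 h)),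
        indicator_of_notMem (by exact fun h => h1 h.2)]
      simp
  · rw [indicator_of_notMem (by exact h0), indicator_of_notMem (by exact fun h => h0 h.1),
      mul_zero]

section

variable {G c : V → ℝ} {R B C : ℝ} (hR : ∀ z, R < ‖z‖ → G z = 0) (hB0 : 0 ≤ B)
  (hB : ∀ z, G z ≤ B) (hC : ∀ z, ‖z‖ ≤ R → c z ≤ C)
include hR hB0 hB hC

/-- Where G does not vanish the radius is at most R, so the thickness is at most C. The bound is
uniform in n, for dominated convergence in the shell width, and in k, for dominated convergence over
pairs of momenta. -/
theorem shellIntegrand_le (k : ℝ) (n : ℕ) (p : sphere (0 : V) 1 × ℝ) :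
    shellIntegrand G c k n p ≤ (univ ×ˢ Ioo (-C) C).indicator
      (fun _ => ENNReal.ofReal (R ^ (finrank ℝ V - 2) / 4 * B)) p := by
  unfold shellIntegrand
  refine indicator_le' (fun p hp => ?_) (fun _ _ => zero_le) p
  obtain ⟨h0, h1⟩ := hp
  set r := Real.sqrt (k ^ 2 + p.2 / (n + 1)) with hr
  have hn : ‖r • (p.1 : V)‖ = r := by
    have : ‖(p.1 : V)‖ = 1 := by simp
    rw [norm_smul, this, mul_one, Real.norm_of_nonneg (Real.sqrt_nonneg _)]
  by_cases hrR : r ≤ R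
  · have h2 := abs_lt.1 (h1.trans_le (hC _ (by rwa [hn])))
    rw [indicator_of_mem (by exact ⟨mem_univ _, h2⟩)]
    have hr0 : 0 ≤ r := Real.sqrt_nonneg _
    refine ENNReal.ofReal_le_ofReal ?_
    exact (mul_le_mul_of_nonneg_left (hB _) (by positivity)).trans (by gcongr)
  · rw [hR _ (by rw [hn]; exact not_le.1 hrR)]
    simp

theorem shellAverage_le (hd : 2 ≤ finrank ℝ V) (hG : Continuous G) (hc : Continuous c) (k : ℝ)
    (n : ℕ) :
    shellAverage G c k n ≤ ENNReal.ofReal (R ^ (finrank ℝ V - 2) / 4 * B) *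
      ((volume : Measure V).toSphere univ * ENNReal.ofReal (2 * C)) := by
  rw [shellAverage_eq hd hG hc]
  refine (lintegral_mono (shellIntegrand_le hR hB0 hB hC k n)).trans ?_
  rw [lintegral_indicator (MeasurableSet.univ.prod measurableSet_Ioo), lintegral_const,
    Measure.restrict_apply_univ, Measure.prod_prod, Real.volume_Ioo]
  ring_nf
  exact le_rfl

/-- Dominated convergence: in the variable w the shells tend to the interval |w| < c(kω), whose
length 2c(kω) turns the 1/4 of `shellIntegrand` into 1/2. -/
theorem tendsto_shellAverage (hd : 2 ≤ finrank ℝ V) (hG : Continuous G) (hc : Continuous c)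
    (hc0 : ∀ z, 0 ≤ c z) {k : ℝ} (hk : 0 < k) :
    Tendsto (shellAverage G c k) atTop (𝓝 (∫⁻ ω : sphere (0 : V) 1,
      ENNReal.ofReal (k ^ (finrank ℝ V - 2) / 2 * (c (k • (ω : V)) * G (k • (ω : V))))
        ∂(volume : Measure V).toSphere)) := by
  have hlim : (∫⁻ ω : sphere (0 : V) 1,
      ENNReal.ofReal (k ^ (finrank ℝ V - 2) / 2 * (c (k • (ω : V)) * G (k • (ω : V))))
        ∂(volume : Measure V).toSphere) = ∫⁻ p : sphere (0 : V) 1 × ℝ,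
      (Ioo (-c (k • (p.1 : V))) (c (k • (p.1 : V)))).indicator (fun _ =>
        ENNReal.ofReal (k ^ (finrank ℝ V - 2) / 4 * G (k • (p.1 : V)))) p.2
        ∂((volume : Measure V).toSphere.prod volume) := by
    rw [lintegral_prod _ (by
      have : (fun p : sphere (0 : V) 1 × ℝ =>
        (Ioo (-c (k • (p.1 : V))) (c (k • (p.1 : V)))).indicator (fun _ =>
        ENNReal.ofReal (k ^ (finrank ℝ V - 2) / 4 * G (k • (p.1 : V)))) p.2) =
        ({p : sphere (0 : V) 1 × ℝ | -c (k • (p.1 : V)) < p.2} ∩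
          {p : sphere (0 : V) 1 × ℝ | p.2 < c (k • (p.1 : V))}).indicator (fun p =>
          ENNReal.ofReal (k ^ (finrank ℝ V - 2) / 4 * G (k • (p.1 : V)))) := by
        ext p
        simp only [indicator, mem_Ioo, mem_inter_iff, mem_ofPred_eq]
      rw [this]
      refine (Measurable.indicator (Continuous.measurable (by fun_prop)) ?_).aemeasurable
      refine MeasurableSet.inter (measurableSet_lt ?_ ?_) (measurableSet_lt ?_ ?_)
      all_goals exact Continuous.measurable (by fun_prop))]
    refine lintegral_congr fun ω => ?_
    simp only []
    rw [lintegral_indicator measurableSet_Ioo, lintegral_const, Measure.restrict_apply_univ,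
      Real.volume_Ioo, ← ENNReal.ofReal_mul' (by linarith [hc0 (k • (ω : V))])]
    congr 1
    ring
  rw [hlim]
  simp_rw [funext (shellAverage_eq hd hG hc k)]
  refine tendsto_lintegral_of_dominated_convergence _
    (fun n => measurable_shellIntegrand hG hc k n)
    (fun n => Eventually.of_forall (shellIntegrand_le hR hB0 hB hC k n)) ?_ ?_
  · rw [lintegral_indicator (MeasurableSet.univ.prod measurableSet_Ioo), lintegral_const,
      Measure.restrict_apply_univ, Measure.prod_prod, Real.volume_Ioo]
    exact ENNReal.mul_ne_top (by simp) (ENNReal.mul_ne_top (measure_ne_top _ _) (by simp))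
  -- the boundary of the limiting shell is a null set
  have hnull : ∀ᵐ p : sphere (0 : V) 1 × ℝ ∂((volume : Measure V).toSphere.prod volume),
      |p.2| ≠ c (k • (p.1 : V)) := by
    have hms : MeasurableSet {p : sphere (0 : V) 1 × ℝ | |p.2| ≠ c (k • (p.1 : V))} :=
      (measurableSet_eq_fun (f := fun p : sphere (0 : V) 1 × ℝ => |p.2|)
        (g := fun p => c (k • (p.1 : V))) (Continuous.measurable (by fun_prop))
        (Continuous.measurable (by fun_prop))).compl
    rw [Measure.ae_prod_iff_ae_ae hms]
    refine Eventually.of_forall fun ω => ?_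
    have hfin : ({c (k • (ω : V)), -c (k • (ω : V))} : Set ℝ).Finite := by simp
    filter_upwards [measure_eq_zero_iff_ae_notMem.1 (hfin.measure_zero volume)] with w hw h
    refine hw ?_
    rcases abs_choice w with h' | h'
    · left; rw [← h, h']
    · right; rw [mem_singleton_iff, ← h, h']; ring
  filter_upwards [hnull] with p hp
  have hr : Tendsto (fun n : ℕ => Real.sqrt (k ^ 2 + p.2 / (n + 1))) atTop (𝓝 k) := by
    have h1 : Tendsto (fun n : ℕ => k ^ 2 + p.2 / ((n : ℝ) + 1)) atTop (𝓝 (k ^ 2 + 0)) := by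
      refine tendsto_const_nhds.add ?_
      have := (tendsto_one_div_add_atTop_nhds_zero_nat (𝕜 := ℝ)).const_mul p.2
      simpa [div_eq_mul_inv] using this
    have := (Real.continuous_sqrt.tendsto _).comp h1
    rwa [add_zero, Real.sqrt_sq hk.le] at this
  have hpos : ∀ᶠ n : ℕ in atTop, 0 < k ^ 2 + p.2 / ((n : ℝ) + 1) := by
    filter_upwards [hr.eventually (lt_mem_nhds hk)] with n hn
    exact Real.sqrt_pos.1 hn
  have hcr := ((hc.comp (continuous_id.smul continuous_const :
    Continuous fun r : ℝ => r • (p.1 : V))).tendsto k).comp hr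
  have hval : Tendsto (fun n : ℕ => ENNReal.ofReal
      (Real.sqrt (k ^ 2 + p.2 / (n + 1)) ^ (finrank ℝ V - 2) / 4 *
      G (Real.sqrt (k ^ 2 + p.2 / (n + 1)) • (p.1 : V)))) atTop
      (𝓝 (ENNReal.ofReal (k ^ (finrank ℝ V - 2) / 4 * G (k • (p.1 : V))))) := by
    have : Continuous fun r : ℝ => ENNReal.ofReal (r ^ (finrank ℝ V - 2) / 4 * G (r • (p.1 : V))) := by
      fun_prop
    exact (this.tendsto k).comp hr
  rcases lt_or_gt_of_ne hp with h | h
  · rw [indicator_of_mem (by exact abs_lt.1 h)]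
    refine hval.congr' ?_
    filter_upwards [hpos, hcr.eventually (lt_mem_nhds h)] with n h1 h2
    rw [shellIntegrand, indicator_of_mem (by exact ⟨h1, h2⟩)]
  · rw [indicator_of_notMem (by exact fun h' => absurd (abs_lt.2 h') (not_lt.2 h.le))]
    refine tendsto_const_nhds.congr' ?_
    filter_upwards [hcr.eventually (gt_mem_nhds h)] with n h2
    rw [shellIntegrand, indicator_of_notMem]
    exact fun h' => absurd h'.2 (not_lt.2 (le_of_lt h2))

end

end Shell

end KleinGordon

namespace KleinGordon

set_option linter.unusedSectionVars false

/-! ### The measure on elastic collisions as a limit over energy windows -/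

noncomputable section Scattering

open Set Metric Module Filter Topology

variable {V : Type*} [NormedAddCommGroup V] [InnerProductSpace ℝ V]

section

variable {X : Type*} [TopologicalSpace X] {f g h : X → V} {m : ℝ}

theorem continuous_boost (hm : 0 < m) (hf : Continuous f) (hg : Continuous g)
    (hh : Continuous h) : Continuous fun p => boost m (f p) (g p) (h p) := by
  unfold boost boostCoeff
  have h1 : Continuous fun p => (invMass m (f p) (g p) *
      (energy m (f p) + energy m (g p) + invMass m (f p) (g p)))⁻¹ := by
    refine Continuous.inv₀ (by fun_prop) fun p => ?_
    have := invMass_pos hm (f p) (g p)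
    have := energy_pos hm (f p)
    have := energy_pos hm (g p)
    positivity
  fun_prop

theorem continuous_shellFactor (hm : 0 < m) (x w : V) : Continuous (shellFactor m x w) := by
  have h1 := continuous_boost hm (continuous_const (y := x)) (continuous_const (y := w))
    (continuous_id (X := V))
  have h2 : Continuous (outEnergy m x w) := by unfold outEnergy; fun_prop
  have h3 : Continuous (boostTime m x w) := by unfold boostTime; fun_prop
  unfold shellFactor
  refine Continuous.mul (by fun_prop) (continuous_const.sub (Continuous.div (by fun_prop)
    (by fun_prop) fun z => ?_))
  have := outEnergy_pos hm x w z
  positivity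

end

/-- The boost as a linear map. -/
def boostMap (m : ℝ) (x w : V) : V →ₗ[ℝ] V :=
  LinearMap.transvection (boostCoeff m x w • (innerₛₗ ℝ (x + w))) (x + w)

theorem boostMap_apply (m : ℝ) (x w z : V) : boostMap m x w z = boost m x w z := by
  simp only [boostMap, LinearMap.transvection.apply, boost, LinearMap.smul_apply,
    innerₛₗ_apply_apply, smul_eq_mul]

variable [FiniteDimensional ℝ V]

/-- A transvection has determinant 1 + (coefficient)·|P|², which `boostCoeff_mul` evaluates. -/
theorem det_boostMap {m : ℝ} (hm : 0 < m) (x w : V) :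
    LinearMap.det (boostMap m x w) = (energy m x + energy m w) / invMass m x w := by
  have h := boostCoeff_mul hm x w
  have hM := invMass_pos hm x w
  rw [boostMap, LinearMap.transvection.det, eq_div_iff hM.ne']
  simp only [LinearMap.smul_apply, innerₛₗ_apply_apply, real_inner_self_eq_norm_sq, smul_eq_mul]
  linarith

/-- The incoming pair is itself an outgoing pair: the boost is invertible, so solve for half the
difference. Energy is then conserved trivially, and `shell_identity` forces z onto the shell. -/
theorem exists_boost_eq {m : ℝ} (hm : 0 < m) (x w : V) :
    ∃ z : V, ‖z‖ = cmMomentum m x w ∧ (2⁻¹ : ℝ) • (x + w) + boost m x w z = x ∧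
      (2⁻¹ : ℝ) • (x + w) - boost m x w z = w := by
  have hdet : LinearMap.det (boostMap m x w) ≠ 0 := by
    rw [det_boostMap hm]
    have := invMass_pos hm x w
    have := energy_pos hm x
    have := energy_pos hm w
    positivity
  obtain ⟨z, hz⟩ := (LinearMap.equivOfDetNeZero (boostMap m x w) hdet).surjective
    ((2⁻¹ : ℝ) • (x - w))
  have hz' : boost m x w z = (2⁻¹ : ℝ) • (x - w) := by rw [← boostMap_apply]; exact hz
  have h1 : (2⁻¹ : ℝ) • (x + w) + boost m x w z = x := by rw [hz']; module
  have h2 : (2⁻¹ : ℝ) • (x + w) - boost m x w z = w := by rw [hz']; module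
  refine ⟨z, ?_, h1, h2⟩
  have h3 := shell_identity hm x w z
  rw [outEnergy, h1, h2, sub_self, zero_mul, sub_eq_zero] at h3
  exact (sq_eq_sq₀ (norm_nonneg _) (cmMomentum_nonneg _ _ _)).1 h3

variable [MeasurableSpace V] [BorelSpace V]

theorem lintegral_boost {m : ℝ} (hm : 0 < m) (x w : V) {h : V → ℝ≥0∞} (hh : Measurable h) :
    ∫⁻ y, h y = ENNReal.ofReal ((energy m x + energy m w) / invMass m x w) *
      ∫⁻ z, h ((2⁻¹ : ℝ) • (x + w) + boost m x w z) := by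
  have hD : 0 < (energy m x + energy m w) / invMass m x w := by
    have := invMass_pos hm x w
    have := energy_pos hm x
    have := energy_pos hm w
    positivity
  have hmap := Measure.map_linearMap_addHaar_eq_smul_addHaar (volume : Measure V)
    (f := boostMap m x w) (by rw [det_boostMap hm]; exact hD.ne')
  have hmeas : Measurable (boostMap m x w) :=
    (LinearMap.continuous_of_finiteDimensional _).measurable
  have h1 : ∫⁻ z, h ((2⁻¹ : ℝ) • (x + w) + boost m x w z) =
      ∫⁻ y, h ((2⁻¹ : ℝ) • (x + w) + y) ∂(Measure.map (boostMap m x w) volume) := by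
    rw [lintegral_map (by fun_prop) hmeas]
    simp_rw [boostMap_apply]
  rw [h1, hmap, lintegral_smul_measure, lintegral_add_left_eq_self h, det_boostMap hm, smul_eq_mul,
    ← mul_assoc, ← ENNReal.ofReal_mul hD.le, abs_of_pos (inv_pos.2 hD), mul_inv_cancel₀ hD.ne',
    ENNReal.ofReal_one, one_mul]

/-- The momentum of the first outgoing particle, when particles of momenta `x` and `w` collide
elastically and `ω` is the outgoing direction in the centre-of-mass frame. -/
def outFst (m : ℝ) (x w : V) (ω : sphere (0 : V) 1) : V :=
  (2⁻¹ : ℝ) • (x + w) + boost m x w (cmMomentum m x w • (ω : V))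

/-- The momentum of the second outgoing particle. -/
def outSnd (m : ℝ) (x w : V) (ω : sphere (0 : V) 1) : V :=
  (2⁻¹ : ℝ) • (x + w) - boost m x w (cmMomentum m x w • (ω : V))

/-- The density of the invariant measure on elastic collisions. -/
def scatterDensity (m : ℝ) (p : (V × V) × sphere (0 : V) 1) : ℝ≥0∞ :=
  ENNReal.ofReal (cmMomentum m p.1.1 p.1.2 ^ (finrank ℝ V - 2) / invMass m p.1.1 p.1.2 *
    (energy m (outFst m p.1.1 p.1.2 p.2) * energy m (outSnd m p.1.1 p.1.2 p.2)))

/-- The collision of momenta `x` and `w` in direction `ω`, ordered as `((x, x'), (w', w))`. -/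
def scatterMap (m : ℝ) (p : (V × V) × sphere (0 : V) 1) : (V × V) × (V × V) :=
  ((p.1.1, outFst m p.1.1 p.1.2 p.2), (outSnd m p.1.1 p.1.2 p.2, p.1.2))

/-- The measure `δ(e(x) + e(w) - e(x') - e(w')) δ(x + w - x' - w')` on elastic collisions. -/
def scatterMeasure (m : ℝ) : Measure ((V × V) × (V × V)) :=
  (((volume : Measure (V × V)).prod (volume : Measure V).toSphere).withDensity
    (scatterDensity m)).map (scatterMap m)

variable {m : ℝ} (hm : 0 < m)

theorem norm_cmMomentum_smul (x w : V) (ω : sphere (0 : V) 1) :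
    ‖cmMomentum m x w • (ω : V)‖ = cmMomentum m x w := by
  have : ‖(ω : V)‖ = 1 := by simp
  rw [norm_smul, this, mul_one, Real.norm_of_nonneg (cmMomentum_nonneg _ _ _)]

include hm

theorem energy_out (x w : V) (ω : sphere (0 : V) 1) :
    energy m (outFst m x w ω) + energy m (outSnd m x w ω) = energy m x + energy m w :=
  energy_boost_add_energy_boost hm x w _ (norm_cmMomentum_smul x w ω)

theorem measurable_outFst :
    Measurable fun p : (V × V) × sphere (0 : V) 1 => outFst m p.1.1 p.1.2 p.2 := by
  unfold outFst
  have := continuous_boost hm (X := (V × V) × sphere (0 : V) 1) (f := fun p => p.1.1)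
    (g := fun p => p.1.2) (h := fun p => cmMomentum m p.1.1 p.1.2 • (p.2 : V))
    (by fun_prop) (by fun_prop) (by fun_prop)
  exact Continuous.measurable (by fun_prop)

theorem measurable_outSnd :
    Measurable fun p : (V × V) × sphere (0 : V) 1 => outSnd m p.1.1 p.1.2 p.2 := by
  unfold outSnd
  have := continuous_boost hm (X := (V × V) × sphere (0 : V) 1) (f := fun p => p.1.1)
    (g := fun p => p.1.2) (h := fun p => cmMomentum m p.1.1 p.1.2 • (p.2 : V))
    (by fun_prop) (by fun_prop) (by fun_prop)
  exact Continuous.measurable (by fun_prop)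

theorem measurable_scatterMap :
    Measurable (scatterMap m : (V × V) × sphere (0 : V) 1 → (V × V) × (V × V)) := by
  have h1 := measurable_outFst hm (V := V)
  have h2 := measurable_outSnd hm (V := V)
  unfold scatterMap
  fun_prop

theorem measurable_scatterDensity :
    Measurable (scatterDensity m : (V × V) × sphere (0 : V) 1 → ℝ≥0∞) := by
  have h1 := measurable_outFst hm (V := V)
  have h2 := measurable_outSnd hm (V := V)
  have h3 : Measurable fun p : (V × V) × sphere (0 : V) 1 => cmMomentum m p.1.1 p.1.2 :=
    Continuous.measurable (by fun_prop)
  have h4 : Measurable fun p : (V × V) × sphere (0 : V) 1 => invMass m p.1.1 p.1.2 :=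
    Continuous.measurable (by fun_prop)
  unfold scatterDensity
  fun_prop

theorem lintegral_scatterMeasure {F : (V × V) × (V × V) → ℝ≥0∞} (hF : Measurable F) :
    ∫⁻ q, F q ∂(scatterMeasure m) = ∫⁻ p : V × V, ∫⁻ ω : sphere (0 : V) 1,
      scatterDensity m (p, ω) * F (scatterMap m (p, ω)) ∂(volume : Measure V).toSphere := by
  have h1 := measurable_scatterMap hm (V := V)
  have h2 := measurable_scatterDensity hm (V := V)
  rw [scatterMeasure, lintegral_map hF h1, lintegral_withDensity_eq_lintegral_mul _ h2 (by fun_prop),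
    lintegral_prod _ (by fun_prop)]
  rfl

omit hm in
theorem ae_fst_ne_snd [Nontrivial V] : ∀ᵐ p : V × V, p.1 ≠ p.2 := by
  have hms : MeasurableSet {p : V × V | p.1 ≠ p.2} :=
    (measurableSet_eq_fun measurable_fst measurable_snd).compl
  rw [Measure.volume_eq_prod, Measure.ae_prod_iff_ae_ae hms]
  refine Eventually.of_forall fun x => ?_
  filter_upwards [measure_eq_zero_iff_ae_notMem.1 (measure_singleton (μ := (volume : Measure V)) x)]
    with w hw h
  exact hw h.symm

/-- The average of `F` over the set where energy conservation is violated by less than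
`1 / (n + 1)`. -/
def energyAverage (m : ℝ) (F : (V × V) × (V × V) → ℝ) (n : ℕ) : ℝ≥0∞ :=
  ∫⁻ p : V × V, ENNReal.ofReal ((n + 1) / 2) * ∫⁻ y : V,
    {y : V | |energy m p.1 + energy m p.2 - energy m y - energy m (p.1 + p.2 - y)| <
      (n + 1 : ℝ)⁻¹}.indicator
      (fun y => ENNReal.ofReal (F ((p.1, y), (p.1 + p.2 - y, p.2)))) y

/-- The affine substitution to centre-of-mass coordinates turns the energy window into a shell by
`abs_outEnergy_sub_lt_iff`, at the price of the Jacobian of the boost. -/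
theorem shellAverage_boost {F : (V × V) × (V × V) → ℝ} (hF : Continuous F) (n : ℕ) (x w : V) :
    ENNReal.ofReal ((n + 1) / 2) * ∫⁻ y : V,
    {y : V | |energy m x + energy m w - energy m y - energy m (x + w - y)| <
      (n + 1 : ℝ)⁻¹}.indicator (fun y => ENNReal.ofReal (F ((x, y), (x + w - y, w)))) y =
    ENNReal.ofReal ((energy m x + energy m w) / invMass m x w) *
      shellAverage (fun z => F ((x, (2⁻¹ : ℝ) • (x + w) + boost m x w z),
        ((2⁻¹ : ℝ) • (x + w) - boost m x w z, w))) (shellFactor m x w) (cmMomentum m x w) n := by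
  have hmeas : MeasurableSet {y : V | |energy m x + energy m w - energy m y -
      energy m (x + w - y)| < (n + 1 : ℝ)⁻¹} :=
    measurableSet_lt (Continuous.measurable (by fun_prop)) measurable_const
  rw [lintegral_boost hm x w (Measurable.indicator (Continuous.measurable (by fun_prop)) hmeas),
    mul_left_comm, shellAverage]
  congr 2
  refine lintegral_congr fun z => ?_
  have h1 : x + w - ((2⁻¹ : ℝ) • (x + w) + boost m x w z) =
      (2⁻¹ : ℝ) • (x + w) - boost m x w z := by module
  have h2 := abs_outEnergy_sub_lt_iff hm x w z (ε := (n + 1 : ℝ)⁻¹)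
  rw [outEnergy, ← sub_sub] at h2
  simp only [indicator, mem_ofPred_eq, h1, h2]

/-- For each pair x ≠ w the inner average converges by `tendsto_shellAverage`, whose hypothesis k >
0 excludes only the null diagonal; dominated convergence over the pairs does the rest. -/
theorem tendsto_energyAverage (hd : 2 ≤ finrank ℝ V) {F : (V × V) × (V × V) → ℝ}
    (hF : Continuous F) {R B : ℝ} (hR0 : 0 ≤ R) (hB0 : 0 ≤ B)
    (hR : ∀ q, F q ≠ 0 → ‖q.1.1‖ ≤ R ∧ ‖q.1.2‖ ≤ R ∧ ‖q.2.1‖ ≤ R ∧ ‖q.2.2‖ ≤ R)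
    (hB : ∀ q, F q ≤ B) :
    Tendsto (energyAverage m F) atTop
      (𝓝 (∫⁻ q, ENNReal.ofReal (F q) ∂(scatterMeasure m))) := by
  have : Nontrivial V := Module.nontrivial_of_finrank_pos (R := ℝ) (by omega)
  rw [lintegral_scatterMeasure hm (by fun_prop)]
  -- A bound for `shellFactor` when all momenta are at most R: incoming energy at most 2m + 2R,
  -- outgoing energy at most 2m + 4R + 2R²/m.
  set C : ℝ := 4 * m + 6 * R + 2 * R ^ 2 / m
  refine tendsto_lintegral_of_dominated_convergence
    ((closedBall (0 : V) R ×ˢ closedBall (0 : V) R).indicator fun _ =>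
      ENNReal.ofReal ((2 * m + 2 * R) / (2 * m)) *
        (ENNReal.ofReal (R ^ (finrank ℝ V - 2) / 4 * B) *
          ((volume : Measure V).toSphere univ * ENNReal.ofReal (2 * C)))) (fun n => ?_) (fun n => ?_)
    ?_ ?_
  · refine Measurable.const_mul ?_ _
    refine Measurable.lintegral_prod_right' (f := fun q : (V × V) × V =>
      {y : V | |energy m q.1.1 + energy m q.1.2 - energy m y - energy m (q.1.1 + q.1.2 - y)| <
      (n + 1 : ℝ)⁻¹}.indicator
      (fun y => ENNReal.ofReal (F ((q.1.1, y), (q.1.1 + q.1.2 - y, q.1.2)))) q.2) ?_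
    have : (fun q : (V × V) × V =>
      {y : V | |energy m q.1.1 + energy m q.1.2 - energy m y - energy m (q.1.1 + q.1.2 - y)| <
      (n + 1 : ℝ)⁻¹}.indicator
      (fun y => ENNReal.ofReal (F ((q.1.1, y), (q.1.1 + q.1.2 - y, q.1.2)))) q.2) =
      {q : (V × V) × V | |energy m q.1.1 + energy m q.1.2 - energy m q.2 -
        energy m (q.1.1 + q.1.2 - q.2)| < (n + 1 : ℝ)⁻¹}.indicator
      (fun q => ENNReal.ofReal (F ((q.1.1, q.2), (q.1.1 + q.1.2 - q.2, q.1.2)))) := by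
      ext q
      simp only [indicator, mem_ofPred_eq]
    rw [this]
    exact Measurable.indicator (Continuous.measurable (by fun_prop))
      (measurableSet_lt (Continuous.measurable (by fun_prop)) measurable_const)
  · refine Eventually.of_forall fun p => ?_
    simp only []
    rw [shellAverage_boost hm hF]
    by_cases hp : p ∈ closedBall (0 : V) R ×ˢ closedBall (0 : V) R
    · rw [indicator_of_mem hp]
      obtain ⟨hx, hw⟩ := hp
      rw [mem_closedBall_zero_iff] at hx hw
      have hE : energy m p.1 + energy m p.2 ≤ 2 * m + 2 * R := by
        linarith [energy_le hm.le p.1, energy_le hm.le p.2]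
      have hM := two_mul_mass_le_invMass hm p.1 p.2
      have hΞ : ‖p.1 + p.2‖ ≤ 2 * R := by linarith [norm_add_le p.1 p.2]
      have hcb := continuous_boost hm (continuous_const (y := p.1)) (continuous_const (y := p.2))
        (continuous_id (X := V))
      simp only [id] at hcb
      gcongr
      refine shellAverage_le (R := R) (C := C) ?_ hB0 (fun z => hB _) ?_ hd ?_
        (continuous_shellFactor hm _ _) _ n
      · intro z hz
        by_contra h0
        obtain ⟨-, h2, h3, -⟩ := hR _ h0
        -- The outgoing momenta differ by twice the boost of z, and a boost does not shorten z;
        -- hence ‖z‖ > R is incompatible with the support of F.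
        have h4 := norm_sub_le ((2⁻¹ : ℝ) • (p.1 + p.2) + boost m p.1 p.2 z)
          ((2⁻¹ : ℝ) • (p.1 + p.2) - boost m p.1 p.2 z)
        rw [add_sub_sub_cancel, ← two_smul ℝ, norm_smul] at h4
        simp only [Real.norm_ofNat] at h4 h2 h3
        have h5 := norm_boost_sq hm p.1 p.2 z
        have h6 : ‖z‖ ≤ ‖boost m p.1 p.2 z‖ :=
          abs_le_of_sq_le_sq' (by nlinarith [sq_nonneg (boostTime m p.1 p.2 z)])
            (norm_nonneg _) |>.2
        linarith
      · intro z hz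
        have h1 := shellFactor_le hm p.1 p.2 z
        have ht : |boostTime m p.1 p.2 z| ≤ R ^ 2 / m := by
          rw [boostTime, abs_div, abs_of_pos (invMass_pos hm _ _)]
          calc _ ≤ (2 * R * R) / (2 * m) := by
                gcongr
                exact (abs_real_inner_le_norm _ _).trans (by gcongr)
            _ = _ := by field_simp
        have h5 := norm_boost_sq hm p.1 p.2 z
        have h6 : ‖boost m p.1 p.2 z‖ ≤ R + R ^ 2 / m := by
          refine abs_le_of_sq_le_sq' ?_ (by positivity) |>.2
          rw [h5, ← sq_abs (boostTime _ _ _ _)]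
          have := abs_nonneg (boostTime m p.1 p.2 z)
          nlinarith [norm_nonneg z]
        have h7 : outEnergy m p.1 p.2 z ≤ 2 * m + 2 * R + 2 * (R + R ^ 2 / m) := by
          have h8 : ‖(2⁻¹ : ℝ) • (p.1 + p.2)‖ ≤ R := by
            rw [norm_smul]; norm_num; linarith
          have h9 := energy_le hm.le ((2⁻¹ : ℝ) • (p.1 + p.2) + boost m p.1 p.2 z)
          have h10 := energy_le hm.le ((2⁻¹ : ℝ) • (p.1 + p.2) - boost m p.1 p.2 z)
          have h11 := norm_add_le ((2⁻¹ : ℝ) • (p.1 + p.2)) (boost m p.1 p.2 z)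
          have h12 := norm_sub_le ((2⁻¹ : ℝ) • (p.1 + p.2)) (boost m p.1 p.2 z)
          unfold outEnergy
          linarith
        have : C = 4 * m + 6 * R + 2 * (R ^ 2 / m) := by simp only [C]; ring
        linarith
      · fun_prop
    · rw [indicator_of_notMem hp]
      have h0 : ∀ z, F ((p.1, (2⁻¹ : ℝ) • (p.1 + p.2) + boost m p.1 p.2 z),
          ((2⁻¹ : ℝ) • (p.1 + p.2) - boost m p.1 p.2 z, p.2)) = 0 := by
        intro z
        by_contra h0
        obtain ⟨h1, -, -, h4⟩ := hR _ h0
        exact hp ⟨mem_closedBall_zero_iff.2 h1, mem_closedBall_zero_iff.2 h4⟩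
      simp only [shellAverage, h0, ENNReal.ofReal_zero, indicator_zero, lintegral_zero, mul_zero,
        le_refl]
  · rw [lintegral_indicator (measurableSet_closedBall.prod measurableSet_closedBall),
      lintegral_const, Measure.restrict_apply_univ, Measure.volume_eq_prod, Measure.prod_prod]
    have h1 : (volume : Measure V) (closedBall (0 : V) R) ≠ ∞ := measure_closedBall_lt_top.ne
    have h2 : (volume : Measure V).toSphere univ ≠ ∞ := measure_ne_top _ _
    finiteness
  · filter_upwards [ae_fst_ne_snd (V := V)] with p hp
    have hk := cmMomentum_pos hm hp
    have hcb := continuous_boost hm (continuous_const (y := p.1)) (continuous_const (y := p.2))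
      (continuous_id (X := V))
    simp only [id] at hcb
    simp_rw [shellAverage_boost hm hF]
    have hE := energy_pos hm p.1
    have hE' := energy_pos hm p.2
    have hM := invMass_pos hm p.1 p.2
    have hlim : ∫⁻ ω : sphere (0 : V) 1, scatterDensity m (p, ω) *
        ENNReal.ofReal (F (scatterMap m (p, ω))) ∂(volume : Measure V).toSphere =
        ENNReal.ofReal ((energy m p.1 + energy m p.2) / invMass m p.1 p.2) *
        ∫⁻ ω : sphere (0 : V) 1, ENNReal.ofReal (cmMomentum m p.1 p.2 ^ (finrank ℝ V - 2) / 2 *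
          (shellFactor m p.1 p.2 (cmMomentum m p.1 p.2 • (ω : V)) *
          F ((p.1, (2⁻¹ : ℝ) • (p.1 + p.2) + boost m p.1 p.2 (cmMomentum m p.1 p.2 • (ω : V))),
            ((2⁻¹ : ℝ) • (p.1 + p.2) - boost m p.1 p.2 (cmMomentum m p.1 p.2 • (ω : V)), p.2))))
          ∂(volume : Measure V).toSphere := by
      rw [← lintegral_const_mul' _ _ (by simp)]
      refine lintegral_congr fun ω => ?_
      -- The Jacobian E/M times half of the shell factor 2ab/E, with a, b the outgoing energies, is
      -- ab/M: this explains the form of `scatterDensity`.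
      have h1 := shellFactor_eq hm p.1 p.2 _ (norm_cmMomentum_smul p.1 p.2 ω)
      have h2 := energy_pos hm (outFst m p.1 p.2 ω)
      have h3 := energy_pos hm (outSnd m p.1 p.2 ω)
      rw [scatterDensity, ← ENNReal.ofReal_mul (by positivity),
        ← ENNReal.ofReal_mul (by positivity)]
      congr 1
      simp only [scatterMap, outFst, outSnd]
      generalize F _ = f
      set a := energy m ((2⁻¹ : ℝ) • (p.1 + p.2) + boost m p.1 p.2 (cmMomentum m p.1 p.2 • (ω : V)))
      set b := energy m ((2⁻¹ : ℝ) • (p.1 + p.2) - boost m p.1 p.2 (cmMomentum m p.1 p.2 • (ω : V)))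
      field_simp
      linear_combination (-f) * h1
    rw [hlim]
    refine ENNReal.Tendsto.const_mul ?_ (Or.inr (by simp))
    obtain ⟨C', hC'⟩ := ((isCompact_closedBall (0 : V) R).image
      (continuous_shellFactor hm p.1 p.2)).bddAbove
    refine tendsto_shellAverage (R := R) (C := C') ?_ hB0 (fun z => hB _) ?_ hd ?_
      (continuous_shellFactor hm _ _) (fun z => (shellFactor_pos hm _ _ z).le) hk
    · intro z hz
      by_contra h0
      obtain ⟨-, h2, h3, -⟩ := hR _ h0
      have h4 := norm_sub_le ((2⁻¹ : ℝ) • (p.1 + p.2) + boost m p.1 p.2 z)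
        ((2⁻¹ : ℝ) • (p.1 + p.2) - boost m p.1 p.2 z)
      rw [add_sub_sub_cancel, ← two_smul ℝ, norm_smul] at h4
      simp only [Real.norm_ofNat] at h4 h2 h3
      have h5 := norm_boost_sq hm p.1 p.2 z
      have h6 : ‖z‖ ≤ ‖boost m p.1 p.2 z‖ :=
        abs_le_of_sq_le_sq' (by nlinarith [sq_nonneg (boostTime m p.1 p.2 z)])
          (norm_nonneg _) |>.2
      linarith
    · intro z hz
      exact hC' ⟨z, mem_closedBall_zero_iff.2 hz, rfl⟩
    · fun_prop

end Scattering

end KleinGordon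

namespace KleinGordon

set_option linter.unusedSectionVars false

/-! ### Absolute continuity of the momentum-energy transfer -/

noncomputable section Transfer

open Set Metric Module Filter Topology
open scoped NNReal

/-- On D the function f has a C-Lipschitz inverse, and Lipschitz images enlarge one-dimensional
Hausdorff measure by at most C; no derivative of f is needed. -/
theorem volume_inter_preimage_le {D B : Set ℝ} {f : ℝ → ℝ} {C : ℝ≥0}
    (h : ∀ v ∈ D, ∀ v' ∈ D, |v - v'| ≤ C * |f v - f v'|) :
    volume (D ∩ f ⁻¹' B) ≤ C * volume B := by
  have hinj : InjOn f D := by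
    intro v hv v' hv' hvv
    have := h v hv v' hv'
    rw [hvv, sub_self, abs_zero, mul_zero] at this
    exact sub_eq_zero.1 (abs_eq_zero.1 (le_antisymm this (abs_nonneg _)))
  set g := Function.invFunOn f D
  have hg : ∀ v ∈ D, g (f v) = v := fun v hv => hinj.leftInvOn_invFunOn hv
  have himg : g '' (f '' (D ∩ f ⁻¹' B)) = D ∩ f ⁻¹' B := by
    rw [image_image]
    refine (image_congr fun v hv => hg v hv.1).trans (image_id' _)
  have hlip : LipschitzOnWith C g (f '' (D ∩ f ⁻¹' B)) := by
    refine LipschitzOnWith.of_dist_le_mul ?_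
    rintro _ ⟨v, hv, rfl⟩ _ ⟨v', hv', rfl⟩
    rw [hg v hv.1, hg v' hv'.1, Real.dist_eq, Real.dist_eq]
    exact h v hv.1 v' hv'.1
  have := hlip.hausdorffMeasure_image_le (d := 1) zero_le_one
  rw [himg, hausdorffMeasure_real, ENNReal.rpow_one] at this
  refine this.trans ?_
  gcongr
  rintro _ ⟨v, hv, rfl⟩
  exact hv.2

variable {V : Type*} [NormedAddCommGroup V] [InnerProductSpace ℝ V]

/-- The momentum and energy transfer. -/
def transfer (m : ℝ) (p : V × V) : V × ℝ := (p.1 - p.2, energy m p.1 - energy m p.2)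

theorem continuous_transfer (m : ℝ) : Continuous (transfer m : V × V → V × ℝ) := by
  unfold transfer; fun_prop

/-- The pairs of momenta of size at most `R` with energy transfer at least `δ`. -/
def goodPairs (m R δ : ℝ) : Set (V × V) :=
  {p | ‖p.1‖ ≤ R ∧ ‖p.2‖ ≤ R ∧ δ ≤ |energy m p.1 - energy m p.2|}

/-- Let τ be the difference and σ the sum of the two energies. Then τσ = 2⟨ξ, y⟩ and σ² + τ² =
4(‖y‖² + m² + ‖ξ‖²/4); eliminate σ. Along a ray y = √v·ω the result is affine in v, which allows v
to be recovered from τ. -/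
theorem energy_transfer_identity (m : ℝ) (y ξ : V) :
    inner ℝ ξ y ^ 2 - (energy m (y + (2⁻¹ : ℝ) • ξ) - energy m (y - (2⁻¹ : ℝ) • ξ)) ^ 2 * ‖y‖ ^ 2 =
    (energy m (y + (2⁻¹ : ℝ) • ξ) - energy m (y - (2⁻¹ : ℝ) • ξ)) ^ 2 * (m ^ 2 + ‖ξ‖ ^ 2 / 4 -
      (energy m (y + (2⁻¹ : ℝ) • ξ) - energy m (y - (2⁻¹ : ℝ) • ξ)) ^ 2 / 4) := by
  have h1 := energy_sq m (y + (2⁻¹ : ℝ) • ξ)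
  have h2 := energy_sq m (y - (2⁻¹ : ℝ) • ξ)
  rw [norm_add_sq_real, inner_smul_right, real_inner_comm, norm_smul, mul_pow] at h1
  rw [norm_sub_sq_real, inner_smul_right, real_inner_comm, norm_smul, mul_pow] at h2
  set a := energy m (y + (2⁻¹ : ℝ) • ξ)
  set b := energy m (y - (2⁻¹ : ℝ) • ξ)
  norm_num at h1 h2
  have h3 : (a - b) * (a + b) = 2 * inner ℝ ξ y := by linear_combination h1 - h2
  have h4 : (a + b) ^ 2 + (a - b) ^ 2 = 4 * (‖y‖ ^ 2 + m ^ 2 + ‖ξ‖ ^ 2 / 4) := by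
    linear_combination 2 * h1 + 2 * h2
  have h5 : ((a - b) * (a + b)) ^ 2 = 4 * inner ℝ ξ y ^ 2 := by rw [h3]; ring
  linear_combination (-1 / 4) * h5 + (a - b) ^ 2 / 4 * h4

variable {m : ℝ} (hm : 0 < m)
include hm

/-- By `energy_transfer_identity`, v(⟨ξ, ω⟩² - τ²) = τ²(m² + ‖ξ‖²/4 - τ²/4). Subtracting two
instances gives (v - v')(⟨ξ, ω⟩² - τ²) = (τ - τ')·(bounded), and the factor on the left is bounded
below because |τ| ≥ δ and v ≤ R². -/
theorem abs_sq_norm_sub_le {R δ : ℝ} (hR : 0 < R) (hδ : 0 < δ) (ξ : V) {ω : V} (hω : ‖ω‖ = 1)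
    {v v' : ℝ} (hv0 : 0 < v) (hv0' : 0 < v')
    (hv : (Real.sqrt v • ω + (2⁻¹ : ℝ) • ξ, Real.sqrt v • ω - (2⁻¹ : ℝ) • ξ) ∈ goodPairs m R δ)
    (hv' : (Real.sqrt v' • ω + (2⁻¹ : ℝ) • ξ, Real.sqrt v' • ω - (2⁻¹ : ℝ) • ξ) ∈
      goodPairs m R δ) :
    |v - v'| ≤ (4 * R * (m ^ 2 + 2 * R ^ 2) * R ^ 2 / (δ ^ 2 * m ^ 2)) *
      |(energy m (Real.sqrt v • ω + (2⁻¹ : ℝ) • ξ) - energy m (Real.sqrt v • ω - (2⁻¹ : ℝ) • ξ)) -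
      (energy m (Real.sqrt v' • ω + (2⁻¹ : ℝ) • ξ) -
        energy m (Real.sqrt v' • ω - (2⁻¹ : ℝ) • ξ))| := by
  have key : ∀ u : ℝ, 0 < u →
      (Real.sqrt u • ω + (2⁻¹ : ℝ) • ξ, Real.sqrt u • ω - (2⁻¹ : ℝ) • ξ) ∈ goodPairs m R δ →
      ∃ τ : ℝ, energy m (Real.sqrt u • ω + (2⁻¹ : ℝ) • ξ) -
        energy m (Real.sqrt u • ω - (2⁻¹ : ℝ) • ξ) = τ ∧ δ ^ 2 ≤ τ ^ 2 ∧ τ ^ 2 ≤ ‖ξ‖ ^ 2 ∧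
        ‖ξ‖ ≤ 2 * R ∧ u ≤ R ^ 2 ∧ |τ| ≤ 2 * R ∧
        u * (inner ℝ ξ ω ^ 2 - τ ^ 2) = τ ^ 2 * (m ^ 2 + ‖ξ‖ ^ 2 / 4 - τ ^ 2 / 4) := by
    rintro u hu ⟨h1, h2, h3⟩
    have hyn : ‖Real.sqrt u • ω‖ = Real.sqrt u := by
      rw [norm_smul, hω, mul_one, Real.norm_of_nonneg (Real.sqrt_nonneg _)]
    have h4 := energy_transfer_identity m (Real.sqrt u • ω) ξ
    have h5 := abs_energy_sub_le hm (Real.sqrt u • ω + (2⁻¹ : ℝ) • ξ)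
      (Real.sqrt u • ω - (2⁻¹ : ℝ) • ξ)
    have h6 : Real.sqrt u • ω + (2⁻¹ : ℝ) • ξ - (Real.sqrt u • ω - (2⁻¹ : ℝ) • ξ) = ξ := by module
    rw [h6] at h5
    have h7 : ‖ξ‖ ≤ 2 * R := by
      rw [← h6]; exact (norm_sub_le _ _).trans (by simp only at h1 h2; linarith)
    have h8 : (2 : ℝ) * Real.sqrt u ≤ 2 * R := by
      have h9 := norm_add_le (Real.sqrt u • ω + (2⁻¹ : ℝ) • ξ) (Real.sqrt u • ω - (2⁻¹ : ℝ) • ξ)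
      rw [add_add_sub_cancel, ← two_smul ℝ, norm_smul, hyn, Real.norm_ofNat] at h9
      simp only at h1 h2
      linarith
    refine ⟨_, rfl, ?_, ?_, h7, ?_, h5.trans h7, ?_⟩
    · rw [← sq_abs (energy m _ - _)]; simp only at h3; gcongr
    · rw [← sq_abs (energy m _ - _)]; gcongr
    · rw [← Real.sq_sqrt hu.le]
      have := Real.sqrt_nonneg u
      gcongr
      linarith
    · rw [← h4, hyn, inner_smul_right, mul_pow, Real.sq_sqrt hu.le]; ring
  obtain ⟨τ, hτ, h1, h2, h3, h4, h5, h6⟩ := key v hv0 hv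
  obtain ⟨τ', hτ', h1', h2', -, h4', h5', h6'⟩ := key v' hv0' hv'
  rw [hτ, hτ']
  set a := inner ℝ ξ ω ^ 2
  have hid : (v - v') * (a - τ ^ 2) =
      (τ - τ') * ((τ + τ') * (m ^ 2 + ‖ξ‖ ^ 2 / 4 - (τ ^ 2 + τ' ^ 2) / 4 + v')) := by
    linear_combination h6 - h6'
  -- The positive mass enters here: τ² ≤ ‖ξ‖² makes the bracket in the identity at least m².
  have hlow : δ ^ 2 * m ^ 2 ≤ R ^ 2 * (a - τ ^ 2) := by
    have h7 : δ ^ 2 * m ^ 2 ≤ v * (a - τ ^ 2) := by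
      rw [h6]
      have : m ^ 2 ≤ m ^ 2 + ‖ξ‖ ^ 2 / 4 - τ ^ 2 / 4 := by linarith
      gcongr
    have h8 : 0 ≤ a - τ ^ 2 := by
      by_contra hneg
      have : v * (a - τ ^ 2) < 0 := mul_neg_of_pos_of_neg hv0 (not_le.1 hneg)
      nlinarith [sq_nonneg (δ * m)]
    exact h7.trans (by gcongr)
  have hup : |(τ + τ') * (m ^ 2 + ‖ξ‖ ^ 2 / 4 - (τ ^ 2 + τ' ^ 2) / 4 + v')| ≤
      4 * R * (m ^ 2 + 2 * R ^ 2) := by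
    rw [abs_mul]
    gcongr
    · exact (abs_add_le _ _).trans (by linarith)
    · have : ‖ξ‖ ^ 2 ≤ (2 * R) ^ 2 := by gcongr
      rw [abs_le]
      constructor <;> nlinarith [sq_nonneg τ, sq_nonneg τ', sq_nonneg m, sq_nonneg R]
  have hpos : 0 < δ ^ 2 * m ^ 2 := by positivity
  rw [div_mul_eq_mul_div, le_div_iff₀ hpos]
  calc |v - v'| * (δ ^ 2 * m ^ 2) ≤ |v - v'| * (R ^ 2 * (a - τ ^ 2)) := by gcongr
    _ = R ^ 2 * |(v - v') * (a - τ ^ 2)| := by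
      have : 0 ≤ a - τ ^ 2 := by
        by_contra hneg
        nlinarith [not_le.1 hneg, pow_pos hR 2]
      rw [abs_mul, abs_of_nonneg this]; ring
    _ = R ^ 2 * (|τ - τ'| * |(τ + τ') * (m ^ 2 + ‖ξ‖ ^ 2 / 4 - (τ ^ 2 + τ' ^ 2) / 4 + v')|) := by
      rw [hid, abs_mul (τ - τ')]
    _ ≤ R ^ 2 * (|τ - τ'| * (4 * R * (m ^ 2 + 2 * R ^ 2))) := by gcongr
    _ = _ := by ring

variable [FiniteDimensional ℝ V] [MeasurableSpace V] [BorelSpace V]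

omit hm in
theorem lintegral_relative {f : V × V → ℝ≥0∞} (hf : Measurable f) :
    ∫⁻ p, f p = ∫⁻ ξ : V, ∫⁻ y : V, f (y + (2⁻¹ : ℝ) • ξ, y - (2⁻¹ : ℝ) • ξ) := by
  rw [Measure.volume_eq_prod, lintegral_prod_symm _ hf.aemeasurable]
  calc ∫⁻ y : V, ∫⁻ x : V, f (x, y) = ∫⁻ y : V, ∫⁻ ξ : V, f (y + ξ, y) :=
        lintegral_congr fun y => (lintegral_add_left_eq_self (fun x => f (x, y)) y).symm
    _ = ∫⁻ ξ : V, ∫⁻ y : V, f (y + ξ, y) := lintegral_lintegral_swap (by fun_prop)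
    _ = _ := by
      refine lintegral_congr fun ξ => ?_
      rw [← lintegral_sub_right_eq_self _ ((2⁻¹ : ℝ) • ξ)]
      refine lintegral_congr fun y => ?_
      congr 2
      module

theorem measurableSet_goodPairs (R δ : ℝ) : MeasurableSet (goodPairs m R δ : Set (V × V)) := by
  unfold goodPairs
  rw [ofPred_and, ofPred_and]
  refine MeasurableSet.inter ?_ (MeasurableSet.inter ?_ ?_)
  all_goals
    refine measurableSet_le ?_ ?_ <;> exact Continuous.measurable (by fun_prop)

/-- Fix the momentum transfer ξ and put the mean momentum in polar coordinates; on each ray the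
energy transfer has a Lipschitz inverse by `abs_sq_norm_sub_le`. So on `goodPairs` the push-forward
of Lebesgue measure has a bounded density. -/
theorem exists_volume_transfer_le (hd : 2 ≤ finrank ℝ V) {R δ : ℝ} (hR : 0 < R) (hδ : 0 < δ) :
    ∃ C : ℝ≥0∞, C ≠ ∞ ∧ ∀ B : Set (V × ℝ), MeasurableSet B →
      volume (goodPairs m R δ ∩ transfer m ⁻¹' B) ≤ C * volume B := by
  set C₁ : ℝ := 4 * R * (m ^ 2 + 2 * R ^ 2) * R ^ 2 / (δ ^ 2 * m ^ 2)
  have hC₁ : 0 ≤ C₁ := by positivity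
  refine ⟨ENNReal.ofReal (R ^ (finrank ℝ V - 2) / 2) * ENNReal.ofReal C₁ *
    (volume : Measure V).toSphere univ, ?_, fun B hB => ?_⟩
  · have := measure_ne_top (volume : Measure V).toSphere univ
    finiteness
  have hS : MeasurableSet (goodPairs m R δ ∩ transfer m ⁻¹' B : Set (V × V)) :=
    (measurableSet_goodPairs hm R δ).inter ((continuous_transfer m).measurable hB)
  rw [← lintegral_indicator_one hS, lintegral_relative (measurable_one.indicator hS)]
  have hBξ : ∀ ξ : V, MeasurableSet (Prod.mk ξ ⁻¹' B) := fun ξ => measurable_prodMk_left hB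
  have hin : ∀ ξ : V, ∫⁻ y : V, (goodPairs m R δ ∩ transfer m ⁻¹' B).indicator 1
      (y + (2⁻¹ : ℝ) • ξ, y - (2⁻¹ : ℝ) • ξ) ≤
      ENNReal.ofReal (R ^ (finrank ℝ V - 2) / 2) * ENNReal.ofReal C₁ *
        (volume : Measure V).toSphere univ * volume (Prod.mk ξ ⁻¹' B) := by
    intro ξ
    have hmeas : Measurable fun y : V => (goodPairs m R δ ∩ transfer m ⁻¹' B).indicator
        (1 : V × V → ℝ≥0∞) (y + (2⁻¹ : ℝ) • ξ, y - (2⁻¹ : ℝ) • ξ) :=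
      (measurable_one.indicator hS).comp (by fun_prop)
    rw [lintegral_polar_sq hd hmeas]
    have hω : ∀ ω : sphere (0 : V) 1, (∫⁻ v in Ioi (0 : ℝ),
        ENNReal.ofReal (Real.sqrt v ^ (finrank ℝ V - 2) / 2) *
        (goodPairs m R δ ∩ transfer m ⁻¹' B).indicator 1
        (Real.sqrt v • (ω : V) + (2⁻¹ : ℝ) • ξ, Real.sqrt v • (ω : V) - (2⁻¹ : ℝ) • ξ)) ≤
        ENNReal.ofReal (R ^ (finrank ℝ V - 2) / 2) * (ENNReal.ofReal C₁ *
          volume (Prod.mk ξ ⁻¹' B)) := by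
      intro ω
      have hω1 : ‖(ω : V)‖ = 1 := by simp
      set D : Set ℝ := {v | 0 < v ∧ (Real.sqrt v • (ω : V) + (2⁻¹ : ℝ) • ξ,
        Real.sqrt v • (ω : V) - (2⁻¹ : ℝ) • ξ) ∈ goodPairs m R δ} with hD
      set f : ℝ → ℝ := fun v => energy m (Real.sqrt v • (ω : V) + (2⁻¹ : ℝ) • ξ) -
        energy m (Real.sqrt v • (ω : V) - (2⁻¹ : ℝ) • ξ) with hf
      have hfm : Measurable f := Continuous.measurable (by fun_prop)
      have hDm : MeasurableSet D := by
        refine (measurableSet_lt measurable_const measurable_id).inter ?_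
        exact (by fun_prop : Measurable fun v : ℝ => (Real.sqrt v • (ω : V) + (2⁻¹ : ℝ) • ξ,
          Real.sqrt v • (ω : V) - (2⁻¹ : ℝ) • ξ)) (measurableSet_goodPairs hm R δ)
      have hvol := volume_inter_preimage_le (D := D) (B := Prod.mk ξ ⁻¹' B) (f := f)
        (C := C₁.toNNReal) (by
          rintro v ⟨hv0, hv⟩ v' ⟨hv0', hv'⟩
          rw [Real.coe_toNNReal _ hC₁]
          exact abs_sq_norm_sub_le hm hR hδ ξ hω1 hv0 hv0' hv hv')
      refine le_trans ?_ (mul_le_mul_right hvol _)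
      rw [← lintegral_indicator measurableSet_Ioi, ← setLIntegral_const,
        ← lintegral_indicator (hDm.inter (hfm (hBξ ξ)))]
      refine lintegral_mono fun v => ?_
      refine indicator_le' (fun v hv => ?_) (fun _ _ => zero_le) v
      by_cases hvm : (Real.sqrt v • (ω : V) + (2⁻¹ : ℝ) • ξ,
        Real.sqrt v • (ω : V) - (2⁻¹ : ℝ) • ξ) ∈ goodPairs m R δ ∩ transfer m ⁻¹' B
      · have hv1 : v ∈ D ∩ f ⁻¹' (Prod.mk ξ ⁻¹' B) := by
          refine ⟨⟨hv, hvm.1⟩, ?_⟩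
          have h1 := hvm.2
          simp only [mem_preimage, transfer] at h1 ⊢
          rwa [show Real.sqrt v • (ω : V) + (2⁻¹ : ℝ) • ξ - (Real.sqrt v • (ω : V) - (2⁻¹ : ℝ) • ξ)
            = ξ by module] at h1
        rw [indicator_of_mem hv1, indicator_of_mem hvm, Pi.one_apply, mul_one]
        refine ENNReal.ofReal_le_ofReal ?_
        have h9 := norm_add_le (Real.sqrt v • (ω : V) + (2⁻¹ : ℝ) • ξ)
          (Real.sqrt v • (ω : V) - (2⁻¹ : ℝ) • ξ)
        rw [add_add_sub_cancel, ← two_smul ℝ, norm_smul, norm_smul, hω1, mul_one,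
          Real.norm_of_nonneg (Real.sqrt_nonneg _), Real.norm_ofNat] at h9
        have h1 := hvm.1.1
        have h2 := hvm.1.2.1
        simp only at h1 h2
        have h3 : Real.sqrt v ≤ R := by linarith
        gcongr
      · rw [indicator_of_notMem hvm, mul_zero]
        exact zero_le
    refine (lintegral_mono hω).trans ?_
    rw [lintegral_const]
    exact le_of_eq (by ring)
  refine (lintegral_mono hin).trans ?_
  rw [lintegral_const_mul _ (measurable_measure_prodMk_left hB), Measure.volume_eq_prod,
    Measure.prod_apply hB]

theorem ae_energy_ne [Nontrivial V] : ∀ᵐ p : V × V, energy m p.1 ≠ energy m p.2 := by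
  have hms : MeasurableSet {p : V × V | energy m p.1 ≠ energy m p.2} :=
    (measurableSet_eq_fun (by fun_prop) (by fun_prop)).compl
  rw [Measure.volume_eq_prod, Measure.ae_prod_iff_ae_ae hms]
  refine Eventually.of_forall fun x => ?_
  have h0 : (volume : Measure V) (sphere 0 ‖x‖) = 0 := Measure.addHaar_sphere _ _ _
  filter_upwards [measure_eq_zero_iff_ae_notMem.1 h0] with w hw h
  refine hw (mem_sphere_zero_iff_norm.2 ?_)
  have h1 := energy_sq m x
  have h2 := energy_sq m w
  rw [h] at h1
  exact (sq_eq_sq₀ (norm_nonneg _) (norm_nonneg _)).1 (by linarith)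

/-- Up to the null set of pairs with equal energies, countably many sets `goodPairs` exhaust all
pairs. -/
theorem map_transfer_absolutelyContinuous (hd : 2 ≤ finrank ℝ V) :
    (volume : Measure (V × V)).map (transfer m) ≪ (volume : Measure (V × ℝ)) := by
  have : Nontrivial V := Module.nontrivial_of_finrank_pos (R := ℝ) (by omega)
  refine Measure.AbsolutelyContinuous.mk fun B hB hB0 => ?_
  rw [Measure.map_apply (continuous_transfer m).measurable hB]
  have hsub : transfer m ⁻¹' B ⊆ {p : V × V | ¬ energy m p.1 ≠ energy m p.2} ∪
      ⋃ n : ℕ, (goodPairs m (n + 1) (n + 1 : ℝ)⁻¹ ∩ transfer m ⁻¹' B) := by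
    intro p hp
    by_cases h : energy m p.1 ≠ energy m p.2
    · right
      have h0 : 0 < |energy m p.1 - energy m p.2| := abs_pos.2 (sub_ne_zero.2 h)
      obtain ⟨n, hn⟩ := exists_nat_ge (max (max ‖p.1‖ ‖p.2‖) |energy m p.1 - energy m p.2|⁻¹)
      simp only [max_le_iff] at hn
      refine mem_iUnion.2 ⟨n, ⟨by linarith [hn.1.1], by linarith [hn.1.2], ?_⟩, hp⟩
      exact inv_le_of_inv_le₀ h0 (by linarith [hn.2])
    · left; exact h
  refine measure_mono_null hsub (measure_union_null (ae_energy_ne hm) ?_)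
  refine measure_iUnion_null fun n => ?_
  obtain ⟨C, -, hC⟩ := exists_volume_transfer_le hm hd (V := V) (R := n + 1) (δ := (n + 1 : ℝ)⁻¹)
    (by positivity) (by positivity)
  refine le_antisymm ((hC B hB).trans ?_) zero_le
  rw [hB0, mul_zero]

/-- The density of the push-forward of `a` under `transfer`. -/
def transferDensity (m : ℝ) (a : V × V → ℝ≥0∞) : V × ℝ → ℝ≥0∞ :=
  ((volume.withDensity a).map (transfer m)).rnDeriv volume

omit hm in
@[fun_prop]
theorem measurable_transferDensity (a : V × V → ℝ≥0∞) : Measurable (transferDensity m a) :=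
  Measure.measurable_rnDeriv _ _

/-- The defining property of the density. Since a need not be integrable, the density may take the
value ∞. -/
theorem lintegral_mul_transferDensity (hd : 2 ≤ finrank ℝ V) {a : V × V → ℝ≥0∞}
    (ha : Measurable a) {Ψ : V × ℝ → ℝ≥0∞} (hΨ : Measurable Ψ) :
    ∫⁻ q, transferDensity m a q * Ψ q = ∫⁻ p, a p * Ψ (transfer m p) := by
  have hac : (volume.withDensity a).map (transfer m) ≪ (volume : Measure (V × ℝ)) :=
    ((withDensity_absolutelyContinuous _ _).map (continuous_transfer m).measurable).trans
      (map_transfer_absolutelyContinuous hm hd)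
  have h1 := Measure.withDensity_rnDeriv_eq _ _ hac
  have h2 : ∫⁻ q, Ψ q ∂(volume.withDensity (transferDensity m a)) =
      ∫⁻ q, Ψ q ∂((volume.withDensity a).map (transfer m)) := by
    rw [← h1]; rfl
  rw [lintegral_withDensity_eq_lintegral_mul _ (measurable_transferDensity a) hΨ,
    lintegral_map hΨ (continuous_transfer m).measurable] at h2
  exact h2.trans (lintegral_withDensity_eq_lintegral_mul _ ha
    (hΨ.comp (continuous_transfer m).measurable))

end Transfer

end KleinGordon

namespace KleinGordon

set_option linter.unusedSectionVars false

/-! ### The pairing of push-forward densities as a limit over energy windows -/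

noncomputable section Duality

open Set Metric Module Filter Topology
open scoped NNReal BoundedContinuousFunction

/-- Lebesgue's differentiation theorem; (n + 1)/2 is the inverse length of the interval of radius
1/(n + 1). -/
theorem tendsto_interval_lintegral_average {h : ℝ → ℝ≥0∞} (hh : Measurable h) {K : ℝ≥0∞}
    (hK : K ≠ ∞) (hle : ∀ᵐ τ, h τ ≤ K) :
    ∀ᵐ τ', Tendsto (fun n : ℕ => ENNReal.ofReal ((n + 1) / 2) *
      ∫⁻ τ, (ball (0 : ℝ) (n + 1 : ℝ)⁻¹).indicator 1 (τ - τ') * h τ) atTop (𝓝 (h τ')) := by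
  have hint : LocallyIntegrable (fun τ => (h τ).toReal) volume := by
    refine (locallyIntegrable_const K.toReal).mono hh.ennreal_toReal.aestronglyMeasurable ?_
    filter_upwards [hle] with τ hτ
    rw [Real.norm_of_nonneg ENNReal.toReal_nonneg, Real.norm_of_nonneg ENNReal.toReal_nonneg]
    exact ENNReal.toReal_mono hK hτ
  filter_upwards [IsUnifLocDoublingMeasure.ae_tendsto_average volume hint 1, hle] with τ' h1 h2
  have hδ : Tendsto (fun n : ℕ => (n + 1 : ℝ)⁻¹) atTop (𝓝[>] 0) := by
    refine tendsto_nhdsWithin_iff.2 ⟨?_, Eventually.of_forall fun n => ?_⟩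
    · simpa [one_div] using tendsto_one_div_add_atTop_nhds_zero_nat (𝕜 := ℝ)
    · exact mem_Ioi.2 (by positivity)
  have h3 := h1 (fun _ : ℕ => τ') _ hδ (Eventually.of_forall fun n => by
    exact mem_closedBall_self (by positivity))
  have h4 := (ENNReal.continuous_ofReal.tendsto _).comp h3
  rw [ENNReal.ofReal_toReal (ne_top_of_le_ne_top hK h2)] at h4
  refine h4.congr fun n => ?_
  have hn : (0 : ℝ) < (n + 1 : ℝ)⁻¹ := by positivity
  have h5 : ∫⁻ τ, (ball (0 : ℝ) (n + 1 : ℝ)⁻¹).indicator 1 (τ - τ') * h τ =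
      ∫⁻ τ in closedBall τ' (n + 1 : ℝ)⁻¹, h τ := by
    rw [Real.closedBall_eq_Icc, ← restrict_Ioo_eq_restrict_Icc,
      ← lintegral_indicator measurableSet_Ioo]
    refine lintegral_congr fun τ => ?_
    have : τ - τ' ∈ ball (0 : ℝ) (n + 1 : ℝ)⁻¹ ↔
        τ ∈ Ioo (τ' - (n + 1 : ℝ)⁻¹) (τ' + (n + 1 : ℝ)⁻¹) := by
      rw [mem_ball_zero_iff, Real.norm_eq_abs, abs_lt, mem_Ioo]
      constructor <;> rintro ⟨_, _⟩ <;> constructor <;> linarith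
    by_cases hτ : τ - τ' ∈ ball (0 : ℝ) (n + 1 : ℝ)⁻¹
    · rw [indicator_of_mem hτ, indicator_of_mem (this.1 hτ), Pi.one_apply, one_mul]
    · rw [indicator_of_notMem hτ, indicator_of_notMem (fun hc => hτ (this.2 hc)), zero_mul]
  have hfin : ∀ᵐ τ ∂(volume.restrict (closedBall τ' (n + 1 : ℝ)⁻¹)), h τ < ∞ :=
    ae_restrict_of_ae (hle.mono fun τ hτ => hτ.trans_lt hK.lt_top)
  simp only [Function.comp]
  rw [h5, setAverage_eq, integral_toReal (by fun_prop) hfin, Real.volume_real_closedBall hn.le,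
    smul_eq_mul, ENNReal.ofReal_mul (by positivity), ENNReal.ofReal_toReal]
  · congr 2
    field_simp
  · refine ne_top_of_le_ne_top ?_ (setLIntegral_mono_ae' measurableSet_closedBall
      (hle.mono fun τ hτ _ => hτ))
    rw [setLIntegral_const]
    exact ENNReal.mul_ne_top hK measure_closedBall_lt_top.ne

variable {V : Type*} [NormedAddCommGroup V] [InnerProductSpace ℝ V] [FiniteDimensional ℝ V]
  [MeasurableSpace V] [BorelSpace V] {m : ℝ} (hm : 0 < m)

theorem lintegral_relative' {f : V × V → ℝ≥0∞} (hf : Measurable f) :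
    ∫⁻ p, f p = ∫⁻ ξ : V, ∫⁻ w : V, f (w + ξ, w) := by
  rw [Measure.volume_eq_prod, lintegral_prod_symm _ hf.aemeasurable]
  calc ∫⁻ y : V, ∫⁻ x : V, f (x, y) = ∫⁻ y : V, ∫⁻ ξ : V, f (y + ξ, y) :=
        lintegral_congr fun y => (lintegral_add_left_eq_self (fun x => f (x, y)) y).symm
    _ = ∫⁻ ξ : V, ∫⁻ y : V, f (y + ξ, y) := lintegral_lintegral_swap (by fun_prop)

include hm

theorem exists_transferDensity_le (hd : 2 ≤ finrank ℝ V) {R δ : ℝ} (hR : 0 < R) (hδ : 0 < δ)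
    {a : V × V → ℝ≥0∞} (ha : Measurable a) {B : ℝ≥0∞} (hB : B ≠ ∞) (hle : ∀ p, a p ≤ B)
    (hsupp : ∀ p ∉ goodPairs m R δ, a p = 0) :
    ∃ K : ℝ≥0∞, K ≠ ∞ ∧ ∀ᵐ q, transferDensity m a q ≤ K := by
  obtain ⟨C, hC, h⟩ := exists_volume_transfer_le hm hd (V := V) hR hδ
  refine ⟨B * C, ENNReal.mul_ne_top hB hC, ?_⟩
  refine ae_le_of_forall_setLIntegral_le_of_sigmaFinite (measurable_transferDensity a)
    fun S hS _ => ?_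
  have h1 := lintegral_mul_transferDensity hm hd ha (Ψ := S.indicator 1)
    (measurable_one.indicator hS)
  have h2 : ∫⁻ q in S, transferDensity m a q = ∫⁻ q, transferDensity m a q * S.indicator 1 q := by
    rw [← lintegral_indicator hS]
    refine lintegral_congr fun q => ?_
    by_cases hq : q ∈ S <;> simp [hq]
  have hms : MeasurableSet (goodPairs m R δ ∩ transfer m ⁻¹' S) :=
    (measurableSet_goodPairs hm R δ).inter ((continuous_transfer m).measurable hS)
  rw [h2, h1, setLIntegral_const]
  calc ∫⁻ p, a p * S.indicator 1 (transfer m p)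
      ≤ ∫⁻ p, (goodPairs m R δ ∩ transfer m ⁻¹' S).indicator (fun _ => B) p := by
        refine lintegral_mono fun p => ?_
        by_cases hp : p ∈ goodPairs m R δ
        · by_cases hq : transfer m p ∈ S
          · rw [indicator_of_mem hq, indicator_of_mem (by exact ⟨hp, hq⟩)]
            simpa using hle p
          · simp [hq]
        · simp [hsupp p hp]
    _ = B * volume (goodPairs m R δ ∩ transfer m ⁻¹' S) := by
        rw [lintegral_indicator hms, setLIntegral_const]
    _ ≤ B * (C * volume S) := by gcongr; exact h S hS
    _ = B * C * volume S := by ring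

/-- Both pairs have the same momentum transfer, and the energy defect is the difference of their
energy transfers. By Fubini's theorem the integral only sees the two push-forwards, one of them
averaged over a window in the energy variable. -/
theorem energyAverage_eq (hd : 2 ≤ finrank ℝ V) {A B : V × V → ℝ} (hA : Continuous A)
    (hB : Continuous B) (hA0 : ∀ p, 0 ≤ A p) (n : ℕ) :
    energyAverage m (fun q : (V × V) × (V × V) => A q.1 * B q.2) n =
      ∫⁻ q : V × ℝ, transferDensity m (fun p => ENNReal.ofReal (B p)) q *
        (ENNReal.ofReal ((n + 1) / 2) * ∫⁻ τ, (ball (0 : ℝ) (n + 1 : ℝ)⁻¹).indicator 1 (τ - q.2) *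
          transferDensity m (fun p => ENNReal.ofReal (A p)) (q.1, τ)) := by
  set E : ℝ → ℝ≥0∞ := (ball (0 : ℝ) (n + 1 : ℝ)⁻¹).indicator 1 with hE
  have hEm : Measurable E := measurable_one.indicator measurableSet_ball
  set a : V × V → ℝ≥0∞ := fun p => ENNReal.ofReal (A p)
  set b : V × V → ℝ≥0∞ := fun p => ENNReal.ofReal (B p)
  have ha : Measurable a := by fun_prop
  have hb : Measurable b := by fun_prop
  set c := ENNReal.ofReal ((n + 1 : ℝ) / 2)
  have hc : c ≠ ∞ := by simp [c]
  have hta := measurable_transferDensity (m := m) a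
  calc energyAverage m (fun q : (V × V) × (V × V) => A q.1 * B q.2) n
      = ∫⁻ p : V × V, c * ∫⁻ y : V, a (p.1, y) * (E ((energy m p.1 - energy m y) -
          (energy m (p.2 + (p.1 - y)) - energy m p.2)) * b (p.2 + (p.1 - y), p.2)) := by
        refine lintegral_congr fun p => ?_
        congr 1
        refine lintegral_congr fun y => ?_
        have h1 : p.1 + p.2 - y = p.2 + (p.1 - y) := by abel
        rw [← h1]
        have h2 : (energy m p.1 - energy m y) - (energy m (p.1 + p.2 - y) - energy m p.2) =
          energy m p.1 + energy m p.2 - energy m y - energy m (p.1 + p.2 - y) := by ring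
        rw [h2, hE]
        simp only [indicator, mem_ofPred_eq, mem_ball_zero_iff, Real.norm_eq_abs]
        split_ifs with h
        · rw [Pi.one_apply, one_mul, ← ENNReal.ofReal_mul (hA0 _)]
        · simp
    _ = c * ∫⁻ x : V, ∫⁻ y : V, ∫⁻ w : V, a (x, y) * (E ((energy m x - energy m y) -
          (energy m (w + (x - y)) - energy m w)) * b (w + (x - y), w)) := by
        rw [lintegral_const_mul' _ _ hc, Measure.volume_eq_prod, lintegral_prod _ (by
          refine (Measurable.lintegral_prod_right' (f := fun r : (V × V) × V =>
            a (r.1.1, r.2) * (E ((energy m r.1.1 - energy m r.2) -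
            (energy m (r.1.2 + (r.1.1 - r.2)) - energy m r.1.2)) *
            b (r.1.2 + (r.1.1 - r.2), r.1.2))) ?_).aemeasurable
          fun_prop)]
        congr 1
        refine lintegral_congr fun x => ?_
        exact lintegral_lintegral_swap (by fun_prop)
    _ = c * ∫⁻ p : V × V, a p * ∫⁻ w : V, E ((transfer m p).2 -
          (energy m (w + (transfer m p).1) - energy m w)) * b (w + (transfer m p).1, w) := by
        rw [Measure.volume_eq_prod, lintegral_prod _ (by
          refine Measurable.aemeasurable (ha.mul ?_)
          refine (Measurable.lintegral_prod_right' (f := fun r : (V × V) × V =>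
            E ((transfer m r.1).2 - (energy m (r.2 + (transfer m r.1).1) - energy m r.2)) *
              b (r.2 + (transfer m r.1).1, r.2)) ?_)
          have := (continuous_transfer (V := V) m).measurable
          fun_prop)]
        congr 1
        refine lintegral_congr fun x => lintegral_congr fun y => ?_
        rw [lintegral_const_mul' _ _ (by simp [a])]
        rfl
    _ = c * ∫⁻ q : V × ℝ, transferDensity m a q * ∫⁻ w : V, E (q.2 -
          (energy m (w + q.1) - energy m w)) * b (w + q.1, w) := by
        rw [lintegral_mul_transferDensity hm hd ha (Ψ := fun q : V × ℝ => ∫⁻ w : V, E (q.2 -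
          (energy m (w + q.1) - energy m w)) * b (w + q.1, w)) (by
          refine (Measurable.lintegral_prod_right' (f := fun r : (V × ℝ) × V =>
            E (r.1.2 - (energy m (r.2 + r.1.1) - energy m r.2)) *
              b (r.2 + r.1.1, r.2)) ?_)
          fun_prop)]
    _ = c * ∫⁻ ξ : V, ∫⁻ τ : ℝ, ∫⁻ w : V, transferDensity m a (ξ, τ) * (E (τ -
          (energy m (w + ξ) - energy m w)) * b (w + ξ, w)) := by
        rw [Measure.volume_eq_prod, lintegral_prod _ (by
          refine Measurable.aemeasurable (hta.mul ?_)
          refine (Measurable.lintegral_prod_right' (f := fun r : (V × ℝ) × V =>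
            E (r.1.2 - (energy m (r.2 + r.1.1) - energy m r.2)) *
              b (r.2 + r.1.1, r.2)) ?_)
          fun_prop)]
        congr 1
        refine lintegral_congr fun ξ => lintegral_congr fun τ => ?_
        rw [lintegral_const_mul _ (by fun_prop)]
    _ = c * ∫⁻ ξ : V, ∫⁻ w : V, b (w + ξ, w) * ∫⁻ τ : ℝ, E (τ -
          (energy m (w + ξ) - energy m w)) * transferDensity m a (ξ, τ) := by
        congr 1
        refine lintegral_congr fun ξ => ?_
        rw [lintegral_lintegral_swap (by fun_prop)]
        refine lintegral_congr fun w => ?_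
        rw [← lintegral_const_mul' _ _ (by simp [b])]
        refine lintegral_congr fun τ => ?_
        ring
    _ = c * ∫⁻ p : V × V, b p * ∫⁻ τ : ℝ, E (τ - (transfer m p).2) *
          transferDensity m a ((transfer m p).1, τ) := by
        rw [lintegral_relative' (f := fun p : V × V => b p * ∫⁻ τ : ℝ, E (τ - (transfer m p).2) *
          transferDensity m a ((transfer m p).1, τ)) (by
          refine hb.mul ?_
          refine (Measurable.lintegral_prod_right' (f := fun r : (V × V) × ℝ =>
            E (r.2 - (transfer m r.1).2) * transferDensity m a ((transfer m r.1).1, r.2)) ?_)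
          have := (continuous_transfer (V := V) m).measurable
          fun_prop)]
        simp only [transfer, add_sub_cancel_left]
    _ = _ := by
        rw [← lintegral_mul_transferDensity hm hd hb (Ψ := fun q : V × ℝ =>
          ∫⁻ τ : ℝ, E (τ - q.2) * transferDensity m a (q.1, τ)) (by
          refine (Measurable.lintegral_prod_right' (f := fun r : (V × ℝ) × ℝ =>
            E (r.2 - r.1.2) * transferDensity m a (r.1.1, r.2)) ?_)
          fun_prop), ← lintegral_const_mul' _ _ hc]
        refine lintegral_congr fun q => ?_
        rw [mul_left_comm]

/-- The density of A is bounded because A lives on `goodPairs`, so its window averages converge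
almost everywhere and boundedly; the density of B is integrable and dominates. -/
theorem tendsto_energyAverage' (hd : 2 ≤ finrank ℝ V) {A B : V × V → ℝ} (hA : Continuous A)
    (hB : Continuous B) (hA0 : ∀ p, 0 ≤ A p) {R δ K : ℝ} (hR : 0 < R) (hδ : 0 < δ)
    (hAK : ∀ p, A p ≤ K) (hAs : ∀ p ∉ goodPairs m R δ, A p = 0)
    (hBi : ∫⁻ p, ENNReal.ofReal (B p) ≠ ∞) :
    Tendsto (energyAverage m (fun q : (V × V) × (V × V) => A q.1 * B q.2)) atTop
      (𝓝 (∫⁻ q, transferDensity m (fun p => ENNReal.ofReal (B p)) q *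
        transferDensity m (fun p => ENNReal.ofReal (A p)) q)) := by
  set a : V × V → ℝ≥0∞ := fun p => ENNReal.ofReal (A p)
  set b : V × V → ℝ≥0∞ := fun p => ENNReal.ofReal (B p)
  have ha : Measurable a := by fun_prop
  have hb : Measurable b := by fun_prop
  have hta := measurable_transferDensity (m := m) a
  obtain ⟨M, hM, hle⟩ := exists_transferDensity_le hm hd hR hδ ha (B := ENNReal.ofReal K)
    (by simp) (fun p => ENNReal.ofReal_le_ofReal (hAK p)) (fun p hp => by simp [a, hAs p hp])
  have hms : MeasurableSet {q : V × ℝ | transferDensity m a q ≤ M} :=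
    measurableSet_le hta measurable_const
  have hle' : ∀ᵐ ξ : V, ∀ᵐ τ : ℝ, transferDensity m a (ξ, τ) ≤ M := by
    rw [Measure.volume_eq_prod, Measure.ae_prod_iff_ae_ae hms] at hle
    exact hle
  set Ψ : ℕ → V × ℝ → ℝ≥0∞ := fun n q => ENNReal.ofReal ((n + 1) / 2) *
    ∫⁻ τ, (ball (0 : ℝ) (n + 1 : ℝ)⁻¹).indicator 1 (τ - q.2) * transferDensity m a (q.1, τ)
  have hΨm : ∀ n, Measurable (Ψ n) := by
    intro n
    refine Measurable.const_mul (Measurable.lintegral_prod_right' (f := fun r : (V × ℝ) × ℝ =>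
      (ball (0 : ℝ) (n + 1 : ℝ)⁻¹).indicator 1 (r.2 - r.1.2) *
        transferDensity m a (r.1.1, r.2)) ?_) _
    have hEm : Measurable ((ball (0 : ℝ) (n + 1 : ℝ)⁻¹).indicator (1 : ℝ → ℝ≥0∞)) :=
      measurable_one.indicator measurableSet_ball
    fun_prop
  have hlim : ∀ᵐ q : V × ℝ, Tendsto (fun n => Ψ n q) atTop (𝓝 (transferDensity m a q)) := by
    rw [Measure.volume_eq_prod, Measure.ae_prod_iff_ae_ae (measurableSet_tendsto_fun hΨm hta)]
    filter_upwards [hle'] with ξ hξ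
    exact tendsto_interval_lintegral_average (h := fun τ => transferDensity m a (ξ, τ))
      (by fun_prop) hM hξ
  have hbound : ∀ n, ∀ᵐ q : V × ℝ, Ψ n q ≤ M := by
    intro n
    rw [Measure.volume_eq_prod,
      Measure.ae_prod_iff_ae_ae (measurableSet_le (hΨm n) measurable_const)]
    filter_upwards [hle'] with ξ hξ
    refine Eventually.of_forall fun τ' => ?_
    calc Ψ n (ξ, τ') ≤ ENNReal.ofReal ((n + 1) / 2) *
          ∫⁻ τ, (ball τ' (n + 1 : ℝ)⁻¹).indicator (fun _ => M) τ := by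
          refine mul_le_mul_right (lintegral_mono_ae ?_) _
          filter_upwards [hξ] with τ hτ
          by_cases h : τ ∈ ball τ' (n + 1 : ℝ)⁻¹
          · have h' : τ - τ' ∈ ball (0 : ℝ) (n + 1 : ℝ)⁻¹ := by
              rw [mem_ball_zero_iff, ← dist_eq_norm]; exact h
            simp [h, h', hτ]
          · have h' : τ - τ' ∉ ball (0 : ℝ) (n + 1 : ℝ)⁻¹ := by
              rw [mem_ball_zero_iff, ← dist_eq_norm]; exact h
            simp [h']
      _ = M := by
          rw [lintegral_indicator measurableSet_ball, setLIntegral_const, Real.volume_ball,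
            mul_left_comm, ← ENNReal.ofReal_mul (by positivity)]
          have : ((n : ℝ) + 1) / 2 * (2 * (n + 1 : ℝ)⁻¹) = 1 := by field_simp
          rw [this, ENNReal.ofReal_one, mul_one]
  simp_rw [funext (energyAverage_eq hm hd hA hB hA0)]
  have htb := measurable_transferDensity (m := m) b
  refine tendsto_lintegral_of_dominated_convergence (fun q => transferDensity m b q * M)
    (fun n => htb.mul (hΨm n)) (fun n => ?_) ?_ ?_
  · filter_upwards [hbound n] with q hq
    gcongr
  · rw [lintegral_mul_transferDensity hm hd hb measurable_const, lintegral_mul_const _ hb]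
    exact ENNReal.mul_ne_top hBi hM
  · have hbf : ∀ᵐ q, transferDensity m b q < ∞ := by
      refine ae_lt_top htb ?_
      have := lintegral_mul_transferDensity hm hd hb (Ψ := fun _ => 1) measurable_const
      simp only [mul_one] at this
      rw [this]
      exact hBi
    filter_upwards [hlim, hbf] with q hq hq'
    exact ENNReal.Tendsto.const_mul hq (Or.inr hq'.ne)

end Duality

end KleinGordon

namespace KleinGordon

set_option linter.unusedSectionVars false

/-! ### The pairing of push-forward densities as an integral over collisions -/

noncomputable section Duality

open Set Metric Module Filter Topology
open scoped NNReal BoundedContinuousFunction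

/-- The series f = ∑ 2⁻ⁿ χₙ is finite everywhere and nonzero almost everywhere for both measures.
They agree after multiplication by f, and f can be divided out. -/
theorem ext_of_withDensity {X : Type*} [MeasurableSpace X] {μ ν : Measure X}
    {χ : ℕ → X → ℝ≥0∞} (hχ : ∀ n, Measurable (χ n)) (h1 : ∀ n x, χ n x ≤ 1)
    (hμ : ∀ᵐ x ∂μ, ∃ n, χ n x ≠ 0) (hν : ∀ᵐ x ∂ν, ∃ n, χ n x ≠ 0)
    (h : ∀ n, μ.withDensity (χ n) = ν.withDensity (χ n)) : μ = ν := by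
  set f : X → ℝ≥0∞ := ∑' n, (2⁻¹ : ℝ≥0∞) ^ n • χ n with hf
  have hfm : ∀ n, Measurable ((2⁻¹ : ℝ≥0∞) ^ n • χ n) := fun n => (hχ n).const_smul _
  have hfmeas : Measurable f := by
    rw [hf]
    have : (∑' n, (2⁻¹ : ℝ≥0∞) ^ n • χ n) = fun x => ∑' n, ((2⁻¹ : ℝ≥0∞) ^ n • χ n) x := by
      ext x
      exact ENNReal.tsum_apply
    rw [this]
    exact Measurable.tsum hfm
  have hfx : ∀ x, f x = ∑' n, (2⁻¹ : ℝ≥0∞) ^ n * χ n x := by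
    intro x
    rw [hf, ENNReal.tsum_apply]
    rfl
  have hfin : ∀ x, f x ≠ ∞ := by
    intro x
    rw [hfx]
    refine ne_top_of_le_ne_top ?_ (ENNReal.tsum_le_tsum (g := fun n => (2⁻¹ : ℝ≥0∞) ^ n) fun n => ?_)
    · rw [ENNReal.tsum_geometric]
      simp
    · exact mul_le_of_le_one_right' (h1 n x)
  have hpos : ∀ x, (∃ n, χ n x ≠ 0) → f x ≠ 0 := by
    rintro x ⟨n, hn⟩
    rw [hfx, Ne, ENNReal.tsum_eq_zero]
    intro h0
    rcases mul_eq_zero.1 (h0 n) with h2 | h2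
    · exact absurd h2 (pow_ne_zero _ (by simp))
    · exact hn h2
  have hd : μ.withDensity f = ν.withDensity f := by
    rw [hf, withDensity_tsum hfm, withDensity_tsum hfm]
    congr 1
    ext1 n
    rw [withDensity_smul _ (hχ n), withDensity_smul _ (hχ n), h n]
  rw [← withDensity_inv_same hfmeas (hμ.mono hpos) (Eventually.of_forall hfin), hd,
    withDensity_inv_same hfmeas (hν.mono hpos) (Eventually.of_forall hfin)]

variable {V : Type*} [NormedAddCommGroup V] [InnerProductSpace ℝ V]

/-- A continuous cutoff to pairs of bounded momenta with non-zero energy transfer. -/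
def cutoff (m : ℝ) (n : ℕ) (p : V × V) : ℝ :=
  min 1 (max 0 (n * |energy m p.1 - energy m p.2| - 1)) *
    (min 1 (max 0 (n - ‖p.1‖)) * min 1 (max 0 (n - ‖p.2‖)))

@[fun_prop]
theorem continuous_cutoff (m : ℝ) (n : ℕ) : Continuous (cutoff m n : V × V → ℝ) := by
  unfold cutoff; fun_prop

theorem cutoff_nonneg (m : ℝ) (n : ℕ) (p : V × V) : 0 ≤ cutoff m n p := by
  unfold cutoff; positivity

theorem cutoff_le_one (m : ℝ) (n : ℕ) (p : V × V) : cutoff m n p ≤ 1 := by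
  unfold cutoff
  refine mul_le_one₀ (min_le_left _ _) (by positivity) (mul_le_one₀ (min_le_left _ _)
    (by positivity) (min_le_left _ _))

/-- Using n + 1 instead of n keeps both parameters of `goodPairs` positive and finite at n = 0. -/
theorem cutoff_ne_zero {m : ℝ} {n : ℕ} {p : V × V} (h : cutoff m n p ≠ 0) :
    p ∈ goodPairs m (n + 1) (n + 1 : ℝ)⁻¹ := by
  unfold cutoff at h
  obtain ⟨h1, h2⟩ := mul_ne_zero_iff.1 h
  obtain ⟨h2, h3⟩ := mul_ne_zero_iff.1 h2
  have key : ∀ {t : ℝ}, min 1 (max 0 t) ≠ 0 → 0 < t := by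
    intro t ht
    by_contra h0
    rw [max_eq_left (not_lt.1 h0)] at ht
    simp at ht
  have h1 := key h1
  have h2 := key h2
  have h3 := key h3
  refine ⟨by linarith, by linarith, ?_⟩
  rw [inv_le_iff_one_le_mul₀ (by positivity)]
  nlinarith [abs_nonneg (energy m p.1 - energy m p.2)]

theorem exists_cutoff_ne_zero {m : ℝ} {p : V × V} (h : energy m p.1 ≠ energy m p.2) :
    ∃ n, cutoff m n p ≠ 0 := by
  have h0 : 0 < |energy m p.1 - energy m p.2| := abs_pos.2 (sub_ne_zero.2 h)
  obtain ⟨n, hn⟩ := exists_nat_gt (max (max ‖p.1‖ ‖p.2‖) |energy m p.1 - energy m p.2|⁻¹)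
  simp only [max_lt_iff] at hn
  have h1 : 1 < n * |energy m p.1 - energy m p.2| := (inv_lt_iff_one_lt_mul₀ h0).1 hn.2
  refine ⟨n, ne_of_gt ?_⟩
  unfold cutoff
  have h2 : 0 < max 0 (n * |energy m p.1 - energy m p.2| - 1) := lt_max_of_lt_right (by linarith)
  have h3 : 0 < max 0 (n - ‖p.1‖) := lt_max_of_lt_right (by linarith [hn.1.1])
  have h4 : 0 < max 0 (n - ‖p.2‖) := lt_max_of_lt_right (by linarith [hn.1.2])
  positivity

variable [FiniteDimensional ℝ V] [MeasurableSpace V] [BorelSpace V] {m : ℝ} (hm : 0 < m)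
include hm

/-- Equal energies of x and x' confine ω to a slice ⟨ω, x + w⟩ = const, a null set unless x + w = 0;
the second pair follows by energy conservation. Hence the cutoffs exhaust the collision measure too.
-/
theorem ae_scatterMeasure_energy_ne (hd : 2 ≤ finrank ℝ V) :
    ∀ᵐ q ∂(scatterMeasure m : Measure ((V × V) × (V × V))),
      energy m q.1.1 ≠ energy m q.1.2 ∧ energy m q.2.1 ≠ energy m q.2.2 := by
  have : Nontrivial V := Module.nontrivial_of_finrank_pos (R := ℝ) (by omega)
  have hms : MeasurableSet {q : (V × V) × (V × V) |
      energy m q.1.1 ≠ energy m q.1.2 ∧ energy m q.2.1 ≠ energy m q.2.2} := by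
    rw [ofPred_and]
    exact (measurableSet_eq_fun (by fun_prop) (by fun_prop)).compl.inter
      (measurableSet_eq_fun (by fun_prop) (by fun_prop)).compl
  rw [scatterMeasure, ae_map_iff (measurable_scatterMap hm).aemeasurable hms]
  refine (withDensity_absolutelyContinuous _ _).ae_le ?_
  refine (Measure.ae_prod_iff_ae_ae (measurable_scatterMap hm hms)).2 ?_
  have hΞ : ∀ᵐ p : V × V, p.1 + p.2 ≠ 0 := by
    have hms' : MeasurableSet {p : V × V | p.1 + p.2 ≠ 0} :=
      (measurableSet_eq_fun (by fun_prop) measurable_const).compl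
    rw [Measure.volume_eq_prod, Measure.ae_prod_iff_ae_ae hms']
    refine Eventually.of_forall fun x => ?_
    filter_upwards [measure_eq_zero_iff_ae_notMem.1
      (measure_singleton (μ := (volume : Measure V)) (-x))] with w hw h
    exact hw (mem_singleton_iff.2 (eq_neg_of_add_eq_zero_right h))
  filter_upwards [hΞ, ae_fst_ne_snd (V := V)] with p hp hne
  have hk := cmMomentum_pos hm hne
  have hM := invMass_pos hm p.1 p.2
  have h0 := toSphere_inner_eq_const hd hp
    ((energy m p.1 - (energy m p.1 + energy m p.2) / 2) * invMass m p.1 p.2 / cmMomentum m p.1 p.2)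
  filter_upwards [measure_eq_zero_iff_ae_notMem.1 h0] with ω hω
  have h1 : energy m p.1 ≠ energy m (outFst m p.1 p.2 ω) := by
    intro h
    rw [outFst, energy_boost_add hm _ _ _ (norm_cmMomentum_smul p.1 p.2 ω), boostTime,
      inner_smul_right] at h
    refine hω ?_
    rw [real_inner_comm, eq_div_iff hk.ne']
    nth_rewrite 1 [h]
    field_simp
    ring
  refine ⟨h1, fun h => h1 ?_⟩
  have := energy_out hm p.1 p.2 ω
  simp only [scatterMap] at h
  linarith

theorem lintegral_cutoff_lt_top (n : ℕ) :
    ∫⁻ p : V × V, ENNReal.ofReal (cutoff m n p) < ∞ := by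
  calc ∫⁻ p : V × V, ENNReal.ofReal (cutoff m n p)
      ≤ ∫⁻ p : V × V, (closedBall (0 : V) (n + 1) ×ˢ closedBall (0 : V) (n + 1)).indicator 1 p := by
        refine lintegral_mono fun p => ?_
        by_cases h : cutoff m n p = 0
        · simp [h]
        · obtain ⟨h1, h2, -⟩ := cutoff_ne_zero h
          rw [indicator_of_mem (by exact ⟨mem_closedBall_zero_iff.2 h1,
            mem_closedBall_zero_iff.2 h2⟩), Pi.one_apply, ← ENNReal.ofReal_one]
          exact ENNReal.ofReal_le_ofReal (cutoff_le_one m n p)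
    _ = volume (closedBall (0 : V) (n + 1)) * volume (closedBall (0 : V) (n + 1)) := by
        rw [lintegral_indicator_one (measurableSet_closedBall.prod measurableSet_closedBall),
          Measure.volume_eq_prod, Measure.prod_prod]
    _ < ∞ := ENNReal.mul_lt_top measure_closedBall_lt_top measure_closedBall_lt_top

/-- For continuous data with cutoffs both limit theorems apply to the same sequence `energyAverage`,
and the limits must agree. -/
theorem lintegral_transferDensity_cutoff (hd : 2 ≤ finrank ℝ V) (f g : V × V →ᵇ ℝ≥0) (n j : ℕ) :
    ∫⁻ q, transferDensity m (fun p => ENNReal.ofReal (cutoff m n p) * f p) q *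
        transferDensity m (fun p => ENNReal.ofReal (cutoff m j p) * g p) q =
      ∫⁻ q, (ENNReal.ofReal (cutoff m n q.1) * f q.1) * (ENNReal.ofReal (cutoff m j q.2) * g q.2)
        ∂(scatterMeasure m) := by
  set Kf : ℝ := ((nndist 0 f : ℝ≥0) : ℝ)
  set Kg : ℝ := ((nndist 0 g : ℝ≥0) : ℝ)
  have hKf : ∀ p, (f p : ℝ) ≤ Kf := fun p => by exact_mod_cast f.apply_le_nndist_zero p
  have hKg : ∀ p, (g p : ℝ) ≤ Kg := fun p => by exact_mod_cast g.apply_le_nndist_zero p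
  set A : V × V → ℝ := fun p => cutoff m n p * f p with hA
  set B : V × V → ℝ := fun p => cutoff m j p * g p with hB
  have hAc : Continuous A := by fun_prop
  have hBc : Continuous B := by fun_prop
  have hA0 : ∀ p, 0 ≤ A p := fun p => mul_nonneg (cutoff_nonneg m n p) (f p).2
  have hB0 : ∀ p, 0 ≤ B p := fun p => mul_nonneg (cutoff_nonneg m j p) (g p).2
  have hAK : ∀ p, A p ≤ Kf := fun p =>
    (mul_le_of_le_one_left (f p).2 (cutoff_le_one m n p)).trans (hKf p)
  have hBK : ∀ p, B p ≤ Kg := fun p =>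
    (mul_le_of_le_one_left (g p).2 (cutoff_le_one m j p)).trans (hKg p)
  have hA1 : (fun p => ENNReal.ofReal (A p)) = fun p => ENNReal.ofReal (cutoff m n p) * f p := by
    ext p
    rw [hA, ENNReal.ofReal_mul (cutoff_nonneg m n p), ENNReal.ofReal_coe_nnreal]
  have hB1 : (fun p => ENNReal.ofReal (B p)) = fun p => ENNReal.ofReal (cutoff m j p) * g p := by
    ext p
    rw [hB, ENNReal.ofReal_mul (cutoff_nonneg m j p), ENNReal.ofReal_coe_nnreal]
  have hAs : ∀ p, A p ≠ 0 → p ∈ goodPairs m (n + 1) (n + 1 : ℝ)⁻¹ := fun p hp =>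
    cutoff_ne_zero (left_ne_zero_of_mul hp)
  have hBs : ∀ p, B p ≠ 0 → p ∈ goodPairs m (j + 1) (j + 1 : ℝ)⁻¹ := fun p hp =>
    cutoff_ne_zero (left_ne_zero_of_mul hp)
  have hBi : ∫⁻ p, ENNReal.ofReal (B p) ≠ ∞ := by
    refine ne_top_of_le_ne_top (ENNReal.mul_ne_top (lintegral_cutoff_lt_top hm (V := V) j).ne
      (ENNReal.ofReal_ne_top (r := Kg))) ?_
    rw [← lintegral_mul_const _ (by fun_prop)]
    refine lintegral_mono fun p => ?_
    rw [← ENNReal.ofReal_mul (cutoff_nonneg m j p)]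
    exact ENNReal.ofReal_le_ofReal (mul_le_mul_of_nonneg_left (hKg p) (cutoff_nonneg m j p))
  have h1 := tendsto_energyAverage' hm hd hAc hBc hA0 (R := n + 1) (δ := (n + 1 : ℝ)⁻¹) (K := Kf)
    (by positivity) (by positivity) hAK (fun p hp => by by_contra h; exact hp (hAs p h)) hBi
  have h2 := tendsto_energyAverage hm hd (F := fun q : (V × V) × (V × V) => A q.1 * B q.2)
    (by fun_prop) (R := n + j + 1) (B := Kf * Kg) (by positivity) (by positivity)
    (fun q hq => by
      obtain ⟨h3, h4⟩ := mul_ne_zero_iff.1 hq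
      obtain ⟨h5, h6, -⟩ := hAs _ h3
      obtain ⟨h7, h8, -⟩ := hBs _ h4
      have : (0 : ℝ) ≤ n := by positivity
      have : (0 : ℝ) ≤ j := by positivity
      refine ⟨?_, ?_, ?_, ?_⟩ <;> linarith)
    (fun q => mul_le_mul (hAK _) (hBK _) (hB0 _) ((hA0 q.1).trans (hAK _)))
  have h3 := tendsto_nhds_unique h1 h2
  rw [hA1, hB1] at h3
  calc _ = _ := lintegral_congr fun q => mul_comm _ _
    _ = _ := h3
    _ = _ := by
      refine lintegral_congr fun q => ?_
      rw [ENNReal.ofReal_mul (hA0 _)]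
      congr 1
      · exact congrFun hA1 q.1
      · exact congrFun hB1 q.2

/-- Bounded continuous functions determine finite measures, and multiplying by a cutoff makes both
measures finite; `ext_of_withDensity` then removes the cutoffs. It upgrades an identity for
continuous functions to one for measurable functions. -/
theorem withDensity_transferDensity_eq (hd : 2 ≤ finrank ℝ V) {b : V × V → ℝ≥0∞}
    {N : Measure (V × V)} (hN : ∀ᵐ p ∂N, energy m p.1 ≠ energy m p.2)
    (hfin : ∃ C : ℝ≥0∞, C ≠ ∞ ∧ ∀ᵐ q : V × ℝ, transferDensity m b q ≤ C)
    (h : ∀ (f : V × V →ᵇ ℝ≥0) (n : ℕ),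
      ∫⁻ q, transferDensity m (fun p => ENNReal.ofReal (cutoff m n p) * f p) q *
        transferDensity m b q = ∫⁻ p, ENNReal.ofReal (cutoff m n p) * f p ∂N) :
    (volume.withDensity fun p => transferDensity m b (transfer m p)) = N := by
  have : Nontrivial V := Module.nontrivial_of_finrank_pos (R := ℝ) (by omega)
  have htr := (continuous_transfer (V := V) m).measurable
  have htb : Measurable fun p => transferDensity m b (transfer m p) :=
    (measurable_transferDensity b).comp htr
  have hχ : ∀ n, Measurable fun p : V × V => ENNReal.ofReal (cutoff m n p) := fun n => by fun_prop
  have hne : ∀ p : V × V, energy m p.1 ≠ energy m p.2 →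
      ∃ n, ENNReal.ofReal (cutoff m n p) ≠ 0 := by
    intro p hp
    obtain ⟨n, hn⟩ := exists_cutoff_ne_zero hp
    exact ⟨n, by simpa using lt_of_le_of_ne (cutoff_nonneg m n p) hn.symm⟩
  have htest : ∀ (n : ℕ) (f : V × V →ᵇ ℝ≥0),
      ∫⁻ p, f p ∂((volume.withDensity fun p => transferDensity m b (transfer m p)).withDensity
        fun p => ENNReal.ofReal (cutoff m n p)) =
      ∫⁻ q, transferDensity m (fun p => ENNReal.ofReal (cutoff m n p) * f p) q *
        transferDensity m b q := by
    intro n f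
    rw [lintegral_mul_transferDensity hm hd (by fun_prop) (measurable_transferDensity b),
      lintegral_withDensity_eq_lintegral_mul _ (hχ n) (by fun_prop),
      lintegral_withDensity_eq_lintegral_mul _ htb (by fun_prop)]
    exact lintegral_congr fun p => mul_comm _ _
  refine ext_of_withDensity hχ (fun n p => ?_) ?_ (hN.mono hne) fun n => ?_
  · rw [← ENNReal.ofReal_one]
    exact ENNReal.ofReal_le_ofReal (cutoff_le_one m n p)
  · exact (withDensity_absolutelyContinuous _ _).ae_le ((ae_energy_ne hm).mono hne)
  · have hf : IsFiniteMeasure ((volume.withDensity fun p =>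
        transferDensity m b (transfer m p)).withDensity
        fun p => ENNReal.ofReal (cutoff m n p)) := by
      refine ⟨?_⟩
      obtain ⟨C, hC, hbC⟩ := hfin
      have h1 := htest n 1
      simp only [BoundedContinuousFunction.coe_one, Pi.one_apply, ENNReal.coe_one, mul_one,
        lintegral_one] at h1
      rw [h1]
      calc ∫⁻ q, transferDensity m (fun p => ENNReal.ofReal (cutoff m n p)) q *
            transferDensity m b q
          ≤ ∫⁻ q, transferDensity m (fun p => ENNReal.ofReal (cutoff m n p)) q * C :=
            lintegral_mono_ae (hbC.mono fun q hq => mul_le_mul_right hq _)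
        _ = (∫⁻ p : V × V, ENNReal.ofReal (cutoff m n p)) * C := by
            rw [lintegral_mul_transferDensity hm hd (hχ n) measurable_const,
              lintegral_mul_const _ (hχ n)]
        _ < ∞ := ENNReal.mul_lt_top (lintegral_cutoff_lt_top hm n) hC.lt_top
    refine ext_of_forall_lintegral_eq_of_IsFiniteMeasure fun f => ?_
    rw [htest, h, lintegral_withDensity_eq_lintegral_mul _ (hχ n) (by fun_prop)]
    rfl

theorem exists_transferDensity_cutoff_le (hd : 2 ≤ finrank ℝ V) (n : ℕ) {g : V × V → ℝ≥0∞}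
    (hg : Measurable g) {K : ℝ≥0} (hK : ∀ p, g p ≤ K) :
    ∃ C : ℝ≥0∞, C ≠ ∞ ∧ ∀ᵐ q : V × ℝ,
      transferDensity m (fun p => ENNReal.ofReal (cutoff m n p) * g p) q ≤ C := by
  refine exists_transferDensity_le hm hd (R := n + 1) (δ := (n + 1 : ℝ)⁻¹) (by positivity)
    (by positivity) (by fun_prop) (ENNReal.coe_ne_top (r := K)) (fun p => ?_) fun p hp => ?_
  · refine (mul_le_of_le_one_left' ?_).trans (hK p)
    rw [← ENNReal.ofReal_one]
    exact ENNReal.ofReal_le_ofReal (cutoff_le_one m n p)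
  · by_contra h
    refine hp (cutoff_ne_zero fun h0 => h ?_)
    rw [h0, ENNReal.ofReal_zero, zero_mul]

/-- The factors are generalised one at a time: the second is still continuous and cut off, so its
density is bounded, and the first is now arbitrary. The identity says that a marginal of the
weighted collision measure has density `transferDensity` of b composed with `transfer`. -/
theorem lintegral_mul_transferDensity_cutoff_right (hd : 2 ≤ finrank ℝ V) (g : V × V →ᵇ ℝ≥0)
    (j : ℕ) {a : V × V → ℝ≥0∞} (ha : Measurable a) :
    ∫⁻ q, transferDensity m a q *
        transferDensity m (fun p => ENNReal.ofReal (cutoff m j p) * g p) q =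
      ∫⁻ q, a q.1 * (ENNReal.ofReal (cutoff m j q.2) * g q.2) ∂(scatterMeasure m) := by
  set b : V × V → ℝ≥0∞ := fun p => ENNReal.ofReal (cutoff m j p) * g p
  have hbm : Measurable b := by fun_prop
  have hb2 : Measurable fun q : (V × V) × (V × V) => b q.2 := hbm.comp measurable_snd
  have ht : Measurable fun p => transferDensity m b (transfer m p) :=
    (measurable_transferDensity b).comp (continuous_transfer (V := V) m).measurable
  have key : (volume.withDensity fun p => transferDensity m b (transfer m p)) =
      ((scatterMeasure m).withDensity fun q => b q.2).map Prod.fst := by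
    refine withDensity_transferDensity_eq hm hd ?_ (exists_transferDensity_cutoff_le hm hd j
      (by fun_prop) (K := nndist 0 g) fun p => by exact_mod_cast g.apply_le_nndist_zero p) ?_
    · refine (ae_map_iff measurable_fst.aemeasurable
        (measurableSet_eq_fun (by fun_prop) (by fun_prop)).compl).2 ?_
      exact (withDensity_absolutelyContinuous _ _).ae_le
        ((ae_scatterMeasure_energy_ne hm hd).mono fun q hq => hq.1)
    · intro f n
      rw [lintegral_transferDensity_cutoff hm hd f g n j, lintegral_map (by fun_prop) (by fun_prop),
        lintegral_withDensity_eq_lintegral_mul _ hb2 (by fun_prop)]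
      exact lintegral_congr fun q => mul_comm _ _
  have h1 := congrArg (fun N : Measure (V × V) => ∫⁻ p, a p ∂N) key
  beta_reduce at h1
  rw [lintegral_map ha measurable_fst,
    lintegral_withDensity_eq_lintegral_mul _ hb2 (by fun_prop),
    lintegral_withDensity_eq_lintegral_mul _ ht ha] at h1
  rw [lintegral_mul_transferDensity hm hd ha (measurable_transferDensity b)]
  simp only [Pi.mul_apply, mul_comm (b _)] at h1
  rw [← h1]
  exact lintegral_congr fun p => mul_comm _ _

/-- The roles are exchanged: the first factor is a cut-off indicator, whose density is still
bounded, and the second becomes arbitrary. The indicators let the final step test equality of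
measures on sets. -/
theorem lintegral_cutoff_mul_transferDensity (hd : 2 ≤ finrank ℝ V) {S : Set (V × V)}
    (hS : MeasurableSet S) (n : ℕ) {b : V × V → ℝ≥0∞} (hb : Measurable b) :
    ∫⁻ q, transferDensity m (fun p => ENNReal.ofReal (cutoff m n p) * S.indicator 1 p) q *
        transferDensity m b q =
      ∫⁻ q, (ENNReal.ofReal (cutoff m n q.1) * S.indicator 1 q.1) * b q.2
        ∂(scatterMeasure m) := by
  have hSm : Measurable (S.indicator (1 : V × V → ℝ≥0∞)) := measurable_one.indicator hS
  set a : V × V → ℝ≥0∞ := fun p => ENNReal.ofReal (cutoff m n p) * S.indicator 1 p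
  have ham : Measurable a := by fun_prop
  have ha2 : Measurable fun q : (V × V) × (V × V) => a q.1 := ham.comp measurable_fst
  have ht : Measurable fun p => transferDensity m a (transfer m p) :=
    (measurable_transferDensity a).comp (continuous_transfer (V := V) m).measurable
  have key : (volume.withDensity fun p => transferDensity m a (transfer m p)) =
      ((scatterMeasure m).withDensity fun q => a q.1).map Prod.snd := by
    refine withDensity_transferDensity_eq hm hd ?_ (exists_transferDensity_cutoff_le hm hd n
      hSm (K := 1) fun p => ?_) ?_
    · refine (ae_map_iff measurable_snd.aemeasurable
        (measurableSet_eq_fun (by fun_prop) (by fun_prop)).compl).2 ?_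
      exact (withDensity_absolutelyContinuous _ _).ae_le
        ((ae_scatterMeasure_energy_ne hm hd).mono fun q hq => hq.2)
    · exact indicator_le_self' (fun _ _ => zero_le) p
    · intro f j
      simp_rw [mul_comm (transferDensity m _ _) (transferDensity m a _)]
      rw [lintegral_mul_transferDensity_cutoff_right hm hd f j ham,
        lintegral_map (by fun_prop) (by fun_prop),
        lintegral_withDensity_eq_lintegral_mul _ ha2 (by fun_prop)]
      rfl
  have h1 := congrArg (fun N : Measure (V × V) => ∫⁻ p, b p ∂N) key
  beta_reduce at h1
  rw [lintegral_map hb measurable_snd,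
    lintegral_withDensity_eq_lintegral_mul _ ha2 (by fun_prop),
    lintegral_withDensity_eq_lintegral_mul _ ht hb] at h1
  simp_rw [mul_comm (transferDensity m a _)]
  rw [lintegral_mul_transferDensity hm hd hb (measurable_transferDensity a)]
  simp only [Pi.mul_apply] at h1
  rw [← h1]
  exact lintegral_congr fun p => mul_comm _ _

/-- Both sides integrate `a(ν₁, ν₂) b(ν₃, ν₄)` over momenta with equal transfers
`ν₁ - ν₂ = ν₃ - ν₄` and `e(ν₁) - e(ν₂) = e(ν₃) - e(ν₄)`; on the right, this is read as the
elastic collision `ν₁ + ν₄ = ν₂ + ν₃`. -/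
theorem lintegral_transferDensity_mul (hd : 2 ≤ finrank ℝ V) {a b : V × V → ℝ≥0∞}
    (ha : Measurable a) (hb : Measurable b) :
    ∫⁻ q, transferDensity m a q * transferDensity m b q =
      ∫⁻ q, a q.1 * b q.2 ∂(scatterMeasure m) := by
  have : Nontrivial V := Module.nontrivial_of_finrank_pos (R := ℝ) (by omega)
  have hb2 : Measurable fun q : (V × V) × (V × V) => b q.2 := hb.comp measurable_snd
  have htb : Measurable fun p => transferDensity m b (transfer m p) :=
    (measurable_transferDensity b).comp (continuous_transfer (V := V) m).measurable
  have hχ : ∀ n, Measurable fun p : V × V => ENNReal.ofReal (cutoff m n p) := fun n => by fun_prop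
  have hne : ∀ p : V × V, energy m p.1 ≠ energy m p.2 →
      ∃ n, ENNReal.ofReal (cutoff m n p) ≠ 0 := by
    intro p hp
    obtain ⟨n, hn⟩ := exists_cutoff_ne_zero hp
    exact ⟨n, by simpa using lt_of_le_of_ne (cutoff_nonneg m n p) hn.symm⟩
  have key : (volume.withDensity fun p => transferDensity m b (transfer m p)) =
      ((scatterMeasure m).withDensity fun q => b q.2).map Prod.fst := by
    have hN : ∀ᵐ p ∂((scatterMeasure m).withDensity fun q => b q.2).map Prod.fst,
        energy m p.1 ≠ energy m p.2 := by
      refine (ae_map_iff measurable_fst.aemeasurable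
        (measurableSet_eq_fun (by fun_prop) (by fun_prop)).compl).2 ?_
      exact (withDensity_absolutelyContinuous _ _).ae_le
        ((ae_scatterMeasure_energy_ne hm hd).mono fun q hq => hq.1)
    refine ext_of_withDensity hχ (fun n p => ?_) ?_ (hN.mono hne) fun n => ?_
    · rw [← ENNReal.ofReal_one]
      exact ENNReal.ofReal_le_ofReal (cutoff_le_one m n p)
    · exact (withDensity_absolutelyContinuous _ _).ae_le ((ae_energy_ne hm).mono hne)
    ext S hS
    have hSm : Measurable (S.indicator (1 : V × V → ℝ≥0∞)) := measurable_one.indicator hS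
    rw [← lintegral_indicator_one hS, ← lintegral_indicator_one hS,
      lintegral_withDensity_eq_lintegral_mul _ (hχ n) hSm,
      lintegral_withDensity_eq_lintegral_mul _ (hχ n) hSm,
      lintegral_withDensity_eq_lintegral_mul _ htb (by fun_prop),
      lintegral_map (by fun_prop) measurable_fst,
      lintegral_withDensity_eq_lintegral_mul _ hb2 (by fun_prop)]
    have h1 := lintegral_cutoff_mul_transferDensity hm hd hS n hb
    rw [lintegral_mul_transferDensity hm hd (by fun_prop) (measurable_transferDensity b)] at h1
    simp only [Pi.mul_apply, mul_comm (b _), mul_comm (transferDensity m b _)]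
    exact h1
  have h1 := congrArg (fun N : Measure (V × V) => ∫⁻ p, a p ∂N) key
  beta_reduce at h1
  rw [lintegral_map ha measurable_fst,
    lintegral_withDensity_eq_lintegral_mul _ hb2 (by fun_prop),
    lintegral_withDensity_eq_lintegral_mul _ htb ha] at h1
  rw [lintegral_mul_transferDensity hm hd ha (measurable_transferDensity b)]
  simp only [Pi.mul_apply, mul_comm (b _)] at h1
  rw [← h1]
  exact lintegral_congr fun p => mul_comm _ _

end Duality

end KleinGordon

namespace KleinGordon

set_option linter.unusedSectionVars false

/-! ### The bilinear estimate for nonnegative profiles -/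

noncomputable section Bilinear

open Set Metric Module Filter Topology
open scoped NNReal

variable {V : Type*} [NormedAddCommGroup V] [InnerProductSpace ℝ V]
  [FiniteDimensional ℝ V] [MeasurableSpace V] [BorelSpace V] {m : ℝ} (hm : 0 < m)

/-- The symbol of `|□|^{2γ}`, up to powers of `2π`. -/
def gapWeight (γ : ℝ) (q : V × ℝ) : ℝ≥0∞ := ENNReal.ofReal (|‖q.1‖ ^ 2 - q.2 ^ 2| ^ γ)

@[fun_prop]
theorem measurable_gapWeight (γ : ℝ) : Measurable (gapWeight γ : V × ℝ → ℝ≥0∞) := by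
  unfold gapWeight; fun_prop

/-- `∫∫ g(x)² e(x) g(w)² e(w) k(x,w)^{2j} / M(x,w) dx dw`. -/
def momentumForm (m : ℝ) (j : ℕ) (g : V → ℝ) : ℝ≥0∞ :=
  ∫⁻ p : V × V, ENNReal.ofReal (g p.1 ^ 2 * energy m p.1 * (g p.2 ^ 2 * energy m p.2) *
    (cmMomentum m p.1 p.2 ^ (2 * j) / invMass m p.1 p.2))

include hm

theorem gapWeight_transfer (γ : ℝ) (p : V × V) :
    gapWeight γ (transfer m p) = ENNReal.ofReal (gap m p.1 p.2 ^ γ) := by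
  rw [gapWeight, transfer, ← abs_of_nonneg (gap_nonneg hm p.1 p.2), gap]

/-- A weight depending on the transfer alone can be moved into the first factor. -/
theorem lintegral_weight_mul_transferDensity (hd : 2 ≤ finrank ℝ V) {a b : V × V → ℝ≥0∞}
    {W : V × ℝ → ℝ≥0∞} (ha : Measurable a) (hb : Measurable b) (hW : Measurable W) :
    ∫⁻ q, W q * (transferDensity m a q * transferDensity m b q) =
      ∫⁻ q, W (transfer m q.1) * (a q.1 * b q.2) ∂(scatterMeasure m) := by
  have htr := (continuous_transfer (V := V) m).measurable
  have hWa : Measurable fun p => W (transfer m p) * a p := (hW.comp htr).mul ha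
  have h1 := lintegral_transferDensity_mul hm hd hWa hb
  rw [lintegral_mul_transferDensity hm hd hWa (by fun_prop)] at h1
  have h2 := lintegral_mul_transferDensity hm hd ha
    (Ψ := fun q => W q * transferDensity m b q) (by fun_prop)
  calc _ = ∫⁻ q, transferDensity m a q * (W q * transferDensity m b q) :=
        lintegral_congr fun q => by ring
    _ = _ := h2
    _ = ∫⁻ p, W (transfer m p) * a p * transferDensity m b (transfer m p) :=
        lintegral_congr fun q => by ring
    _ = _ := h1
    _ = _ := lintegral_congr fun q => by ring

/-- In the centre-of-mass frame x has momentum z with ‖z‖ = k, so the gap is k²‖ω - z/k‖² by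
`gap_boost_boost`. The powers of k add up to d - 2 + 2γ = 2j, and the sphere integral does not
depend on the direction of z. -/
theorem lintegral_gapWeight_outFst (hd : 2 ≤ finrank ℝ V) {γ : ℝ} {j : ℕ} {S : ℝ≥0∞}
    (hγ : 2 * γ = 2 * j + 2 - finrank ℝ V)
    (hS : ∀ e : V, ‖e‖ = 1 → ∫⁻ ω : sphere (0 : V) 1, ENNReal.ofReal ((‖(ω : V) - e‖ ^ 2) ^ γ)
      ∂(volume : Measure V).toSphere = S) {x w : V} (hxw : x ≠ w) :
    ∫⁻ ω : sphere (0 : V) 1, ENNReal.ofReal (cmMomentum m x w ^ (finrank ℝ V - 2) *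
        gap m x (outFst m x w ω) ^ γ) ∂(volume : Measure V).toSphere =
      ENNReal.ofReal (cmMomentum m x w ^ (2 * j)) * S := by
  have hk := cmMomentum_pos hm hxw
  obtain ⟨z, hz, hx, -⟩ := exists_boost_eq hm x w
  set k := cmMomentum m x w
  have he : ‖k⁻¹ • z‖ = 1 := by
    rw [norm_smul, hz, norm_inv, Real.norm_of_nonneg hk.le, inv_mul_cancel₀ hk.ne']
  rw [← hS _ he, ← lintegral_const_mul' _ _ (by simp)]
  refine lintegral_congr fun ω => ?_
  rw [← ENNReal.ofReal_mul (by positivity)]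
  congr 1
  have hgap : gap m x (outFst m x w ω) = k ^ 2 * ‖(ω : V) - k⁻¹ • z‖ ^ 2 := by
    have h1 := gap_boost_boost hm x w hz (norm_cmMomentum_smul (m := m) x w ω)
    rw [hx] at h1
    rw [outFst, h1, ← mul_pow, ← Real.norm_of_nonneg hk.le, ← norm_smul, smul_sub, smul_smul,
      Real.norm_of_nonneg hk.le, mul_inv_cancel₀ hk.ne', one_smul, norm_sub_rev]
  rw [hgap, Real.mul_rpow (by positivity) (by positivity), ← mul_assoc]
  congr 1
  rw [← Real.rpow_natCast, ← Real.rpow_natCast, ← Real.rpow_natCast, ← Real.rpow_mul hk.le,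
    ← Real.rpow_add hk]
  congr 1
  push_cast [Nat.cast_sub hd]
  linarith

/-- The energy quotients are chosen to cancel the outgoing energies in `scatterDensity`, so that ω
occurs only in the gap. -/
theorem lintegral_gapWeight_scatterMeasure (hd : 2 ≤ finrank ℝ V) {γ : ℝ} {j : ℕ} {S : ℝ≥0∞}
    (hγ : 2 * γ = 2 * j + 2 - finrank ℝ V)
    (hS : ∀ e : V, ‖e‖ = 1 → ∫⁻ ω : sphere (0 : V) 1, ENNReal.ofReal ((‖(ω : V) - e‖ ^ 2) ^ γ)
      ∂(volume : Measure V).toSphere = S) {g : V → ℝ} (hg : Measurable g) :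
    ∫⁻ q, gapWeight γ (transfer m q.1) *
        (ENNReal.ofReal (g q.1.1 ^ 2 * (energy m q.1.1 / energy m q.1.2)) *
          ENNReal.ofReal (g q.2.2 ^ 2 * (energy m q.2.2 / energy m q.2.1))) ∂(scatterMeasure m) =
      S * momentumForm m j g := by
  have : Nontrivial V := Module.nontrivial_of_finrank_pos (R := ℝ) (by omega)
  have htr := (continuous_transfer (V := V) m).measurable
  have hgap : Measurable fun p : V × V => gapWeight γ (transfer m p) :=
    (measurable_gapWeight γ).comp htr
  have hk : Measurable fun p : V × V => cmMomentum m p.1 p.2 := Continuous.measurable (by fun_prop)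
  have hM : Measurable fun p : V × V => invMass m p.1 p.2 := Continuous.measurable (by fun_prop)
  rw [lintegral_scatterMeasure hm (by fun_prop), momentumForm,
    ← lintegral_const_mul _ (by fun_prop)]
  refine lintegral_congr_ae ?_
  filter_upwards [ae_fst_ne_snd (V := V)] with p hp
  have h1 := energy_pos hm p.1
  have h2 := energy_pos hm p.2
  have h3 := invMass_pos hm p.1 p.2
  set A : ℝ := g p.1 ^ 2 * energy m p.1 * (g p.2 ^ 2 * energy m p.2) / invMass m p.1 p.2 with hA
  have hA0 : 0 ≤ A := by positivity
  calc _ = ∫⁻ ω : sphere (0 : V) 1, ENNReal.ofReal A * ENNReal.ofReal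
        (cmMomentum m p.1 p.2 ^ (finrank ℝ V - 2) * gap m p.1 (outFst m p.1 p.2 ω) ^ γ)
          ∂(volume : Measure V).toSphere := by
        refine lintegral_congr fun ω => ?_
        have h4 := energy_pos hm (outFst m p.1 p.2 ω)
        have h5 := energy_pos hm (outSnd m p.1 p.2 ω)
        have h6 := gap_nonneg hm p.1 (outFst m p.1 p.2 ω)
        have h7 := cmMomentum_nonneg m p.1 p.2
        simp only [scatterMap, gapWeight_transfer hm, scatterDensity]
        rw [← ENNReal.ofReal_mul (by positivity), ← ENNReal.ofReal_mul (by positivity),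
          ← ENNReal.ofReal_mul (by positivity), ← ENNReal.ofReal_mul (by positivity)]
        congr 1
        rw [hA]
        field_simp
    _ = _ := by
        rw [lintegral_const_mul' _ _ (by simp), lintegral_gapWeight_outFst hm hd hγ hS hp,
          ← mul_assoc, ← ENNReal.ofReal_mul hA0, mul_comm]
        congr 2
        rw [hA]
        ring

/-- Arithmetic-geometric mean on each collision, with weights that are balanced exactly when g·e has
the same product over incoming and outgoing particles, as for g = exp(-a e)/e. -/
theorem lintegral_gapWeight_mul_sq_le (hd : 2 ≤ finrank ℝ V) {γ : ℝ} {j : ℕ} {S : ℝ≥0∞}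
    (hγ : 2 * γ = 2 * j + 2 - finrank ℝ V)
    (hS : ∀ e : V, ‖e‖ = 1 → ∫⁻ ω : sphere (0 : V) 1, ENNReal.ofReal ((‖(ω : V) - e‖ ^ 2) ^ γ)
      ∂(volume : Measure V).toSphere = S) {g : V → ℝ} (hg : Measurable g) (hg0 : ∀ x, 0 ≤ g x) :
    ∫⁻ q, gapWeight γ q * transferDensity m (fun p => ENNReal.ofReal (g p.1 * g p.2)) q ^ 2 ≤
      S * momentumForm m j g := by
  have htr := (continuous_transfer (V := V) m).measurable
  have hgap : Measurable fun p : V × V => gapWeight γ (transfer m p) :=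
    (measurable_gapWeight γ).comp htr
  set α : V × V → ℝ≥0∞ := fun p => ENNReal.ofReal (g p.1 ^ 2 * (energy m p.1 / energy m p.2))
  set α' : V × V → ℝ≥0∞ := fun p => ENNReal.ofReal (g p.2 ^ 2 * (energy m p.2 / energy m p.1))
  have hα : Measurable α := by fun_prop
  have hα' : Measurable α' := by fun_prop
  have h1 : ∫⁻ q, gapWeight γ (transfer m q.1) * (α q.1 * α' q.2) ∂(scatterMeasure m) =
      S * momentumForm m j g := lintegral_gapWeight_scatterMeasure hm hd hγ hS hg
  have h2 := lintegral_weight_mul_transferDensity hm hd hα hα' (measurable_gapWeight γ)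
  have h3 := lintegral_weight_mul_transferDensity hm hd hα' hα (measurable_gapWeight γ)
  -- Exchanging incoming and outgoing particles is just commutativity of the product of the two
  -- densities.
  have h4 : ∫⁻ q, gapWeight γ (transfer m q.1) * (α q.1 * α' q.2) ∂(scatterMeasure m) =
      ∫⁻ q, gapWeight γ (transfer m q.1) * (α' q.1 * α q.2) ∂(scatterMeasure m) := by
    rw [← h2, ← h3]
    exact lintegral_congr fun q => by ring
  simp_rw [sq]
  rw [lintegral_weight_mul_transferDensity hm hd (by fun_prop) (by fun_prop)
    (measurable_gapWeight γ)]
  have h5 : (2 : ℝ≥0∞) * ∫⁻ q, gapWeight γ (transfer m q.1) * (ENNReal.ofReal (g q.1.1 * g q.1.2) *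
      ENNReal.ofReal (g q.2.1 * g q.2.2)) ∂(scatterMeasure m) ≤ 2 * (S * momentumForm m j g) := by
    have h6 : 2 * (S * momentumForm m j g) =
        ∫⁻ q, gapWeight γ (transfer m q.1) * (α q.1 * α' q.2) ∂(scatterMeasure m) +
        ∫⁻ q, gapWeight γ (transfer m q.1) * (α' q.1 * α q.2) ∂(scatterMeasure m) := by
      rw [← h4, h1, two_mul]
    rw [h6, ← lintegral_add_left (by fun_prop), ← lintegral_const_mul' _ _ (by simp)]
    refine lintegral_mono fun q => ?_
    rw [← mul_add, mul_left_comm]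
    refine mul_le_mul_right ?_ _
    have e1 := energy_pos hm q.1.1
    have e2 := energy_pos hm q.1.2
    have e3 := energy_pos hm q.2.1
    have e4 := energy_pos hm q.2.2
    have g1 := hg0 q.1.1
    have g2 := hg0 q.1.2
    have g3 := hg0 q.2.1
    have g4 := hg0 q.2.2
    simp only [α, α']
    rw [← ENNReal.ofReal_mul (by positivity), ← ENNReal.ofReal_mul (by positivity),
      ← ENNReal.ofReal_mul (by positivity), ← ENNReal.ofReal_add (by positivity) (by positivity),
      ← ENNReal.ofReal_ofNat, ← ENNReal.ofReal_mul (by positivity)]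
    refine ENNReal.ofReal_le_ofReal ?_
    generalize energy m q.1.1 = a at *
    generalize energy m q.1.2 = b at *
    generalize energy m q.2.1 = c at *
    generalize energy m q.2.2 = d at *
    -- The difference of the two sides of the pointwise inequality, as a completed square.
    have : 0 ≤ (g q.1.1 * g q.2.2 * (a * d) - g q.1.2 * g q.2.1 * (b * c)) ^ 2 / (a * b * c * d) := by
      positivity
    refine le_of_sub_nonneg (this.trans_eq ?_)
    field_simp
    ring
  exact (ENNReal.mul_le_mul_iff_right (by simp) (by simp)).1 h5

/-- For exponentials the bilinear estimate is an identity. -/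
theorem lintegral_gapWeight_mul_sq_eq (hd : 2 ≤ finrank ℝ V) {γ : ℝ} {j : ℕ} {S : ℝ≥0∞}
    (hγ : 2 * γ = 2 * j + 2 - finrank ℝ V)
    (hS : ∀ e : V, ‖e‖ = 1 → ∫⁻ ω : sphere (0 : V) 1, ENNReal.ofReal ((‖(ω : V) - e‖ ^ 2) ^ γ)
      ∂(volume : Measure V).toSphere = S) {a : ℝ} {g : V → ℝ}
    (hg : ∀ x, g x = Real.exp (-a * energy m x) / energy m x) :
    ∫⁻ q, gapWeight γ q * transferDensity m (fun p => ENNReal.ofReal (g p.1 * g p.2)) q ^ 2 =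
      S * momentumForm m j g := by
  obtain rfl : g = fun x => Real.exp (-a * energy m x) / energy m x := funext hg
  have htr := (continuous_transfer (V := V) m).measurable
  have hgap : Measurable fun p : V × V => gapWeight γ (transfer m p) :=
    (measurable_gapWeight γ).comp htr
  simp_rw [sq]
  rw [lintegral_weight_mul_transferDensity hm hd (by fun_prop) (by fun_prop)
    (measurable_gapWeight γ), ← lintegral_gapWeight_scatterMeasure hm hd hγ hS (by fun_prop),
    lintegral_scatterMeasure hm (by fun_prop), lintegral_scatterMeasure hm (by fun_prop)]
  refine lintegral_congr fun p => lintegral_congr fun ω => ?_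
  congr 2
  have e1 := energy_pos hm p.1
  have e4 := energy_pos hm p.2
  have e2 := energy_pos hm (outFst m p.1 p.2 ω)
  have e3 := energy_pos hm (outSnd m p.1 p.2 ω)
  have he := energy_out hm p.1 p.2 ω
  simp only [scatterMap]
  rw [← ENNReal.ofReal_mul (by positivity), ← ENNReal.ofReal_mul (by positivity)]
  congr 1
  generalize energy m p.1 = x at *
  generalize energy m p.2 = y at *
  generalize energy m (outFst m p.1 p.2 ω) = z at *
  generalize energy m (outSnd m p.1 p.2 ω) = w at *
  -- Energy conservation makes the square in the arithmetic-geometric step vanish.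
  have h1 : Real.exp (-a * x) * Real.exp (-a * y) = Real.exp (-a * z) * Real.exp (-a * w) := by
    rw [← Real.exp_add, ← Real.exp_add]
    congr 1
    linear_combination a * he
  generalize Real.exp (-a * x) = X at *
  generalize Real.exp (-a * y) = Y at *
  generalize Real.exp (-a * z) = Z at *
  generalize Real.exp (-a * w) = W at *
  field_simp
  linear_combination (-X * Y) * h1

end Bilinear

end KleinGordon

namespace KleinGordon

set_option linter.unusedSectionVars false

/-! ### Strictness, and concentration of exponentials at rest -/

noncomputable section Extremal

open Set Metric Module Filter Topology
open scoped NNReal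

/-- Laplace's principle: the part with E ≥ T weighs at most exp(-bT)·ν(X), while the part with E <
T' weighs at least exp(-bT')·ν(E < T'). For large b the former is absorbed by the slack c' - c on
the latter. -/
theorem exists_concentration {X : Type*} [MeasurableSpace X] {ν : Measure X} [IsFiniteMeasure ν]
    {φ : X → ℝ≥0∞} {E : X → ℝ} (hE : Measurable E) {T T' : ℝ} (hT : T' < T)
    (hν : ν {x | E x < T'} ≠ 0) {c c' : ℝ≥0∞} (hc : c < c') (hφ : ∀ x, E x < T → c' ≤ φ x) :
    ∃ b : ℝ, 0 ≤ b ∧ c * ∫⁻ x, ENNReal.ofReal (Real.exp (-b * E x)) ∂ν ≤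
      ∫⁻ x, φ x * ENNReal.ofReal (Real.exp (-b * E x)) ∂ν := by
  have hctop : c ≠ ∞ := hc.ne_top
  have h1 : Tendsto (fun b : ℝ => c * ν univ * ENNReal.ofReal (Real.exp (-(b * (T - T')))))
      atTop (𝓝 0) := by
    have : Tendsto (fun b : ℝ => Real.exp (-(b * (T - T')))) atTop (𝓝 0) :=
      Real.tendsto_exp_neg_atTop_nhds_zero.comp
        (tendsto_id.atTop_mul_const (sub_pos.2 hT))
    have h2 := ENNReal.Tendsto.const_mul (a := c * ν univ) (ENNReal.tendsto_ofReal this)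
      (Or.inr (ENNReal.mul_ne_top hctop (measure_ne_top _ _)))
    simpa using h2
  have h2 : 0 < (c' - c) * ν {x | E x < T'} := by
    rw [pos_iff_ne_zero, Ne, mul_eq_zero, not_or]
    exact ⟨(tsub_pos_of_lt hc).ne', hν⟩
  obtain ⟨b, hb, hb0⟩ := ((h1.eventually (gt_mem_nhds h2)).and (eventually_ge_atTop 0)).exists
  refine ⟨b, hb0, ?_⟩
  have hS : MeasurableSet {x | E x < T} := measurableSet_lt hE measurable_const
  have hS' : MeasurableSet {x | E x < T'} := measurableSet_lt hE measurable_const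
  set f : X → ℝ≥0∞ := fun x => ENNReal.ofReal (Real.exp (-b * E x))
  have hin : ENNReal.ofReal (Real.exp (-b * T')) * ν {x | E x < T'} ≤
      ∫⁻ x in {x | E x < T}, f x ∂ν := by
    rw [← setLIntegral_const]
    refine (setLIntegral_mono' hS' fun x hx => ?_).trans
      (lintegral_mono_set fun x hx => lt_trans (show E x < T' from hx) hT)
    refine ENNReal.ofReal_le_ofReal (Real.exp_le_exp.2 ?_)
    have : E x < T' := hx
    nlinarith
  have hout : ∫⁻ x in {x | E x < T}ᶜ, f x ∂ν ≤ ENNReal.ofReal (Real.exp (-b * T)) * ν univ := by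
    refine (setLIntegral_mono' (g := fun _ => ENNReal.ofReal (Real.exp (-b * T)))
      hS.compl fun x hx => ?_).trans ?_
    · refine ENNReal.ofReal_le_ofReal (Real.exp_le_exp.2 ?_)
      have : T ≤ E x := not_lt.1 hx
      nlinarith
    · rw [setLIntegral_const]
      gcongr
      exact subset_univ _
  have hexp : ENNReal.ofReal (Real.exp (-b * T)) =
      ENNReal.ofReal (Real.exp (-b * T')) * ENNReal.ofReal (Real.exp (-(b * (T - T')))) := by
    rw [← ENNReal.ofReal_mul (Real.exp_nonneg _), ← Real.exp_add]
    congr 2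
    ring
  have hcompl : c * ∫⁻ x in {x | E x < T}ᶜ, f x ∂ν ≤
      (c' - c) * ∫⁻ x in {x | E x < T}, f x ∂ν :=
    calc c * ∫⁻ x in {x | E x < T}ᶜ, f x ∂ν
        ≤ c * (ENNReal.ofReal (Real.exp (-b * T)) * ν univ) := mul_le_mul_right hout _
      _ = ENNReal.ofReal (Real.exp (-b * T')) *
          (c * ν univ * ENNReal.ofReal (Real.exp (-(b * (T - T'))))) := by rw [hexp]; ring
      _ ≤ ENNReal.ofReal (Real.exp (-b * T')) * ((c' - c) * ν {x | E x < T'}) :=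
        mul_le_mul_right hb.le _
      _ = (c' - c) * (ENNReal.ofReal (Real.exp (-b * T')) * ν {x | E x < T'}) := by ring
      _ ≤ _ := mul_le_mul_right hin _
  calc c * ∫⁻ x, f x ∂ν
      = c * ∫⁻ x in {x | E x < T}, f x ∂ν + c * ∫⁻ x in {x | E x < T}ᶜ, f x ∂ν := by
        rw [← mul_add, lintegral_add_compl _ hS]
    _ ≤ c * ∫⁻ x in {x | E x < T}, f x ∂ν + (c' - c) * ∫⁻ x in {x | E x < T}, f x ∂ν :=
        add_le_add_right hcompl _
    _ = c' * ∫⁻ x in {x | E x < T}, f x ∂ν := by rw [← add_mul, add_tsub_cancel_of_le hc.le]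
    _ = ∫⁻ x in {x | E x < T}, c' * f x ∂ν := (lintegral_const_mul _ (by fun_prop)).symm
    _ ≤ ∫⁻ x in {x | E x < T}, φ x * f x ∂ν :=
        setLIntegral_mono' hS fun x hx => mul_le_mul_left (hφ x hx) _
    _ ≤ _ := setLIntegral_le_lintegral _ _

variable {V : Type*} [NormedAddCommGroup V] [InnerProductSpace ℝ V]
  [FiniteDimensional ℝ V] [MeasurableSpace V] [BorelSpace V] {m : ℝ} (hm : 0 < m)

/-- `∫∫ g(x)² e(x) g(w)² e(w) k(x,w)^{2j} dx dw`. -/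
def momentumMass (m : ℝ) (j : ℕ) (g : V → ℝ) : ℝ≥0∞ :=
  ∫⁻ p : V × V, ENNReal.ofReal (g p.1 ^ 2 * energy m p.1 * (g p.2 ^ 2 * energy m p.2) *
    cmMomentum m p.1 p.2 ^ (2 * j))

/-- The functions `e^{-a e} / e`. -/
def expProfile (m a : ℝ) (x : V) : ℝ := Real.exp (-a * energy m x) / energy m x

@[fun_prop]
theorem measurable_expProfile (m a : ℝ) : Measurable (expProfile m a : V → ℝ) := by
  unfold expProfile; fun_prop

include hm

/-- The invariant mass exceeds 2m off the diagonal, where k > 0 as well, so equality would force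
g(x)g(w) = 0 for almost all pairs. This is why there are no extremisers. -/
theorem momentumForm_lt [Nontrivial V] {j : ℕ} {g : V → ℝ} (hg : Measurable g)
    (hfin : momentumMass m j g ≠ ∞) (hg0 : ¬ g =ᵐ[volume] 0) :
    momentumForm m j g < ENNReal.ofReal (1 / (2 * m)) * momentumMass m j g := by
  have hk : Measurable fun p : V × V => cmMomentum m p.1 p.2 := Continuous.measurable (by fun_prop)
  have hM : Measurable fun p : V × V => invMass m p.1 p.2 := Continuous.measurable (by fun_prop)
  have hle : ∀ p : V × V, ENNReal.ofReal (g p.1 ^ 2 * energy m p.1 * (g p.2 ^ 2 * energy m p.2) *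
      (cmMomentum m p.1 p.2 ^ (2 * j) / invMass m p.1 p.2)) ≤
      ENNReal.ofReal (1 / (2 * m)) * ENNReal.ofReal (g p.1 ^ 2 * energy m p.1 *
      (g p.2 ^ 2 * energy m p.2) * cmMomentum m p.1 p.2 ^ (2 * j)) := by
    intro p
    have h1 := energy_pos hm p.1
    have h2 := energy_pos hm p.2
    have h3 := cmMomentum_nonneg m p.1 p.2
    rw [← ENNReal.ofReal_mul (by positivity)]
    refine ENNReal.ofReal_le_ofReal ?_
    rw [← mul_div_assoc, div_eq_mul_one_div, mul_comm]
    gcongr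
    exact two_mul_mass_le_invMass hm _ _
  rw [momentumMass, ← lintegral_const_mul' _ _ (by simp), momentumForm]
  refine lintegral_strict_mono_of_ae_le_of_frequently_ae_lt (Measurable.aemeasurable (by fun_prop))
    (ne_top_of_le_ne_top ?_ (lintegral_mono hle)) (Eventually.of_forall hle) ?_
  · rw [lintegral_const_mul' _ _ (by simp)]
    exact ENNReal.mul_ne_top (by simp) hfin
  intro hcon
  refine hg0 ?_
  have h0 : ∀ᵐ p : V × V, g p.1 * g p.2 = 0 := by
    filter_upwards [hcon, ae_fst_ne_snd (V := V)] with p hp hne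
    have h1 := energy_pos hm p.1
    have h2 := energy_pos hm p.2
    have h3 := cmMomentum_pos hm hne
    have h4 := two_mul_mass_lt_invMass hm hne
    have h4' := invMass_pos hm p.1 p.2
    rw [not_ne_iff, ← ENNReal.ofReal_mul (by positivity), ENNReal.ofReal_eq_ofReal_iff
      (by positivity) (by positivity)] at hp
    have h5 : g p.1 ^ 2 * energy m p.1 * (g p.2 ^ 2 * energy m p.2) * cmMomentum m p.1 p.2 ^ (2 * j)
        * (1 / (2 * m) - 1 / invMass m p.1 p.2) = 0 := by linear_combination -hp
    have h6 : 1 / (2 * m) - 1 / invMass m p.1 p.2 ≠ 0 :=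
      (sub_pos.2 (one_div_lt_one_div_of_lt (by positivity) h4)).ne'
    simp only [mul_eq_zero, h1.ne', h2.ne', h6, pow_eq_zero_iff', h3.ne',
      or_false, false_and] at h5
    exact mul_eq_zero.2 (h5.imp And.left And.left)
  have hms : MeasurableSet {p : V × V | g p.1 * g p.2 = 0} :=
    measurableSet_eq_fun (by fun_prop) measurable_const
  rw [Measure.volume_eq_prod, Measure.ae_prod_iff_ae_ae hms] at h0
  by_cases hx : ∃ x, g x ≠ 0 ∧ ∀ᵐ y, g x * g y = 0
  · obtain ⟨x, hx, hy⟩ := hx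
    exact hy.mono fun y hy => (mul_eq_zero.1 hy).resolve_left hx
  · push Not at hx
    filter_upwards [h0] with x h
    by_contra hne
    exact hx x hne (h.mono fun y hy => not_not.2 hy)

theorem cmMomentum_sq_le_mul (x w : V) : cmMomentum m x w ^ 2 ≤ energy m x * energy m w := by
  have h1 := energy_pos hm x
  have h2 := energy_pos hm w
  rw [cmMomentum_sq hm, gap_eq]
  have h3 := abs_real_inner_le_norm x w
  have h4 : ‖x‖ * ‖w‖ ≤ energy m x * energy m w := by
    gcongr <;> exact norm_le_energy m _
  have h5 := neg_abs_le (inner ℝ x w)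
  nlinarith [sq_nonneg m]

/-- The exponential beats every power of the energy, and the energy dominates a multiple of 1 + ‖x‖;
compare with (1 + ‖x‖)^(-(d + 1)). -/
theorem integrable_pow_mul_exp_energy (n : ℕ) {a : ℝ} (ha : 0 < a) :
    Integrable fun x : V => energy m x ^ n * Real.exp (-a * energy m x) := by
  set r : ℕ := finrank ℝ V + 1
  have h1 := (integrable_one_add_norm (E := V) (μ := volume) (r := r) (by simp [r])).const_mul
    ((1 + 1 / m) ^ r * ((n + r).factorial / a ^ (n + r)))
  refine h1.mono' (Measurable.aestronglyMeasurable (by fun_prop)) (Eventually.of_forall fun x => ?_)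
  have he := energy_pos hm x
  rw [Real.norm_of_nonneg (by positivity), Real.rpow_neg (by positivity), Real.rpow_natCast,
    ← div_eq_mul_inv, le_div_iff₀ (by positivity)]
  have h2 : 1 + ‖x‖ ≤ (1 + 1 / m) * energy m x := by
    have h3 := norm_le_energy m x
    have h4 : 1 ≤ 1 / m * energy m x := by
      rw [one_div_mul_eq_div, one_le_div hm]
      exact mass_le_energy x
    linarith
  have h3 := Real.pow_div_factorial_le_exp (a * energy m x) (by positivity) (n + r)
  have h4 : energy m x ^ (n + r) * Real.exp (-a * energy m x) ≤
      (n + r).factorial / a ^ (n + r) := by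
    rw [neg_mul, Real.exp_neg, ← div_eq_mul_inv, div_le_div_iff₀ (Real.exp_pos _) (by positivity)]
    rw [div_le_iff₀ (by positivity), mul_pow] at h3
    linarith
  calc energy m x ^ n * Real.exp (-a * energy m x) * (1 + ‖x‖) ^ r
      ≤ energy m x ^ n * Real.exp (-a * energy m x) * ((1 + 1 / m) * energy m x) ^ r := by gcongr
    _ = (1 + 1 / m) ^ r * (energy m x ^ (n + r) * Real.exp (-a * energy m x)) := by
        rw [mul_pow, pow_add]; ring
    _ ≤ _ := by gcongr

/-- Since M ≤ e(x) + e(w), the factor 1/M is close to its supremum 1/(2m) where the total energy is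
close to 2m, and exponentials concentrate there. -/
theorem exists_momentumForm_expProfile_ge [Nontrivial V] (j : ℕ) {c : ℝ} (hc0 : 0 < c)
    (hc : c < 1 / (2 * m)) : ∃ a : ℝ, 0 < a ∧
      ENNReal.ofReal c * momentumMass m j (expProfile m a : V → ℝ) ≤
        momentumForm m j (expProfile m a : V → ℝ) := by
  have hk : Measurable fun p : V × V => cmMomentum m p.1 p.2 := Continuous.measurable (by fun_prop)
  have hM : Measurable fun p : V × V => invMass m p.1 p.2 := Continuous.measurable (by fun_prop)
  set E : V × V → ℝ := fun p => energy m p.1 + energy m p.2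
  have hEm : Measurable E := by fun_prop
  -- One factor exp(-E) is kept in the reference measure to make it finite. As the profile enters
  -- squared, a further weight exp(-bE) corresponds to the exponent (b + 1)/2.
  set R : V × V → ℝ := fun p => cmMomentum m p.1 p.2 ^ (2 * j) / (energy m p.1 * energy m p.2) *
    Real.exp (-E p)
  have hRm : Measurable R := by fun_prop
  have hR0 : ∀ p, 0 ≤ R p := fun p => by
    have h1 := energy_pos hm p.1
    have h2 := energy_pos hm p.2
    have h3 := cmMomentum_nonneg m p.1 p.2
    positivity
  have hRi : ∫⁻ p, ENNReal.ofReal (R p) ≠ ∞ := by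
    have h1 := (integrable_pow_mul_exp_energy hm (V := V) j one_pos)
    have h2 := (h1.mul_prod h1).const_mul (1 / m ^ 2)
    refine ne_top_of_le_ne_top h2.lintegral_lt_top.ne (lintegral_mono fun p =>
      ENNReal.ofReal_le_ofReal ?_)
    have e1 := mass_le_energy (m := m) p.1
    have e2 := mass_le_energy (m := m) p.2
    have e3 := energy_pos hm p.1
    have e4 := energy_pos hm p.2
    have h3 := cmMomentum_sq_le_mul hm p.1 p.2
    have h4 : Real.exp (-E p) =
        Real.exp (-1 * energy m p.1) * Real.exp (-1 * energy m p.2) := by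
      rw [← Real.exp_add]; congr 1; simp only [E]; ring
    simp only [R]
    rw [h4, pow_mul, div_eq_mul_one_div]
    calc (cmMomentum m p.1 p.2 ^ 2) ^ j * (1 / (energy m p.1 * energy m p.2)) *
          (Real.exp (-1 * energy m p.1) * Real.exp (-1 * energy m p.2))
        ≤ (energy m p.1 * energy m p.2) ^ j * (1 / (m * m)) *
          (Real.exp (-1 * energy m p.1) * Real.exp (-1 * energy m p.2)) := by gcongr
      _ = _ := by rw [mul_pow]; ring
  set ν : Measure (V × V) := volume.withDensity fun p => ENNReal.ofReal (R p)
  have : IsFiniteMeasure ν := isFiniteMeasure_withDensity hRi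
  -- Here T lies between c and 1/(2m); the energy threshold used below is 1/T > 2m.
  obtain ⟨T, hT, hTc⟩ := exists_between hc
  have hT0 : 0 < T := hc0.trans hT
  have hmT : 2 * m < 1 / T := by
    rw [lt_one_div (by positivity) hT0]
    exact hTc
  obtain ⟨T', hmT', hT'⟩ := exists_between hmT
  have hν : ν {p | E p < T'} ≠ 0 := by
    intro h0
    have hset : MeasurableSet {p | E p < T'} := measurableSet_lt hEm measurable_const
    rw [withDensity_apply _ hset, lintegral_eq_zero_iff (by fun_prop)] at h0
    have hopen : IsOpen {p : V × V | E p < T'} :=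
      isOpen_lt (by simp only [E]; fun_prop) continuous_const
    refine (hopen.measure_pos volume ⟨0, ?_⟩).ne' ?_
    · simp only [E, mem_ofPred_eq, energy, Prod.fst_zero, Prod.snd_zero, norm_zero]
      rw [zero_pow two_ne_zero, add_zero, Real.sqrt_sq hm.le]
      linarith
    · rw [measure_eq_zero_iff_ae_notMem]
      filter_upwards [(ae_restrict_iff' hset).1 h0, ae_fst_ne_snd (V := V)] with p hp hne hmem
      have h1 := hp hmem
      simp only [Pi.zero_apply, ENNReal.ofReal_eq_zero] at h1
      have h2 := energy_pos hm p.1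
      have h3 := energy_pos hm p.2
      have h4 := cmMomentum_pos hm hne
      have : 0 < R p := by simp only [R]; positivity
      linarith
  obtain ⟨b, hb, h⟩ := exists_concentration (ν := ν) (E := E)
    (φ := fun p => ENNReal.ofReal (1 / invMass m p.1 p.2)) hEm hT' hν
    (c := ENNReal.ofReal c) (c' := ENNReal.ofReal T)
    ((ENNReal.ofReal_lt_ofReal_iff hT0).2 hT) (fun p hp => by
      refine ENNReal.ofReal_le_ofReal ?_
      rw [le_one_div hT0 (invMass_pos hm _ _)]
      exact (invMass_le hm _ _).trans hp.le)
  refine ⟨(b + 1) / 2, by positivity, ?_⟩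
  have hprof : ∀ p : V × V, expProfile m ((b + 1) / 2) p.1 ^ 2 * energy m p.1 *
      (expProfile m ((b + 1) / 2) p.2 ^ 2 * energy m p.2) * cmMomentum m p.1 p.2 ^ (2 * j) =
      R p * Real.exp (-b * E p) := by
    intro p
    have h2 := energy_pos hm p.1
    have h3 := energy_pos hm p.2
    have h4 : Real.exp (-E p) * Real.exp (-b * E p) = Real.exp (-((b + 1) / 2) * energy m p.1) ^ 2 *
        Real.exp (-((b + 1) / 2) * energy m p.2) ^ 2 := by
      rw [← Real.exp_add, ← Real.exp_nat_mul, ← Real.exp_nat_mul, ← Real.exp_add]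
      congr 1
      simp only [E]
      push_cast
      ring
    simp only [R, expProfile]
    rw [mul_assoc _ (Real.exp (-E p)), h4]
    field_simp
  rw [lintegral_withDensity_eq_lintegral_mul _ (by fun_prop) (by fun_prop),
    lintegral_withDensity_eq_lintegral_mul _ (by fun_prop) (by fun_prop)] at h
  convert h using 1
  · congr 1
    refine lintegral_congr fun p => ?_
    rw [hprof, ENNReal.ofReal_mul (hR0 p), Pi.mul_apply]
  · refine lintegral_congr fun p => ?_
    have h1 := invMass_pos hm p.1 p.2
    rw [Pi.mul_apply, ← ENNReal.ofReal_mul (by positivity), ← ENNReal.ofReal_mul (hR0 p)]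
    congr 1
    rw [← mul_div_assoc, hprof]
    ring

theorem momentumMass_zero {g : V → ℝ} (hg : Integrable fun x => g x ^ 2 * energy m x) :
    momentumMass m 0 g = ENNReal.ofReal ((∫ x, g x ^ 2 * energy m x) ^ 2) := by
  simp only [momentumMass, mul_zero, pow_zero, mul_one]
  have h1 := hg.mul_prod hg
  rw [← Measure.volume_eq_prod] at h1
  rw [← ofReal_integral_eq_lintegral_ofReal h1 (Eventually.of_forall fun p => ?_),
    Measure.volume_eq_prod, integral_prod_mul (fun x => g x ^ 2 * energy m x)
      (fun x => g x ^ 2 * energy m x), sq]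
  have h2 := energy_pos hm p.1
  have h3 := energy_pos hm p.2
  simp only [Pi.zero_apply]
  positivity

/-- By `cmMomentum_sq` and `gap_eq`, k² = (e(x)e(w) - ⟨x, w⟩ - m²)/2, a sum of three terms that
separate in x and w; the middle one integrates to the square of the total momentum. -/
theorem momentumMass_one {g : V → ℝ} (hg : Integrable fun x => g x ^ 2 * energy m x ^ 2)
    (hgm : Measurable g) :
    momentumMass m 1 g = ENNReal.ofReal (2⁻¹ * ((∫ x, g x ^ 2 * energy m x ^ 2) ^ 2 -
      ‖∫ x, (g x ^ 2 * energy m x) • x‖ ^ 2 - m ^ 2 * (∫ x, g x ^ 2 * energy m x) ^ 2)) := by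
  have hg1 : Integrable fun x => g x ^ 2 * energy m x := by
    refine (hg.const_mul (1 / m)).mono' (Measurable.aestronglyMeasurable (by fun_prop))
      (Eventually.of_forall fun x => ?_)
    have h1 := energy_pos hm x
    have h2 := mass_le_energy (m := m) x
    rw [Real.norm_of_nonneg (by positivity), one_div_mul_eq_div, le_div_iff₀ hm, sq (energy m x),
      ← mul_assoc]
    gcongr
  have hg2 : Integrable fun x : V => (g x ^ 2 * energy m x) • x := by
    refine hg.mono' (Measurable.aestronglyMeasurable (by fun_prop))
      (Eventually.of_forall fun x => ?_)
    have h1 := energy_pos hm x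
    rw [norm_smul, Real.norm_of_nonneg (by positivity), sq (energy m x), ← mul_assoc]
    gcongr
    exact norm_le_energy m x
  have i1 := hg.mul_prod hg
  have i2 := hg1.mul_prod hg1
  have i3 : Integrable (fun p : V × V => innerSL ℝ ((g p.1 ^ 2 * energy m p.1) • p.1)
      ((g p.2 ^ 2 * energy m p.2) • p.2)) (volume.prod volume) :=
    hg2.op_fst_snd (innerSL ℝ (E := V)).continuous₂ ⟨‖innerSL ℝ (E := V)‖, (innerSL ℝ (E := V)).le_opNorm₂⟩ hg2
  have hid : ∀ p : V × V, g p.1 ^ 2 * energy m p.1 * (g p.2 ^ 2 * energy m p.2) *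
      cmMomentum m p.1 p.2 ^ (2 * 1) = 2⁻¹ * (g p.1 ^ 2 * energy m p.1 ^ 2 *
      (g p.2 ^ 2 * energy m p.2 ^ 2) - innerSL ℝ ((g p.1 ^ 2 * energy m p.1) • p.1)
      ((g p.2 ^ 2 * energy m p.2) • p.2) -
      m ^ 2 * (g p.1 ^ 2 * energy m p.1 * (g p.2 ^ 2 * energy m p.2))) := by
    intro p
    rw [mul_one, cmMomentum_sq hm, gap_eq]
    simp only [innerSL_apply_apply]
    rw [real_inner_smul_left, real_inner_smul_right]
    ring
  have i4 := ((i1.sub i3).sub (i2.const_mul (m ^ 2))).const_mul 2⁻¹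
  simp only [momentumMass]
  rw [← ofReal_integral_eq_lintegral_ofReal ?_ (Eventually.of_forall fun p => ?_)]
  · have e1 := integral_prod_mul (μ := (volume : Measure V)) (ν := (volume : Measure V))
      (fun x : V => g x ^ 2 * energy m x) (fun x : V => g x ^ 2 * energy m x)
    have e2 := integral_prod_mul (μ := (volume : Measure V)) (ν := (volume : Measure V))
      (fun x : V => g x ^ 2 * energy m x ^ 2) (fun x : V => g x ^ 2 * energy m x ^ 2)
    have e3 := integral_prod_bilin (innerSL ℝ) hg2 hg2
    have e4 := integral_sub (i1.sub i3) (i2.const_mul (m ^ 2))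
    have e5 := integral_sub i1 i3
    simp only [Pi.sub_apply] at e4
    simp_rw [hid]
    rw [integral_const_mul, Measure.volume_eq_prod, e4, e5, integral_const_mul, e1, e2, e3,
      innerSL_apply_apply, real_inner_self_eq_norm_sq, ← sq, ← sq]
  · simp_rw [hid]
    exact i4
  · have h2 := energy_pos hm p.1
    have h3 := energy_pos hm p.2
    have h4 := cmMomentum_nonneg m p.1 p.2
    simp only [Pi.zero_apply]
    positivity

omit hm in
theorem integral_expProfile_smul (a : ℝ) :
    ∫ x : V, (expProfile m a x ^ 2 * energy m x) • x = 0 := by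
  have h := integral_neg_eq_self (fun x : V => (expProfile m a x ^ 2 * energy m x) • x) volume
  simp only [expProfile, energy_neg, smul_neg, integral_neg] at h
  have h2 : (2 : ℝ) • ∫ x : V, (expProfile m a x ^ 2 * energy m x) • x = 0 := by
    simp only [expProfile]
    rw [two_smul]
    nth_rewrite 1 [← h]
    exact neg_add_cancel _
  exact (smul_eq_zero.1 h2).resolve_left two_ne_zero

theorem integrable_expProfile_sq {a : ℝ} (ha : 0 < a) (n : ℕ) :
    Integrable fun x : V => expProfile m a x ^ 2 * energy m x ^ n := by
  refine ((integrable_pow_mul_exp_energy hm (V := V) n (a := 2 * a) (by positivity)).const_mul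
    (1 / m ^ 2)).mono' (Measurable.aestronglyMeasurable (by fun_prop))
      (Eventually.of_forall fun x => ?_)
  have h1 := energy_pos hm x
  have h2 := mass_le_energy (m := m) x
  have h3 : Real.exp (-(2 * a) * energy m x) = Real.exp (-a * energy m x) ^ 2 := by
    rw [← Real.exp_nat_mul]
    congr 1
    push_cast
    ring
  rw [Real.norm_of_nonneg (by positivity), h3, expProfile, div_pow, div_eq_mul_one_div]
  calc Real.exp (-a * energy m x) ^ 2 * (1 / energy m x ^ 2) * energy m x ^ n
      ≤ Real.exp (-a * energy m x) ^ 2 * (1 / m ^ 2) * energy m x ^ n := by gcongr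
    _ = _ := by ring

end Extremal

end KleinGordon

namespace KleinGordon

set_option linter.unusedSectionVars false

/-! ### Pairings with Schwartz functions and quadratic forms on `L²` -/

noncomputable section FourierPairing

open Set Metric Module Filter Topology
open scoped NNReal ContDiff

section General

variable {E : Type*} [NormedAddCommGroup E] [InnerProductSpace ℝ E] [FiniteDimensional ℝ E]
  [MeasurableSpace E] [BorelSpace E]

theorem ae_eq_of_integral_mul_schwartz_eq {f f' : E → ℂ} (hf : LocallyIntegrable f)
    (hf' : LocallyIntegrable f')
    (h : ∀ Φ : 𝓢(E, ℂ), HasCompactSupport (Φ : E → ℂ) → ∫ x, f x * Φ x = ∫ x, f' x * Φ x) :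
    f =ᵐ[volume] f' := by
  refine ae_eq_of_integral_contDiff_smul_eq hf hf' fun g hg hgs => ?_
  have hg₁ : HasCompactSupport (Complex.ofRealCLM ∘ g) := hgs.comp_left rfl
  have hg₂ : ContDiff ℝ ∞ (Complex.ofRealCLM ∘ g) := by fun_prop
  have h1 := h (hg₁.toSchwartzMap hg₂) hg₁
  simpa [mul_comm] using h1

theorem integral_fourierInv_L2_mul (F : Lp ℂ 2 (volume : Measure E)) (Ψ : 𝓢(E, ℂ)) :
    ∫ x, (𝓕⁻ F : Lp ℂ 2 (volume : Measure E)) x * Ψ x = ∫ x, F x * (𝓕⁻ Ψ : 𝓢(E, ℂ)) x := by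
  have h := congrArg (fun T : 𝓢'(E, ℂ) => T Ψ) (Lp.fourierInv_toTemperedDistribution_eq F)
  simp only [TemperedDistribution.fourierInv_apply, Lp.toTemperedDistribution_apply,
    smul_eq_mul] at h
  simp_rw [mul_comm _ (Ψ _), mul_comm _ ((𝓕⁻ Ψ : 𝓢(E, ℂ)) _)]
  exact h.symm

theorem continuous_fourierInv {k : E → ℂ} (hk : Integrable k) : Continuous (𝓕⁻ k) :=
  VectorFourier.fourierIntegral_continuous Real.continuous_fourierChar
    (L := -innerₗ E) (continuous_inner (𝕜 := ℝ) (E := E)).neg hk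

theorem integral_fourierInv_mul {k : E → ℂ} (hk : Integrable k) (Ψ : 𝓢(E, ℂ)) :
    ∫ x, 𝓕⁻ k x * Ψ x = ∫ x, k x * (𝓕⁻ Ψ : 𝓢(E, ℂ)) x := by
  have h := VectorFourier.integral_fourierIntegral_smul_eq_flip (L := -innerₗ E)
    Real.continuous_fourierChar (continuous_inner (𝕜 := ℝ) (E := E)).neg hk (Ψ.integrable (μ := volume))
  rw [SchwartzMap.fourierInv_coe]
  have hflip : (-innerₗ E).flip = -innerₗ E := by
    ext x y
    simp [real_inner_comm]
  rw [hflip] at h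
  exact h

/-- The inverse transform on `L²` and the inversion integral have the same pairings with Schwartz
functions. -/
theorem fourierInv_toLp_ae_eq {k : E → ℂ} (hk : Integrable k) (hk2 : MemLp k 2) :
    (𝓕⁻ (hk2.toLp k) : Lp ℂ 2 (volume : Measure E)) =ᵐ[volume] 𝓕⁻ k := by
  refine ae_eq_of_integral_mul_schwartz_eq ((Lp.memLp _).locallyIntegrable (by norm_num))
    (continuous_fourierInv hk).locallyIntegrable fun Φ _ => ?_
  rw [integral_fourierInv_L2_mul, integral_fourierInv_mul hk]
  refine integral_congr_ae ?_
  filter_upwards [hk2.coeFn_toLp] with x hx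
  rw [hx]

theorem exists_schwartz_decay (Φ : 𝓢(E, ℂ)) (r : ℕ) :
    ∃ C, 0 ≤ C ∧ ∀ x, ‖Φ x‖ ≤ C * ((1 + ‖x‖) ^ r)⁻¹ := by
  refine ⟨2 ^ r * (Finset.Iic (r, 0)).sup (fun m => SchwartzMap.seminorm ℝ m.1 m.2) Φ,
    by positivity, fun x => ?_⟩
  have h := SchwartzMap.one_add_le_sup_seminorm_apply (𝕜 := ℝ) (m := (r, 0)) le_rfl le_rfl Φ x
  rw [norm_iteratedFDeriv_zero, mul_comm] at h
  rw [← div_eq_mul_inv, le_div_iff₀ (by positivity)]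
  exact h

end General

section Density

variable {X : Type*} [MeasurableSpace X] {μ : Measure X}

theorem exists_mul_L2 {ψ : X → ℂ} {C : ℝ} (hψ : AEStronglyMeasurable ψ μ) (hC : ∀ x, ‖ψ x‖ ≤ C)
    (u : Lp ℂ 2 μ) : MemLp (fun x => ψ x * u x) 2 μ :=
  (Lp.memLp u).of_le_mul (c := C) (hψ.mul (Lp.aestronglyMeasurable u))
    (Eventually.of_forall fun x => by rw [norm_mul]; gcongr; exact hC x)

/-- Writing the integral as an inner product shows that it is bounded and continuous in u, which
gives the bounds and limits needed for the density. -/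
theorem integral_norm_sq_mul_eq_inner {ψ : X → ℂ} {C : ℝ} (hψ : AEStronglyMeasurable ψ μ)
    (hC : ∀ x, ‖ψ x‖ ≤ C) (u : Lp ℂ 2 μ) :
    ∫ x, ((‖u x‖ ^ 2 : ℝ) : ℂ) * ψ x ∂μ = inner ℂ u ((exists_mul_L2 hψ hC u).toLp _) := by
  rw [L2.inner_def]
  refine integral_congr_ae ?_
  filter_upwards [(exists_mul_L2 hψ hC u).coeFn_toLp] with x hx
  rw [hx, RCLike.inner_apply, mul_assoc, Complex.mul_conj, Complex.normSq_eq_norm_sq, mul_comm]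

theorem norm_mul_L2_sub_le {ψ : X → ℂ} {C : ℝ} (hψ : AEStronglyMeasurable ψ μ)
    (hC : ∀ x, ‖ψ x‖ ≤ C) (u v : Lp ℂ 2 μ) :
    ‖(exists_mul_L2 hψ hC u).toLp _ - (exists_mul_L2 hψ hC v).toLp _‖ ≤ C * ‖u - v‖ := by
  refine Lp.norm_le_mul_norm_of_ae_le_mul ?_
  filter_upwards [(exists_mul_L2 hψ hC u).coeFn_toLp, (exists_mul_L2 hψ hC v).coeFn_toLp,
    Lp.coeFn_sub u v, Lp.coeFn_sub ((exists_mul_L2 hψ hC u).toLp _)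
      ((exists_mul_L2 hψ hC v).toLp _)] with x h1 h2 h3 h4
  rw [h4, h3, Pi.sub_apply, Pi.sub_apply, h1, h2, ← mul_sub, norm_mul]
  gcongr
  exact hC x

theorem norm_integral_norm_sq_mul_le {ψ : X → ℂ} {C : ℝ} (hψ : AEStronglyMeasurable ψ μ)
    (hC : ∀ x, ‖ψ x‖ ≤ C) (u : Lp ℂ 2 μ) :
    ‖∫ x, ((‖u x‖ ^ 2 : ℝ) : ℂ) * ψ x ∂μ‖ ≤ C * ‖u‖ ^ 2 := by
  rw [integral_norm_sq_mul_eq_inner hψ hC]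
  refine (norm_inner_le_norm _ _).trans ?_
  have h : ‖(exists_mul_L2 hψ hC u).toLp _‖ ≤ C * ‖u‖ := by
    refine Lp.norm_le_mul_norm_of_ae_le_mul ?_
    filter_upwards [(exists_mul_L2 hψ hC u).coeFn_toLp] with x h1
    rw [h1, norm_mul]
    gcongr
    exact hC x
  calc _ ≤ ‖u‖ * (C * ‖u‖) := by gcongr
    _ = _ := by ring

theorem tendsto_integral_norm_sq_mul {ψ : X → ℂ} {C : ℝ} (hψ : AEStronglyMeasurable ψ μ)
    (hC : ∀ x, ‖ψ x‖ ≤ C) {u : ℕ → Lp ℂ 2 μ} {v : Lp ℂ 2 μ} (h : Tendsto u atTop (𝓝 v)) :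
    Tendsto (fun n => ∫ x, ((‖u n x‖ ^ 2 : ℝ) : ℂ) * ψ x ∂μ) atTop
      (𝓝 (∫ x, ((‖v x‖ ^ 2 : ℝ) : ℂ) * ψ x ∂μ)) := by
  simp_rw [integral_norm_sq_mul_eq_inner hψ hC]
  refine h.inner (tendsto_iff_norm_sub_tendsto_zero.2 ?_)
  refine squeeze_zero (fun _ => norm_nonneg _) (fun n => norm_mul_L2_sub_le hψ hC (u n) v) ?_
  simpa using (tendsto_iff_norm_sub_tendsto_zero.1 h).const_mul C

end Density

end FourierPairing

end KleinGordon

namespace KleinGordon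

set_option linter.unusedSectionVars false

/-! ### The space-time Fourier transform of the density -/

noncomputable section Waves

open Set Metric Module Filter Topology
open scoped NNReal ComplexConjugate

variable {d : ℕ}

/-- In the unitary normalisation the mass is s/(2π), and the phase t·`symbol` is 2πt times an
energy, matching the Fourier kernel in time. -/
theorem symbol_eq (s : ℝ) (ν : Space d) : symbol s ν = 2 * Real.pi * energy (s / (2 * Real.pi)) ν := by
  have hπ := Real.pi_pos
  rw [symbol, phi, energy, ← Real.sqrt_sq (show 0 ≤ 2 * Real.pi by positivity), ← Real.sqrt_mul (by positivity),
    Real.sqrt_sq (by positivity)]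
  congr 1
  field_simp

@[fun_prop]
theorem continuous_symbol (s : ℝ) : Continuous (symbol s : Space d → ℝ) := by
  unfold symbol phi; fun_prop

/-- The restriction of the Fourier transform of `f` to frequencies at most `n`. -/
def lowFreq (f : L2 d) (n : ℕ) : Space d → ℂ :=
  (closedBall (0 : Space d) n).indicator (𝓕 f : L2 d)

theorem measurable_fourier (f : L2 d) : Measurable (𝓕 f : L2 d) :=
  (Lp.stronglyMeasurable _).measurable

@[fun_prop]
theorem measurable_lowFreq (f : L2 d) (n : ℕ) : Measurable (lowFreq f n) :=
  (measurable_fourier f).indicator measurableSet_closedBall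

theorem memLp_lowFreq (f : L2 d) (n : ℕ) : MemLp (lowFreq f n) 2 :=
  (Lp.memLp _).indicator measurableSet_closedBall

theorem integrable_lowFreq (f : L2 d) (n : ℕ) : Integrable (lowFreq f n) := by
  refine (integrable_indicator_iff measurableSet_closedBall).2 ?_
  exact ((Lp.memLp (𝓕 f : L2 d)).locallyIntegrable (by norm_num)).integrableOn_isCompact
    (isCompact_closedBall _ _)

theorem norm_lowFreq_le (f : L2 d) (n : ℕ) (ν : Space d) :
    ‖lowFreq f n ν‖ ≤ ‖(𝓕 f : L2 d) ν‖ := norm_indicator_le_norm_self _ _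

theorem lowFreq_eq {f : L2 d} {n : ℕ} {ν : Space d} (h : ‖ν‖ ≤ n) :
    lowFreq f n ν = (𝓕 f : L2 d) ν := indicator_of_mem (mem_closedBall_zero_iff.2 h) _

/-- The time evolution of `lowFreq f n`, on the Fourier side. -/
def lowWaveHat (s : ℝ) (f : L2 d) (n : ℕ) (t : ℝ) (ν : Space d) : ℂ :=
  Complex.exp (((t * symbol s ν : ℝ) : ℂ) * Complex.I) * lowFreq f n ν

theorem norm_lowWaveHat (s : ℝ) (f : L2 d) (n : ℕ) (t : ℝ) (ν : Space d) :
    ‖lowWaveHat s f n t ν‖ = ‖lowFreq f n ν‖ := by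
  rw [lowWaveHat, norm_mul, Complex.norm_exp_ofReal_mul_I, one_mul]

@[fun_prop]
theorem Measurable.lowWaveHat {X : Type*} [MeasurableSpace X] {s : ℝ} {f : L2 d} {n : ℕ} {t : X → ℝ}
    {ν : X → Space d} (ht : Measurable t) (hν : Measurable ν) :
    Measurable fun x => lowWaveHat s f n (t x) (ν x) := by
  unfold KleinGordon.lowWaveHat; fun_prop

theorem measurable_lowWaveHat_right (s : ℝ) (f : L2 d) (n : ℕ) (t : ℝ) :
    Measurable (lowWaveHat s f n t) := Measurable.lowWaveHat measurable_const measurable_id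

theorem integrable_lowWaveHat (s : ℝ) (f : L2 d) (n : ℕ) (t : ℝ) :
    Integrable (lowWaveHat s f n t) :=
  (integrable_lowFreq f n).mono (measurable_lowWaveHat_right s f n t).aestronglyMeasurable
    (Eventually.of_forall fun ν => (norm_lowWaveHat s f n t ν).le)

theorem memLp_lowWaveHat (s : ℝ) (f : L2 d) (n : ℕ) (t : ℝ) : MemLp (lowWaveHat s f n t) 2 :=
  (memLp_lowFreq f n).of_le (measurable_lowWaveHat_right s f n t).aestronglyMeasurable
    (Eventually.of_forall fun ν => (norm_lowWaveHat s f n t ν).le)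

/-- The contribution of the frequency `ν` to the wave at the point `z` of space-time. -/
def waveIntegrand (s : ℝ) (f : L2 d) (n : ℕ) (z : ℝ × Space d) (ν : Space d) : ℂ :=
  Complex.exp (((2 * Real.pi * inner ℝ ν z.2 : ℝ) : ℂ) * Complex.I) * lowWaveHat s f n z.1 ν

theorem norm_waveIntegrand (s : ℝ) (f : L2 d) (n : ℕ) (z : ℝ × Space d) (ν : Space d) :
    ‖waveIntegrand s f n z ν‖ = ‖lowFreq f n ν‖ := by
  rw [waveIntegrand, norm_mul, Complex.norm_exp_ofReal_mul_I, one_mul, norm_lowWaveHat]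

@[fun_prop]
theorem Measurable.waveIntegrand {X : Type*} [MeasurableSpace X] {s : ℝ} {f : L2 d} {n : ℕ}
    {z : X → ℝ × Space d} {ν : X → Space d} (hz : Measurable z) (hν : Measurable ν) :
    Measurable fun x => waveIntegrand s f n (z x) (ν x) := by
  unfold KleinGordon.waveIntegrand
  have h : Measurable fun x => (inner ℝ (ν x) (z x).2 : ℝ) := hν.inner hz.snd
  fun_prop

/-- The low-frequency part of the wave, as a function. -/
def lowWave (s : ℝ) (f : L2 d) (n : ℕ) (t : ℝ) (x : Space d) : ℂ := 𝓕⁻ (lowWaveHat s f n t) x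

/-- The low-frequency part of the wave, as an element of `L²`. -/
def lowWaveL2 (s : ℝ) (f : L2 d) (n : ℕ) (t : ℝ) : L2 d :=
  𝓕⁻ ((memLp_lowWaveHat s f n t).toLp _ : L2 d)

theorem lowWaveL2_ae_eq (s : ℝ) (f : L2 d) (n : ℕ) (t : ℝ) :
    lowWaveL2 s f n t =ᵐ[volume] lowWave s f n t :=
  fourierInv_toLp_ae_eq (integrable_lowWaveHat s f n t) (memLp_lowWaveHat s f n t)

theorem lowWave_eq (s : ℝ) (f : L2 d) (n : ℕ) (z : ℝ × Space d) :
    lowWave s f n z.1 z.2 = ∫ ν, waveIntegrand s f n z ν := by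
  rw [lowWave, Real.fourierInv_eq']
  rfl

theorem measurable_lowWave (s : ℝ) (f : L2 d) (n : ℕ) :
    Measurable fun z : ℝ × Space d => lowWave s f n z.1 z.2 := by
  simp_rw [lowWave_eq]
  have h : Measurable fun q : (ℝ × Space d) × Space d => waveIntegrand s f n q.1 q.2 :=
    Measurable.waveIntegrand measurable_fst measurable_snd
  exact h.stronglyMeasurable.integral_prod_right'.measurable

theorem norm_fourierInv_L2 (F : L2 d) : ‖(𝓕⁻ F : L2 d)‖ = ‖F‖ := by
  rw [← Lp.norm_fourier_eq (𝓕⁻ F : L2 d), FourierTransform.fourier_fourierInv_eq]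

theorem norm_propagator (s t : ℝ) (f : L2 d) : ‖propagator s t f‖ = ‖f‖ := by
  rw [propagator, norm_fourierInv_L2, ← Lp.norm_fourier_eq f, Lp.norm_toLp, Lp.norm_def]
  congr 1
  refine eLpNorm_congr_norm_ae (Eventually.of_forall fun ν => ?_)
  rw [norm_mul, Complex.norm_exp_ofReal_mul_I, one_mul]

theorem norm_lowWaveL2_le (s t : ℝ) (f : L2 d) (n : ℕ) : ‖lowWaveL2 s f n t‖ ≤ ‖f‖ := by
  rw [lowWaveL2, norm_fourierInv_L2, ← Lp.norm_fourier_eq f, Lp.norm_toLp, Lp.norm_def]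
  refine ENNReal.toReal_mono (Lp.eLpNorm_ne_top _) (eLpNorm_mono fun ν => ?_)
  rw [norm_lowWaveHat]
  exact norm_lowFreq_le f n ν

/-- The propagator is an `L²` isometry commuting with the truncation, so the error does not depend
on t. `exists_measurable_enorm_propagator` relies on this to choose one subsequence for all times.
-/
theorem norm_lowWaveL2_sub (s t : ℝ) (f : L2 d) (n : ℕ) :
    ‖lowWaveL2 s f n t - propagator s t f‖ = ‖(memLp_lowFreq f n).toLp _ - (𝓕 f : L2 d)‖ := by
  have h : lowWaveL2 s f n t - propagator s t f = (𝓕⁻ ((memLp_lowWaveHat s f n t).toLp _ -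
      (memLp_propagator s t f).toLp _ : L2 d) : L2 d) := by
    rw [sub_eq_iff_eq_add, lowWaveL2, propagator, ← FourierTransform.fourierInv_add, sub_add_cancel]
  rw [h, norm_fourierInv_L2, Lp.norm_def, Lp.norm_def]
  congr 1
  refine eLpNorm_congr_norm_ae ?_
  filter_upwards [Lp.coeFn_sub ((memLp_lowWaveHat s f n t).toLp _)
    ((memLp_propagator s t f).toLp _), (memLp_lowWaveHat s f n t).coeFn_toLp,
    (memLp_propagator s t f).coeFn_toLp, Lp.coeFn_sub ((memLp_lowFreq f n).toLp _) (𝓕 f : L2 d),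
    (memLp_lowFreq f n).coeFn_toLp] with ν h1 h2 h3 h4 h5
  rw [h1, h4, Pi.sub_apply, Pi.sub_apply, h2, h3, h5, lowWaveHat, ← mul_sub, norm_mul,
    Complex.norm_exp_ofReal_mul_I, one_mul]

theorem tendsto_lowFreq (f : L2 d) :
    Tendsto (fun n => ((memLp_lowFreq f n).toLp _ : L2 d)) atTop (𝓝 (𝓕 f : L2 d)) := by
  rw [← Lp.toLp_coeFn (𝓕 f : L2 d) (Lp.memLp _), Lp.tendsto_Lp_iff_tendsto_eLpNorm'']
  have hm : ∀ n, Measurable fun ν => ‖lowFreq f n ν - (𝓕 f : L2 d) ν‖ₑ ^ (2 : ℝ) := fun n =>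
    ((measurable_lowFreq f n).sub (measurable_fourier f)).enorm.pow_const _
  have h : Tendsto (fun n : ℕ => ∫⁻ ν, ‖lowFreq f n ν - (𝓕 f : L2 d) ν‖ₑ ^ (2 : ℝ)) atTop
      (𝓝 (∫⁻ _ : Space d, 0)) := by
    refine tendsto_lintegral_of_dominated_convergence
      (fun ν => ‖(𝓕 f : L2 d) ν‖ₑ ^ (2 : ℝ)) hm (fun n => Eventually.of_forall fun ν => ?_) ?_
      (Eventually.of_forall fun ν => ?_)
    · refine ENNReal.rpow_le_rpow ?_ two_pos.le
      by_cases h : ν ∈ closedBall (0 : Space d) n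
      · simp [lowFreq, h]
      · simp [lowFreq, h]
    · have h1 := (Lp.memLp (𝓕 f : L2 d)).eLpNorm_lt_top
      rw [eLpNorm_lt_top_iff_lintegral_rpow_enorm_lt_top two_ne_zero ENNReal.ofNat_ne_top] at h1
      simpa using h1.ne
    · obtain ⟨N, hN⟩ := exists_nat_ge ‖ν‖
      refine tendsto_const_nhds.congr' ?_
      filter_upwards [eventually_ge_atTop N] with n hn
      rw [lowFreq_eq (hN.trans (by exact_mod_cast hn)), sub_self, enorm_zero,
        ENNReal.zero_rpow_of_pos two_pos]
  rw [lintegral_zero] at h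
  have h2 := h.ennrpow_const (1 / 2)
  rw [ENNReal.zero_rpow_of_pos (by norm_num)] at h2
  refine h2.congr fun n => ?_
  rw [eLpNorm_eq_lintegral_rpow_enorm_toReal two_ne_zero ENNReal.ofNat_ne_top]
  simp

theorem tendsto_lowWaveL2 (s t : ℝ) (f : L2 d) :
    Tendsto (fun n => lowWaveL2 s f n t) atTop (𝓝 (propagator s t f)) := by
  rw [tendsto_iff_norm_sub_tendsto_zero]
  simp_rw [norm_lowWaveL2_sub]
  exact tendsto_iff_norm_sub_tendsto_zero.1 (tendsto_lowFreq f)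

/-- The space-time frequency attached to a pair of momenta. -/
def transferPoint (m : ℝ) (p : Space d × Space d) : SpaceTime d :=
  WithLp.toLp 2 (energy m p.1 - energy m p.2, p.1 - p.2)

theorem integral_spaceTime {F : Type*} [NormedAddCommGroup F] [NormedSpace ℝ F]
    (f : SpaceTime d → F) : ∫ z : ℝ × Space d, f (WithLp.toLp 2 z) = ∫ p, f p :=
  (WithLp.volume_preserving_toLp ℝ (Space d)).integral_comp
    (MeasurableEquiv.toLp 2 (ℝ × Space d)).measurableEmbedding f

theorem integrable_comp_toLp {f : SpaceTime d → ℂ} (hf : Integrable f) :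
    Integrable fun z : ℝ × Space d => f (WithLp.toLp 2 z) :=
  (WithLp.volume_preserving_toLp ℝ (Space d)).integrable_comp_of_integrable hf

/-- A truncated transform is integrable, so |u|² is an absolutely convergent double integral of
plane waves in t and x. Fubini's theorem and space-time Fourier inversion then evaluate Φ at the
transferred frequency. -/
theorem integral_lowWave_mul (s : ℝ) (f : L2 d) (n : ℕ) (Φ : 𝓢(SpaceTime d, ℂ)) :
    ∫ t : ℝ, ∫ x : Space d, ((‖lowWave s f n t x‖ ^ 2 : ℝ) : ℂ) *
        (𝓕 Φ : 𝓢(SpaceTime d, ℂ)) (WithLp.toLp 2 (t, x)) =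
      ∫ p : Space d × Space d, lowFreq f n p.1 * conj (lowFreq f n p.2) *
        Φ (transferPoint (s / (2 * Real.pi)) p) := by
  set m := s / (2 * Real.pi)
  set Ψ : ℝ × Space d → ℂ := fun z => (𝓕 Φ : 𝓢(SpaceTime d, ℂ)) (WithLp.toLp 2 z) with hΨ
  have hΨi : Integrable Ψ := integrable_comp_toLp (𝓕 Φ : 𝓢(SpaceTime d, ℂ)).integrable
  set F : ℝ × Space d → Space d × Space d → ℂ := fun z p =>
    waveIntegrand s f n z p.1 * conj (waveIntegrand s f n z p.2) * Ψ z with hFdef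
  have hF : Integrable (Function.uncurry F) (volume.prod volume) := by
    have h1 := hΨi.mul_prod ((integrable_lowFreq f n).mul_prod (integrable_lowFreq f n))
    refine h1.mono ?_ (Eventually.of_forall ?_)
    · have h2 : Measurable fun q : (ℝ × Space d) × (Space d × Space d) =>
          waveIntegrand s f n q.1 q.2.1 :=
        Measurable.waveIntegrand measurable_fst measurable_snd.fst
      have h3 : Measurable fun q : (ℝ × Space d) × (Space d × Space d) =>
          waveIntegrand s f n q.1 q.2.2 :=
        Measurable.waveIntegrand measurable_fst measurable_snd.snd
      have h4 : Measurable fun q : (ℝ × Space d) × (Space d × Space d) =>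
          conj (waveIntegrand s f n q.1 q.2.2) := Complex.continuous_conj.measurable.comp h3
      exact (h2.mul h4).aestronglyMeasurable.mul hΨi.aestronglyMeasurable.comp_fst
    · rintro ⟨z, p⟩
      simp only [Function.uncurry_apply_pair, hFdef, norm_mul, RCLike.norm_conj,
        norm_waveIntegrand]
      exact le_of_eq (by ring)
  have hz : ∀ z : ℝ × Space d, ((‖lowWave s f n z.1 z.2‖ ^ 2 : ℝ) : ℂ) * Ψ z = ∫ p, F z p := by
    intro z
    rw [← Complex.normSq_eq_norm_sq, ← Complex.mul_conj, lowWave_eq, ← integral_conj,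
      ← integral_prod_mul, ← integral_mul_const]
    rfl
  have hp : ∀ p : Space d × Space d, ∫ z, F z p =
      lowFreq f n p.1 * conj (lowFreq f n p.2) * Φ (transferPoint m p) := by
    intro p
    have h1 : ∀ z, F z p = lowFreq f n p.1 * conj (lowFreq f n p.2) *
        (Complex.exp (((2 * Real.pi * inner ℝ (WithLp.toLp 2 z : SpaceTime d)
          (transferPoint m p) : ℝ) : ℂ) * Complex.I) • Ψ z) := by
      intro z
      -- One plane wave times the conjugate of another is the plane wave of the difference of their
      -- space-time frequencies.
      have h2 : Complex.exp (((2 * Real.pi * inner ℝ (WithLp.toLp 2 z : SpaceTime d)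
          (transferPoint m p) : ℝ) : ℂ) * Complex.I) =
          Complex.exp (((2 * Real.pi * inner ℝ p.1 z.2 : ℝ) : ℂ) * Complex.I) *
          Complex.exp (((z.1 * symbol s p.1 : ℝ) : ℂ) * Complex.I) *
          (conj (Complex.exp (((2 * Real.pi * inner ℝ p.2 z.2 : ℝ) : ℂ) * Complex.I)) *
          conj (Complex.exp (((z.1 * symbol s p.2 : ℝ) : ℂ) * Complex.I))) := by
        simp only [← Complex.exp_conj, map_mul, Complex.conj_I, Complex.conj_ofReal]
        rw [← Complex.exp_add, ← Complex.exp_add, ← Complex.exp_add, WithLp.prod_inner_apply,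
          symbol_eq, symbol_eq]
        congr 1
        simp only [transferPoint, inner_sub_right]
        rw [real_inner_comm p.1, real_inner_comm p.2]
        push_cast
        simp only [RCLike.inner_apply, conj_trivial]
        push_cast
        ring
      rw [h2]
      simp only [hFdef, waveIntegrand, lowWaveHat, map_mul, smul_eq_mul]
      ring
    simp_rw [h1]
    rw [integral_const_mul]
    congr 1
    have h3 := integral_spaceTime (d := d) fun v : SpaceTime d =>
      Complex.exp (((2 * Real.pi * inner ℝ v (transferPoint m p) : ℝ) : ℂ) * Complex.I) •
        (𝓕 Φ : 𝓢(SpaceTime d, ℂ)) v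
    rw [hΨ]
    beta_reduce
    rw [h3, ← Real.fourierInv_eq', ← SchwartzMap.fourierInv_coe,
      FourierTransform.fourierInv_fourier_eq]
  calc _ = ∫ t : ℝ, ∫ x : Space d, (fun z : ℝ × Space d => ∫ p, F z p) (t, x) := by
        simp_rw [← hz]; rfl
    _ = ∫ z : ℝ × Space d, ∫ p, F z p := by
        exact (integral_prod _ hF.integral_prod_left).symm
    _ = ∫ p, ∫ z, F z p := integral_integral_swap hF
    _ = _ := by simp_rw [hp]

/-- Bound ‖g(x)‖‖g(y)‖ by ‖g(x)‖² + ‖g(y)‖²; each term is then the integrand of a convolution of two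
integrable functions. -/
theorem integrable_mul_mul_sub {g : Space d → ℂ} (hg : MemLp g 2) {w : Space d → ℝ}
    (hw : Integrable w) : Integrable fun p : Space d × Space d => ‖g p.1‖ * ‖g p.2‖ * w (p.1 - p.2) := by
  have hg2 : Integrable fun x => ‖g x‖ ^ 2 := hg.integrable_norm_pow two_ne_zero
  have h1 := Integrable.convolution_integrand (ContinuousLinearMap.mul ℝ ℝ) hg2 hw
  have h2 := (Integrable.convolution_integrand (ContinuousLinearMap.mul ℝ ℝ) hg2 hw.comp_neg).swap
  have hw2 : AEStronglyMeasurable (fun p : Space d × Space d => w (p.1 - p.2))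
      (volume.prod volume) :=
    hw.aestronglyMeasurable.comp_quasiMeasurePreserving
      (quasiMeasurePreserving_sub_of_right_invariant volume volume)
  refine (h1.add h2).mono ((hg.aestronglyMeasurable.norm.comp_fst.mul
    hg.aestronglyMeasurable.norm.comp_snd).mul hw2) (Eventually.of_forall fun p => ?_)
  simp only [Pi.add_apply, ContinuousLinearMap.mul_apply', Function.comp_apply, Prod.fst_swap,
    Prod.snd_swap, neg_sub, norm_mul, norm_norm]
  rw [← add_mul, norm_mul, Real.norm_of_nonneg (show 0 ≤ ‖g p.2‖ ^ 2 + ‖g p.1‖ ^ 2 by positivity)]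
  gcongr
  nlinarith [sq_nonneg (‖g p.1‖ - ‖g p.2‖), norm_nonneg (g p.1), norm_nonneg (g p.2)]

theorem integrable_inv_one_add_norm_pow {E : Type*} [NormedAddCommGroup E] [NormedSpace ℝ E]
    [FiniteDimensional ℝ E] [MeasureSpace E] [BorelSpace E]
    [(volume : Measure E).IsAddHaarMeasure] {r : ℕ} (hr : finrank ℝ E < r) :
    Integrable fun x : E => ((1 + ‖x‖) ^ r)⁻¹ := by
  refine (integrable_one_add_norm (E := E) (μ := volume) (r := r) (by exact_mod_cast hr)).congr
    (Eventually.of_forall fun x => ?_)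
  beta_reduce
  rw [Real.rpow_neg (by positivity), Real.rpow_natCast]

theorem exists_transferPoint_decay (Φ : 𝓢(SpaceTime d, ℂ)) : ∃ w : Space d → ℝ, Integrable w ∧
    (∀ ξ, 0 ≤ w ξ) ∧ ∀ v : SpaceTime d, ‖Φ v‖ ≤ w v.snd := by
  obtain ⟨C, hC0, hC⟩ := exists_schwartz_decay Φ (d + 1)
  refine ⟨fun ξ => C * ((1 + ‖ξ‖) ^ (d + 1))⁻¹, ?_, fun ξ => by positivity, fun v => ?_⟩
  · exact (integrable_inv_one_add_norm_pow (by simp)).const_mul C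
  · refine (hC v).trans ?_
    have h : ‖v.snd‖ ≤ ‖v‖ := WithLp.norm_snd_le _ v
    beta_reduce
    gcongr

theorem integrable_fourier_transferPoint (f : L2 d) (m : ℝ) (Φ : 𝓢(SpaceTime d, ℂ)) :
    Integrable fun p : Space d × Space d =>
      ‖(𝓕 f : L2 d) p.1‖ * ‖(𝓕 f : L2 d) p.2‖ * ‖Φ (transferPoint m p)‖ := by
  obtain ⟨w, hw, hw0, hΦ⟩ := exists_transferPoint_decay Φ
  have hm := measurable_fourier f
  refine (integrable_mul_mul_sub (Lp.memLp (𝓕 f : L2 d)) hw).mono' ?_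
    (Eventually.of_forall fun p => ?_)
  · have h1 : Continuous (transferPoint m : Space d × Space d → SpaceTime d) := by
      unfold transferPoint; fun_prop
    exact (((hm.comp measurable_fst).norm.mul (hm.comp measurable_snd).norm).mul
      (Φ.continuous.comp h1).norm.measurable).aestronglyMeasurable
  · rw [Real.norm_of_nonneg (by positivity)]
    gcongr
    exact hΦ _

/-- The truncation in `integral_lowWave_mul` is removed on both sides: on the left by `L²`
convergence at each time and decay of the test function in t, on the right by decay of Φ in the
momentum transfer. -/
theorem integral_density_mul (s : ℝ) (f : L2 d) (Φ : 𝓢(SpaceTime d, ℂ)) :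
    ∫ t : ℝ, ∫ x : Space d, density s f t x *
        (𝓕 Φ : 𝓢(SpaceTime d, ℂ)) (WithLp.toLp 2 (t, x)) =
      ∫ p : Space d × Space d, (𝓕 f : L2 d) p.1 * conj ((𝓕 f : L2 d) p.2) *
        Φ (transferPoint (s / (2 * Real.pi)) p) := by
  set Ψ : 𝓢(SpaceTime d, ℂ) := 𝓕 Φ
  obtain ⟨C, hC0, hC⟩ := exists_schwartz_decay Ψ 2
  have hΨt : ∀ (t : ℝ) (x : Space d), ‖Ψ (WithLp.toLp 2 (t, x))‖ ≤ C * ((1 + ‖t‖) ^ 2)⁻¹ := by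
    intro t x
    refine (hC _).trans ?_
    have h : ‖t‖ ≤ ‖(WithLp.toLp 2 (t, x) : SpaceTime d)‖ :=
      WithLp.norm_fst_le _ (WithLp.toLp 2 (t, x) : SpaceTime d)
    gcongr
  have hΨm : ∀ t : ℝ, AEStronglyMeasurable (fun x : Space d => Ψ (WithLp.toLp 2 (t, x))) :=
    fun t => Continuous.aestronglyMeasurable (by fun_prop)
  have hlow : ∀ n t, ∫ x : Space d, ((‖lowWave s f n t x‖ ^ 2 : ℝ) : ℂ) * Ψ (WithLp.toLp 2 (t, x)) =
      ∫ x : Space d, ((‖lowWaveL2 s f n t x‖ ^ 2 : ℝ) : ℂ) * Ψ (WithLp.toLp 2 (t, x)) := by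
    intro n t
    refine integral_congr_ae ?_
    filter_upwards [lowWaveL2_ae_eq s f n t] with x hx
    rw [hx]
  have h1 : Tendsto (fun n => ∫ t : ℝ, ∫ x : Space d, ((‖lowWave s f n t x‖ ^ 2 : ℝ) : ℂ) *
      Ψ (WithLp.toLp 2 (t, x))) atTop
      (𝓝 (∫ t : ℝ, ∫ x : Space d, density s f t x * Ψ (WithLp.toLp 2 (t, x)))) := by
    refine tendsto_integral_of_dominated_convergence
      (fun t => C * ((1 + ‖t‖) ^ 2)⁻¹ * ‖f‖ ^ 2) (fun n => ?_) ?_ (fun n => ?_) ?_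
    · have h2 : Measurable fun z : ℝ × Space d => ((‖lowWave s f n z.1 z.2‖ ^ 2 : ℝ) : ℂ) *
          Ψ (WithLp.toLp 2 z) := by
        have h3 := (measurable_lowWave s f n).norm
        have h4 : Measurable fun z : ℝ × Space d => Ψ (WithLp.toLp 2 z) :=
          Continuous.measurable (by fun_prop)
        exact (Complex.measurable_ofReal.comp (h3.pow_const 2)).mul h4
      exact h2.stronglyMeasurable.integral_prod_right'.aestronglyMeasurable
    · exact ((integrable_inv_one_add_norm_pow (by simp)).const_mul C).mul_const _
    · refine Eventually.of_forall fun t => ?_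
      rw [hlow]
      refine (norm_integral_norm_sq_mul_le (hΨm t) (hΨt t) _).trans ?_
      have := norm_lowWaveL2_le s t f n
      gcongr
    · refine Eventually.of_forall fun t => ?_
      simp_rw [hlow]
      exact tendsto_integral_norm_sq_mul (hΨm t) (hΨt t) (tendsto_lowWaveL2 s t f)
  simp_rw [Ψ, integral_lowWave_mul] at h1
  refine tendsto_nhds_unique h1 ?_
  have hm := measurable_fourier f
  have hcont : Continuous (transferPoint (s / (2 * Real.pi)) : Space d × Space d → SpaceTime d) := by
    unfold transferPoint; fun_prop
  refine tendsto_integral_of_dominated_convergence _ (fun n => ?_)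
    (integrable_fourier_transferPoint f (s / (2 * Real.pi)) Φ) (fun n => ?_) ?_
  · have h2 : Measurable fun p : Space d × Space d => lowFreq f n p.1 :=
      (measurable_lowFreq f n).comp measurable_fst
    have h3 : Measurable fun p : Space d × Space d => conj (lowFreq f n p.2) :=
      Complex.continuous_conj.measurable.comp ((measurable_lowFreq f n).comp measurable_snd)
    exact ((h2.mul h3).mul (Φ.continuous.comp hcont).measurable).aestronglyMeasurable
  · refine Eventually.of_forall fun p => ?_
    rw [norm_mul, norm_mul, RCLike.norm_conj]
    gcongr <;> exact norm_lowFreq_le _ _ _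
  · refine Eventually.of_forall fun p => ?_
    obtain ⟨N, hN⟩ := exists_nat_ge (max ‖p.1‖ ‖p.2‖)
    rw [max_le_iff] at hN
    refine tendsto_const_nhds.congr' ?_
    filter_upwards [eventually_ge_atTop N] with n hn
    have hn' : (N : ℝ) ≤ n := by exact_mod_cast hn
    rw [lowFreq_eq (hN.1.trans hn'), lowFreq_eq (hN.2.trans hn')]

end Waves

end KleinGordon

namespace KleinGordon

set_option linter.unusedSectionVars false

/-! ### Push-forward densities of complex functions -/

noncomputable section ComplexDensity

open Set Metric Module Filter Topology
open scoped NNReal ComplexConjugate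

variable {V : Type*} [NormedAddCommGroup V] [InnerProductSpace ℝ V]
  [FiniteDimensional ℝ V] [MeasurableSpace V] [BorelSpace V] {m : ℝ} (hm : 0 < m)

include hm

theorem withDensity_transferDensity (hd : 2 ≤ finrank ℝ V) (a : V × V → ℝ≥0∞) [SFinite (volume.withDensity a)] :
    volume.withDensity (transferDensity m a) = (volume.withDensity a).map (transfer m) :=
  Measure.withDensity_rnDeriv_eq _ _
    (((withDensity_absolutelyContinuous _ _).map (continuous_transfer m).measurable).trans
      (map_transfer_absolutelyContinuous hm hd))

theorem integral_toReal_transferDensity_mul (hd : 2 ≤ finrank ℝ V) {b : V × V → ℝ≥0∞}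
    (hb : Measurable b) (hbt : ∀ p, b p < ∞) (hfin : ∀ᵐ q, transferDensity m b q < ∞)
    {Ψ : V × ℝ → ℂ} (hΨ : Measurable Ψ)
    (hi : Integrable fun p => ((b p).toReal : ℂ) * Ψ (transfer m p)) :
    Integrable (fun q => ((transferDensity m b q).toReal : ℂ) * Ψ q) ∧
      ∫ q, ((transferDensity m b q).toReal : ℂ) * Ψ q =
        ∫ p, ((b p).toReal : ℂ) * Ψ (transfer m p) := by
  have htr := (continuous_transfer (V := V) m).measurable
  have h1 := withDensity_transferDensity hm hd b
  have hbt' : ∀ᵐ p : V × V, b p < ∞ := Eventually.of_forall hbt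
  constructor
  · have h2 : Integrable (fun p => Ψ (transfer m p)) (volume.withDensity b) := by
      rw [integrable_withDensity_iff_integrable_smul' hb hbt']
      simpa only [Complex.real_smul] using hi
    have h3 : Integrable Ψ ((volume.withDensity b).map (transfer m)) :=
      (integrable_map_measure hΨ.aestronglyMeasurable htr.aemeasurable).2 h2
    rw [← h1, integrable_withDensity_iff_integrable_smul' (by fun_prop) hfin] at h3
    simpa only [Complex.real_smul] using h3
  · have h2 := integral_map (μ := volume.withDensity b) htr.aemeasurable
      (f := Ψ) hΨ.aestronglyMeasurable
    rw [← h1, integral_withDensity_eq_integral_toReal_smul (by fun_prop) hfin,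
      integral_withDensity_eq_integral_toReal_smul hb hbt'] at h2
    simpa only [Complex.real_smul] using h2

/-- The product f̂ ⊗ conj f̂ is not integrable for general f in `L²`, but it becomes so with a
decaying weight in the momentum transfer. Such a weight is a function of the target variable, so it
also controls the density. -/
theorem transferDensity_lt_top (hd : 2 ≤ finrank ℝ V) {b : V × V → ℝ≥0∞} (hb : Measurable b)
    {W : V → ℝ} (hW : Measurable W) (hW0 : ∀ ξ, 0 < W ξ)
    (hi : ∫⁻ p, b p * ENNReal.ofReal (W (p.1 - p.2)) ≠ ∞) :
    ∀ᵐ q, transferDensity m b q < ∞ := by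
  have h := lintegral_mul_transferDensity hm hd hb
    (Ψ := fun q => ENNReal.ofReal (W q.1)) (by fun_prop)
  simp only [transfer] at h
  rw [← h] at hi
  filter_upwards [ae_lt_top (by fun_prop) hi] with q hq
  by_contra h0
  rw [not_lt, top_le_iff] at h0
  rw [h0, ENNReal.top_mul (by simpa using hW0 q.1)] at hq
  exact lt_irrefl _ hq

omit hm in
/-- The density of the push-forward of the complex function `a` under `transfer`. -/
def transferDensityC (m : ℝ) (a : V × V → ℂ) (q : V × ℝ) : ℂ :=
  (((transferDensity m (fun p => ENNReal.ofReal (a p).re) q).toReal : ℂ) -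
    ((transferDensity m (fun p => ENNReal.ofReal (-(a p).re)) q).toReal : ℂ)) +
  (((transferDensity m (fun p => ENNReal.ofReal (a p).im) q).toReal : ℂ) -
    ((transferDensity m (fun p => ENNReal.ofReal (-(a p).im)) q).toReal : ℂ)) * Complex.I

omit hm in
@[fun_prop]
theorem measurable_transferDensityC (a : V × V → ℂ) : Measurable (transferDensityC m a) := by
  unfold transferDensityC; fun_prop

variable (hd : 2 ≤ finrank ℝ V) {a : V × V → ℂ} (ha : Measurable a) {W : V → ℝ}
  (hW : Measurable W) (hW0 : ∀ ξ, 0 < W ξ) (hi : Integrable fun p => ‖a p‖ * W (p.1 - p.2))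
include hd ha hW hW0 hi

/-- Positive and negative parts of the real and imaginary parts are pushed forward separately; the
weight W makes the four densities finite almost everywhere, so that their differences are
meaningful. -/
theorem integral_transferDensityC_mul {Ψ : V × ℝ → ℂ} (hΨ : Measurable Ψ)
    (hiΨ : Integrable fun p => ‖a p‖ * ‖Ψ (transfer m p)‖) :
    Integrable (fun q => transferDensityC m a q * Ψ q) ∧
      ∫ q, transferDensityC m a q * Ψ q = ∫ p, a p * Ψ (transfer m p) := by
  have htr := (continuous_transfer (V := V) m).measurable
  have key : ∀ b : V × V → ℝ, Measurable b → (∀ p, |b p| ≤ ‖a p‖) →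
      (Integrable fun p => ((ENNReal.ofReal (b p)).toReal : ℂ) * Ψ (transfer m p)) ∧
      Integrable (fun q =>
        ((transferDensity m (fun p => ENNReal.ofReal (b p)) q).toReal : ℂ) * Ψ q) ∧
      ∫ q, ((transferDensity m (fun p => ENNReal.ofReal (b p)) q).toReal : ℂ) * Ψ q =
        ∫ p, ((ENNReal.ofReal (b p)).toReal : ℂ) * Ψ (transfer m p) := by
    intro b hb hba
    have hle : ∀ p, (ENNReal.ofReal (b p)).toReal ≤ ‖a p‖ := fun p => by
      rw [ENNReal.toReal_ofReal']
      exact max_le ((le_abs_self _).trans (hba p)) (norm_nonneg _)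
    have h1 : Integrable fun p => ((ENNReal.ofReal (b p)).toReal : ℂ) * Ψ (transfer m p) := by
      refine hiΨ.mono ?_ (Eventually.of_forall fun p => ?_)
      · exact ((by fun_prop : Measurable fun p =>
          ((ENNReal.ofReal (b p)).toReal : ℂ)).mul (hΨ.comp htr)).aestronglyMeasurable
      · rw [norm_mul, Complex.norm_real, norm_mul, norm_norm, norm_norm,
          Real.norm_of_nonneg ENNReal.toReal_nonneg]
        gcongr
        exact hle p
    refine ⟨h1, integral_toReal_transferDensity_mul hm hd (by fun_prop) (fun p => by simp)
      (transferDensity_lt_top hm hd (by fun_prop) hW hW0 (ne_top_of_le_ne_top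
        hi.lintegral_lt_top.ne (lintegral_mono fun p => ?_))) hΨ h1⟩
    rw [← ENNReal.ofReal_mul' (hW0 _).le]
    refine ENNReal.ofReal_le_ofReal ?_
    have := hW0 (p.1 - p.2)
    gcongr
    exact (le_abs_self _).trans (hba p)
  obtain ⟨j1, i1, e1⟩ := key (fun p => (a p).re) (by fun_prop) fun p => Complex.abs_re_le_norm _
  obtain ⟨j2, i2, e2⟩ := key (fun p => -(a p).re) (by fun_prop) fun p => by
    rw [abs_neg]; exact Complex.abs_re_le_norm _
  obtain ⟨j3, i3, e3⟩ := key (fun p => (a p).im) (by fun_prop) fun p => Complex.abs_im_le_norm _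
  obtain ⟨j4, i4, e4⟩ := key (fun p => -(a p).im) (by fun_prop) fun p => by
    rw [abs_neg]; exact Complex.abs_im_le_norm _
  have hsplit : ∀ q, transferDensityC m a q * Ψ q =
      (((transferDensity m (fun p => ENNReal.ofReal (a p).re) q).toReal : ℂ) * Ψ q -
      ((transferDensity m (fun p => ENNReal.ofReal (-(a p).re)) q).toReal : ℂ) * Ψ q) +
      (((transferDensity m (fun p => ENNReal.ofReal (a p).im) q).toReal : ℂ) * Ψ q -
      ((transferDensity m (fun p => ENNReal.ofReal (-(a p).im)) q).toReal : ℂ) * Ψ q) *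
        Complex.I := fun q => by
    rw [transferDensityC]; ring
  have hsplit' : ∀ p, a p * Ψ (transfer m p) =
      (((ENNReal.ofReal (a p).re).toReal : ℂ) * Ψ (transfer m p) -
      ((ENNReal.ofReal (-(a p).re)).toReal : ℂ) * Ψ (transfer m p)) +
      (((ENNReal.ofReal (a p).im).toReal : ℂ) * Ψ (transfer m p) -
      ((ENNReal.ofReal (-(a p).im)).toReal : ℂ) * Ψ (transfer m p)) * Complex.I := fun p => by
    have h5 : ∀ x : ℝ, (ENNReal.ofReal x).toReal - (ENNReal.ofReal (-x)).toReal = x := fun x => by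
      rw [ENNReal.toReal_ofReal', ENNReal.toReal_ofReal']
      rcases le_total 0 x with h | h
      · rw [max_eq_left h, max_eq_right (by linarith), sub_zero]
      · rw [max_eq_right h, max_eq_left (by linarith)]; ring
    rw [← sub_mul, ← sub_mul, ← Complex.ofReal_sub, ← Complex.ofReal_sub, h5, h5]
    nth_rewrite 1 [← Complex.re_add_im (a p)]
    ring
  simp_rw [hsplit, hsplit']
  refine ⟨(i1.sub i2).add ((i3.sub i4).mul_const _), ?_⟩
  have s1 := integral_sub i1 i2
  have s2 := integral_sub i3 i4
  have s3 := integral_sub j1 j2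
  have s4 := integral_sub j3 j4
  have t1 := integral_add (i1.sub i2) ((i3.sub i4).mul_const Complex.I)
  have t2 := integral_add (j1.sub j2) ((j3.sub j4).mul_const Complex.I)
  simp only [Pi.sub_apply] at t1 t2
  rw [t1, t2, integral_mul_const, integral_mul_const, s1, s2, s3, s4, e1, e2, e3, e4]

/-- The triangle inequality for push-forwards, by testing against the conjugate phase of the
density; it allows f̂ to be replaced by its modulus. -/
theorem enorm_transferDensityC_le :
    ∀ᵐ q, ‖transferDensityC m a q‖ₑ ≤ transferDensity m (fun p => ‖a p‖ₑ) q := by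
  have htr := (continuous_transfer (V := V) m).measurable
  set h := transferDensityC m a
  have hh : Measurable h := measurable_transferDensityC a
  have h1 : (fun q : V × ℝ => ENNReal.ofReal (W q.1) * ‖h q‖ₑ) ≤ᵐ[volume]
      fun q => ENNReal.ofReal (W q.1) * transferDensity m (fun p => ‖a p‖ₑ) q := by
    refine ae_le_of_forall_setLIntegral_le_of_sigmaFinite (by fun_prop) fun S hS _ => ?_
    -- The phase turns the density into its modulus, and the factor W makes all integrals finite; W
    -- is divided out at the end.
    set Ψ : V × ℝ → ℂ := fun q => S.indicator (fun q => ((W q.1 : ℝ) : ℂ) *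
      (conj (h q) / (‖h q‖ : ℂ))) q
    have hΨ : Measurable Ψ := by
      refine Measurable.indicator ?_ hS
      have h2 : Measurable fun q => conj (h q) := Complex.continuous_conj.measurable.comp hh
      fun_prop
    have hΨn : ∀ q, ‖Ψ q‖ ≤ S.indicator (fun q => W q.1) q := by
      intro q
      simp only [Ψ]
      by_cases hq : q ∈ S
      · rw [indicator_of_mem hq, indicator_of_mem hq, norm_mul, norm_div, RCLike.norm_conj,
          Complex.norm_real, Complex.norm_real, norm_norm, Real.norm_of_nonneg (hW0 _).le]
        exact mul_le_of_le_one_right (hW0 _).le (div_self_le_one _)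
      · rw [indicator_of_notMem hq, indicator_of_notMem hq, norm_zero]
    have hΨW : ∀ q, ‖Ψ q‖ ≤ W q.1 := fun q =>
      (hΨn q).trans (indicator_le_self' (fun _ _ => (hW0 _).le) q)
    have hiΨ : Integrable fun p => ‖a p‖ * ‖Ψ (transfer m p)‖ := by
      refine hi.mono' ((ha.norm.mul (hΨ.comp htr).norm).aestronglyMeasurable)
        (Eventually.of_forall fun p => ?_)
      rw [norm_mul, norm_norm, norm_norm]
      gcongr
      exact hΨW _
    obtain ⟨hint, heq⟩ := integral_transferDensityC_mul hm hd ha hW hW0 hi hΨ hiΨ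
    have h3 : ∀ q, h q * Ψ q = ((S.indicator (fun q => W q.1 * ‖h q‖) q : ℝ) : ℂ) := by
      intro q
      simp only [Ψ]
      by_cases hq : q ∈ S
      · rw [indicator_of_mem hq, indicator_of_mem hq]
        by_cases h0 : h q = 0
        · simp [h0]
        · have h4 : (‖h q‖ : ℂ) ≠ 0 := by simpa using h0
          have h5 : h q * conj (h q) = (‖h q‖ : ℂ) * ‖h q‖ := by
            rw [Complex.mul_conj, Complex.normSq_eq_norm_sq]
            push_cast
            ring
          push_cast
          field_simp
          linear_combination ((W q.1 : ℝ) : ℂ) * h5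
      · rw [indicator_of_notMem hq, indicator_of_notMem hq]; simp
    have h6 : ∀ q, 0 ≤ S.indicator (fun q => W q.1 * ‖h q‖) q := fun q =>
      indicator_nonneg (fun q _ => mul_nonneg (hW0 _).le (norm_nonneg _)) q
    have hintR : Integrable fun q => S.indicator (fun q => W q.1 * ‖h q‖) q := by
      refine hint.norm.congr (Eventually.of_forall fun q => ?_)
      change ‖h q * Ψ q‖ = _
      rw [h3, Complex.norm_real, Real.norm_of_nonneg (h6 q)]
    calc ∫⁻ q in S, ENNReal.ofReal (W q.1) * ‖h q‖ₑ
        = ∫⁻ q, ENNReal.ofReal (S.indicator (fun q => W q.1 * ‖h q‖) q) := by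
          rw [← lintegral_indicator hS]
          refine lintegral_congr fun q => ?_
          by_cases hq : q ∈ S
          · rw [indicator_of_mem hq, indicator_of_mem hq, ENNReal.ofReal_mul (hW0 _).le,
              ofReal_norm]
          · rw [indicator_of_notMem hq, indicator_of_notMem hq, ENNReal.ofReal_zero]
      _ = ENNReal.ofReal (∫ q, S.indicator (fun q => W q.1 * ‖h q‖) q) :=
          (ofReal_integral_eq_lintegral_ofReal hintR (Eventually.of_forall h6)).symm
      _ = ‖∫ q, h q * Ψ q‖ₑ := by
          simp_rw [h3]
          rw [integral_complex_ofReal, ← ofReal_norm, Complex.norm_real,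
            Real.norm_of_nonneg (integral_nonneg h6)]
      _ = ‖∫ p, a p * Ψ (transfer m p)‖ₑ := by rw [heq]
      _ ≤ ∫⁻ p, ‖a p * Ψ (transfer m p)‖ₑ := enorm_integral_le_lintegral_enorm _
      _ ≤ ∫⁻ p, ‖a p‖ₑ * S.indicator (fun q => ENNReal.ofReal (W q.1)) (transfer m p) := by
          refine lintegral_mono fun p => ?_
          rw [enorm_mul]
          refine mul_le_mul_right ?_ _
          rw [← ofReal_norm]
          refine (ENNReal.ofReal_le_ofReal (hΨn _)).trans ?_
          by_cases hq : transfer m p ∈ S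
          · rw [indicator_of_mem hq, indicator_of_mem hq]
          · rw [indicator_of_notMem hq, indicator_of_notMem hq, ENNReal.ofReal_zero]
      _ = ∫⁻ q, transferDensity m (fun p => ‖a p‖ₑ) q *
          S.indicator (fun q => ENNReal.ofReal (W q.1)) q :=
          (lintegral_mul_transferDensity hm hd (by fun_prop)
            (Measurable.indicator (by fun_prop) hS)).symm
      _ = _ := by
          rw [← lintegral_indicator hS]
          refine lintegral_congr fun q => ?_
          by_cases hq : q ∈ S
          · rw [indicator_of_mem hq, indicator_of_mem hq, mul_comm]
          · rw [indicator_of_notMem hq, indicator_of_notMem hq, mul_zero]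
  filter_upwards [h1] with q hq
  exact (ENNReal.mul_le_mul_iff_right (by simpa using hW0 q.1) (by simp)).1 hq

end ComplexDensity

end KleinGordon

namespace KleinGordon

set_option linter.unusedSectionVars false

/-! ### The norm of |□|^β|u|² in terms of push-forward densities -/

noncomputable section BoxNorm

open Set Metric Module Filter Topology
open scoped NNReal ComplexConjugate

variable {d : ℕ}

theorem HasSpaceTimeFourier.ae_eq {G : ℝ → Space d → ℂ} {h h' : SpaceTime d → ℂ}
    (hh : HasSpaceTimeFourier G h) (hh' : HasSpaceTimeFourier G h') : h =ᵐ[volume] h' :=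
  ae_eq_of_integral_mul_schwartz_eq hh.1 hh'.1 fun Φ hΦ => (hh.2 Φ hΦ).symm.trans (hh'.2 Φ hΦ)

theorem HasSpaceTimeFourier.boxNorm_eq {G : ℝ → Space d → ℂ} {h : SpaceTime d → ℂ}
    (hh : HasSpaceTimeFourier G h) (β : ℝ) :
    boxNorm β G = eLpNorm (fun p : SpaceTime d => ((boxSymbol β p : ℝ) : ℂ) * h p) 2 volume := by
  refine le_antisymm (iInf₂_le h hh) (le_iInf₂ fun h' hh' => le_of_eq (eLpNorm_congr_ae ?_))
  filter_upwards [hh.ae_eq hh'] with p hp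
  rw [hp]

/-- The exchange of the time and space components. -/
def spaceTimeSwap (v : SpaceTime d) : Space d × ℝ := (v.snd, v.fst)

theorem measurePreserving_spaceTimeSwap :
    MeasurePreserving (spaceTimeSwap : SpaceTime d → Space d × ℝ) :=
  (Measure.measurePreserving_swap (μ := (volume : Measure ℝ)) (ν := (volume : Measure (Space d)))).comp
    (WithLp.volume_preserving_ofLp ℝ (Space d))

theorem measurableEmbedding_spaceTimeSwap :
    MeasurableEmbedding (spaceTimeSwap : SpaceTime d → Space d × ℝ) :=
  (MeasurableEquiv.prodComm (α := ℝ) (β := Space d)).measurableEmbedding.comp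
    (MeasurableEquiv.toLp 2 (ℝ × Space d)).symm.measurableEmbedding

/-- The weight `(1 + ‖ξ‖)^{-(d+1)}`. -/
def decayWeight (ξ : Space d) : ℝ := ((1 + ‖ξ‖) ^ (d + 1))⁻¹

theorem decayWeight_pos (ξ : Space d) : 0 < decayWeight ξ := by
  unfold decayWeight; positivity

theorem continuous_decayWeight : Continuous (decayWeight : Space d → ℝ) := by
  unfold decayWeight
  exact Continuous.inv₀ (by fun_prop) fun ξ => by positivity

theorem integrable_decayWeight : Integrable (decayWeight : Space d → ℝ) :=
  integrable_inv_one_add_norm_pow (by simp)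

/-- Local integrability comes from the weighted integrability, since the inverse weight is
continuous and hence bounded on compact sets; the pairing is `integral_density_mul`. -/
theorem hasSpaceTimeFourier_density {s : ℝ} {f : L2 d} {h : Space d × ℝ → ℂ}
    (hint : Integrable fun q => h q * (decayWeight q.1 : ℂ))
    (hh : ∀ Φ : 𝓢(SpaceTime d, ℂ), ∫ q, h q * Φ (WithLp.toLp 2 (q.2, q.1)) =
      ∫ p : Space d × Space d, (𝓕 f : L2 d) p.1 * conj ((𝓕 f : L2 d) p.2) *
        Φ (transferPoint (s / (2 * Real.pi)) p)) :
    HasSpaceTimeFourier (density s f) fun v => h (spaceTimeSwap v) := by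
  constructor
  · refine locallyIntegrable_iff.2 fun K hK => ?_
    have h1 : Integrable fun v : SpaceTime d =>
        h (spaceTimeSwap v) * (decayWeight v.snd : ℂ) :=
      measurePreserving_spaceTimeSwap.integrable_comp_of_integrable hint
    have h2 : Continuous fun v : SpaceTime d => ((decayWeight v.snd : ℂ))⁻¹ := by
      refine Continuous.inv₀ ?_ fun v => by simpa using (decayWeight_pos _).ne'
      exact Complex.continuous_ofReal.comp (continuous_decayWeight.comp (by fun_prop))
    refine (h1.integrableOn.mul_continuousOn h2.continuousOn hK).congr_fun (fun v _ => ?_)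
      hK.measurableSet
    have h3 : (decayWeight v.snd : ℂ) ≠ 0 := by simpa using (decayWeight_pos v.snd).ne'
    beta_reduce
    rw [mul_inv_cancel_right₀ h3]
  · intro Φ _
    rw [integral_density_mul, ← hh]
    exact (measurePreserving_spaceTimeSwap.integral_comp measurableEmbedding_spaceTimeSwap
      fun q : Space d × ℝ => h q * Φ (WithLp.toLp 2 (q.2, q.1))).symm

/-- The symbol is evaluated at 2π times the frequency and has degree 2β; squaring gives the factor
(2π)^(4β). -/
theorem enorm_boxSymbol_sq (β : ℝ) (v : SpaceTime d) :
    ‖((boxSymbol β v : ℝ) : ℂ)‖ₑ ^ 2 =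
      ENNReal.ofReal ((2 * Real.pi) ^ (4 * β)) * gapWeight (2 * β) (spaceTimeSwap v) := by
  have hπ := Real.pi_pos
  have h0 : 0 ≤ boxSymbol β v := by unfold boxSymbol; positivity
  rw [← ofReal_norm, Complex.norm_real, Real.norm_of_nonneg h0, ← ENNReal.ofReal_pow h0,
    gapWeight, ← ENNReal.ofReal_mul (by positivity)]
  congr 1
  have h1 : (2 * Real.pi * v.fst) ^ 2 - (2 * Real.pi * ‖v.snd‖) ^ 2 =
      -((2 * Real.pi) ^ 2 * (‖(spaceTimeSwap v).1‖ ^ 2 - (spaceTimeSwap v).2 ^ 2)) := by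
    simp only [spaceTimeSwap]; ring
  rw [boxSymbol, h1, abs_neg, abs_mul, abs_of_nonneg (by positivity : 0 ≤ (2 * Real.pi) ^ 2),
    ← Real.rpow_natCast _ 2, ← Real.rpow_mul (by positivity), Real.mul_rpow (by positivity) (by positivity),
    ← Real.rpow_natCast _ 2, ← Real.rpow_mul (by positivity)]
  congr 2 <;> push_cast <;> ring

theorem HasSpaceTimeFourier.boxNorm_eq_lintegral {G : ℝ → Space d → ℂ} {h : Space d × ℝ → ℂ}
    (hh : HasSpaceTimeFourier G fun v => h (spaceTimeSwap v)) (β : ℝ) :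
    boxNorm β G = (ENNReal.ofReal ((2 * Real.pi) ^ (4 * β)) *
      ∫⁻ q, gapWeight (2 * β) q * ‖h q‖ₑ ^ 2) ^ (1 / 2 : ℝ) := by
  rw [hh.boxNorm_eq, eLpNorm_eq_lintegral_rpow_enorm_toReal two_ne_zero ENNReal.ofNat_ne_top]
  simp only [ENNReal.toReal_ofNat, ENNReal.rpow_ofNat, enorm_mul, mul_pow, enorm_boxSymbol_sq,
    mul_assoc]
  rw [lintegral_const_mul' _ _ ENNReal.ofReal_ne_top,
    ← measurePreserving_spaceTimeSwap.lintegral_comp_emb measurableEmbedding_spaceTimeSwap]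

/-- The product of the Fourier transform of `f` and its conjugate. -/
def fourierCorrelation (f : L2 d) (p : Space d × Space d) : ℂ :=
  (𝓕 f : L2 d) p.1 * conj ((𝓕 f : L2 d) p.2)

theorem measurable_fourierCorrelation (f : L2 d) : Measurable (fourierCorrelation f) := by
  have h := measurable_fourier f
  exact (h.comp measurable_fst).mul
    (Complex.continuous_conj.measurable.comp (h.comp measurable_snd))

theorem norm_fourierCorrelation (f : L2 d) (p : Space d × Space d) :
    ‖fourierCorrelation f p‖ = ‖(𝓕 f : L2 d) p.1‖ * ‖(𝓕 f : L2 d) p.2‖ := by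
  rw [fourierCorrelation, norm_mul, RCLike.norm_conj]

theorem integrable_fourierCorrelation (f : L2 d) : Integrable fun p : Space d × Space d =>
    ‖fourierCorrelation f p‖ * decayWeight (p.1 - p.2) := by
  simp_rw [norm_fourierCorrelation]
  exact integrable_mul_mul_sub (Lp.memLp _) integrable_decayWeight

variable {s : ℝ} (hs : 0 < s) (hd : 2 ≤ d)
include hs hd

theorem hasSpaceTimeFourier_transferDensityC (f : L2 d) :
    HasSpaceTimeFourier (density s f) fun v =>
      transferDensityC (s / (2 * Real.pi)) (fourierCorrelation f) (spaceTimeSwap v) := by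
  have hm : 0 < s / (2 * Real.pi) := by positivity
  have hd' : 2 ≤ finrank ℝ (Space d) := by simpa using hd
  have h := fun {Ψ : Space d × ℝ → ℂ} => integral_transferDensityC_mul hm hd'
    (measurable_fourierCorrelation f) continuous_decayWeight.measurable decayWeight_pos
    (integrable_fourierCorrelation f) (Ψ := Ψ)
  refine hasSpaceTimeFourier_density
    (h (Complex.measurable_ofReal.comp (continuous_decayWeight.measurable.comp measurable_fst)) ?_).1
    fun Φ => (h (Ψ := fun q => Φ (WithLp.toLp 2 (q.2, q.1))) (Continuous.measurable (by fun_prop))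
      ?_).2
  · refine (integrable_fourierCorrelation f).congr (Eventually.of_forall fun p => ?_)
    simp [transfer, abs_of_pos (decayWeight_pos _)]
  · simp_rw [norm_fourierCorrelation]
    exact integrable_fourier_transferPoint f _ Φ

/-- Only the modulus of f̂ matters for the upper bound, by `enorm_transferDensityC_le`. -/
theorem boxNorm_density_le (f : L2 d) (β : ℝ) :
    boxNorm β (density s f) ≤ (ENNReal.ofReal ((2 * Real.pi) ^ (4 * β)) *
      ∫⁻ q, gapWeight (2 * β) q * transferDensity (s / (2 * Real.pi))
        (fun p => ENNReal.ofReal (‖(𝓕 f : L2 d) p.1‖ * ‖(𝓕 f : L2 d) p.2‖)) q ^ 2) ^ (1 / 2 : ℝ) := by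
  have hm : 0 < s / (2 * Real.pi) := by positivity
  rw [(hasSpaceTimeFourier_transferDensityC hs hd f).boxNorm_eq_lintegral]
  refine ENNReal.rpow_le_rpow (mul_le_mul_right (lintegral_mono_ae ?_) _) (by norm_num)
  filter_upwards [enorm_transferDensityC_le hm (by simpa using hd) (measurable_fourierCorrelation f)
    continuous_decayWeight.measurable decayWeight_pos (integrable_fourierCorrelation f)] with q hq
  simp_rw [← ofReal_norm, norm_fourierCorrelation] at hq ⊢
  gcongr

/-- When f̂ is nonnegative there is no cancellation, so the bound of `boxNorm_density_le` is
attained. Needed for the lower bounds. -/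
theorem boxNorm_density_eq {f : L2 d} {g : Space d → ℝ} (hg : Measurable g) (hg0 : ∀ x, 0 ≤ g x)
    (hf : (𝓕 f : L2 d) =ᵐ[volume] fun x => (g x : ℂ)) (β : ℝ) :
    boxNorm β (density s f) = (ENNReal.ofReal ((2 * Real.pi) ^ (4 * β)) *
      ∫⁻ q, gapWeight (2 * β) q * transferDensity (s / (2 * Real.pi))
        (fun p => ENNReal.ofReal (g p.1 * g p.2)) q ^ 2) ^ (1 / 2 : ℝ) := by
  have hm : 0 < s / (2 * Real.pi) := by positivity
  have hd' : 2 ≤ finrank ℝ (Space d) := by simpa using hd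
  have hg2 : MemLp (fun x => (g x : ℂ)) 2 := (memLp_congr_ae hf).1 (Lp.memLp _)
  have hb0 : ∀ p : Space d × Space d, 0 ≤ g p.1 * g p.2 := fun p => mul_nonneg (hg0 _) (hg0 _)
  have hi : Integrable fun p : Space d × Space d => g p.1 * g p.2 * decayWeight (p.1 - p.2) := by
    refine (integrable_mul_mul_sub hg2 integrable_decayWeight).congr
      (Eventually.of_forall fun p => ?_)
    simp only [Complex.norm_real, Real.norm_of_nonneg (hg0 _)]
  have hW : Measurable (decayWeight : Space d → ℝ) := continuous_decayWeight.measurable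
  set b : Space d × Space d → ℝ≥0∞ := fun p => ENNReal.ofReal (g p.1 * g p.2)
  have hbm : Measurable b := by fun_prop
  have hfin : ∀ᵐ q, transferDensity (s / (2 * Real.pi)) b q < ∞ := by
    refine transferDensity_lt_top hm hd' hbm hW decayWeight_pos
      (ne_top_of_le_ne_top hi.lintegral_lt_top.ne (lintegral_mono fun p => ?_))
    rw [ENNReal.ofReal_mul (hb0 p)]
  have hcorr : ∀ᵐ p : Space d × Space d, fourierCorrelation f p = (((b p).toReal : ℝ) : ℂ) := by
    have h1 : ∀ᵐ p : Space d × Space d, (𝓕 f : L2 d) p.1 = (g p.1 : ℂ) :=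
      Measure.quasiMeasurePreserving_fst.ae hf
    have h2 : ∀ᵐ p : Space d × Space d, (𝓕 f : L2 d) p.2 = (g p.2 : ℂ) :=
      Measure.quasiMeasurePreserving_snd.ae hf
    filter_upwards [h1, h2] with p h1 h2
    rw [fourierCorrelation, h1, h2, Complex.conj_ofReal, ENNReal.toReal_ofReal (hb0 p),
      Complex.ofReal_mul]
  have h := fun {Ψ : Space d × ℝ → ℂ} => integral_toReal_transferDensity_mul hm hd' hbm
    (fun p => ENNReal.ofReal_lt_top) hfin (Ψ := Ψ)
  have hF : HasSpaceTimeFourier (density s f) fun v =>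
      ((transferDensity (s / (2 * Real.pi)) b (spaceTimeSwap v)).toReal : ℂ) := by
    refine hasSpaceTimeFourier_density
      (h := fun q => ((transferDensity (s / (2 * Real.pi)) b q).toReal : ℂ))
      (h (Complex.measurable_ofReal.comp (hW.comp measurable_fst)) ?_).1
      fun Φ => ((h (Ψ := fun q => Φ (WithLp.toLp 2 (q.2, q.1)))
        (Continuous.measurable (by fun_prop)) ?_).2.trans (integral_congr_ae ?_))
    · refine hi.ofReal.congr (Eventually.of_forall fun p => ?_)
      simp [transfer, b, ENNReal.toReal_ofReal (hb0 p)]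
    · have h3 := integrable_fourier_transferPoint f (s / (2 * Real.pi)) Φ
      have h4 : Continuous fun p : Space d × Space d => Φ (transferPoint (s / (2 * Real.pi)) p) := by
        unfold transferPoint; fun_prop
      refine h3.mono (((by fun_prop : Measurable fun p => ((b p).toReal : ℂ)).mul
        h4.measurable).aestronglyMeasurable) ?_
      filter_upwards [hcorr] with p hp
      rw [norm_mul, ← hp, norm_fourierCorrelation, Real.norm_of_nonneg (by positivity)]
      rfl
    · filter_upwards [hcorr] with p hp
      rw [← hp]
      rfl
  rw [hF.boxNorm_eq_lintegral (h := fun q => ((transferDensity (s / (2 * Real.pi)) b q).toReal : ℂ))]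
  congr 2
  refine lintegral_congr_ae ?_
  filter_upwards [hfin] with q hq
  rw [← ofReal_norm, Complex.norm_real, Real.norm_of_nonneg ENNReal.toReal_nonneg,
    ENNReal.ofReal_toReal hq.ne]

end BoxNorm

end KleinGordon

namespace KleinGordon

set_option linter.unusedSectionVars false

/-! ### Plancherel's theorem on space-time and the `L⁴` norm -/

noncomputable section Strichartz

open Set Metric Module Filter Topology
open scoped NNReal ComplexConjugate

variable {d : ℕ}

theorem lintegral_enorm_sq_L2 (F : L2 d) : ∫⁻ x, ‖F x‖ₑ ^ 2 = ENNReal.ofReal (‖F‖ ^ 2) := by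
  rw [Lp.norm_def, ENNReal.ofReal_pow ENNReal.toReal_nonneg,
    ENNReal.ofReal_toReal (Lp.eLpNorm_ne_top _),
    eLpNorm_eq_lintegral_rpow_enorm_toReal two_ne_zero ENNReal.ofNat_ne_top]
  simp only [ENNReal.toReal_ofNat, ENNReal.rpow_ofNat]
  rw [← ENNReal.rpow_natCast, ← ENNReal.rpow_mul]
  norm_num

/-- For each t the wave is only a class of functions of x, so joint measurability is not automatic.
The truncated waves are jointly measurable, and along a subsequence with summable squared errors,
the same for all t, they converge almost everywhere in x. -/
theorem exists_measurable_enorm_propagator (s : ℝ) (f : L2 d) : ∃ G : ℝ × Space d → ℝ≥0∞,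
    Measurable G ∧ ∀ t, ∀ᵐ x, G (t, x) = ‖(propagator s t f : L2 d) x‖ₑ := by
  have h0 : ∀ k : ℕ, ∃ n, ‖(memLp_lowFreq f n).toLp _ - (𝓕 f : L2 d)‖ ^ 2 < (1 / 2) ^ k := by
    intro k
    have h := ((tendsto_lowFreq f).sub_const (𝓕 f : L2 d)).norm.pow 2
    rw [sub_self, norm_zero, zero_pow two_ne_zero] at h
    exact (h.eventually_lt_const (by positivity)).exists
  choose φ hφ using h0
  refine ⟨fun z => liminf (fun k => ‖lowWave s f (φ k) z.1 z.2‖ₑ) atTop,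
    Measurable.liminf fun k => (measurable_lowWave s f (φ k)).enorm, fun t => ?_⟩
  have hm : ∀ k, Measurable fun x => ‖(lowWaveL2 s f (φ k) t - propagator s t f : L2 d) x‖ₑ ^ 2 :=
    fun k => ((Lp.stronglyMeasurable _).measurable.enorm.pow_const 2)
  have hsum : ∫⁻ x, ∑' k, ‖(lowWaveL2 s f (φ k) t - propagator s t f : L2 d) x‖ₑ ^ 2 ≠ ∞ := by
    rw [lintegral_tsum fun k => (hm k).aemeasurable]
    simp_rw [lintegral_enorm_sq_L2, norm_lowWaveL2_sub]
    refine ne_top_of_le_ne_top ?_ (ENNReal.tsum_le_tsum fun k => ENNReal.ofReal_le_ofReal (hφ k).le)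
    rw [← ENNReal.ofReal_tsum_of_nonneg (fun k => by positivity) summable_geometric_two]
    exact ENNReal.ofReal_ne_top
  filter_upwards [ae_lt_top (Measurable.tsum hm) hsum,
    ae_all_iff.2 fun k => lowWaveL2_ae_eq s f (φ k) t,
    ae_all_iff.2 fun k => Lp.coeFn_sub (lowWaveL2 s f (φ k) t) (propagator s t f)] with x h1 h2 h3
  have h4 := ENNReal.tendsto_atTop_zero_of_tsum_ne_top h1.ne
  simp_rw [h3, Pi.sub_apply, h2] at h4
  have h5 : Tendsto (fun k => ‖lowWave s f (φ k) t x - propagator s t f x‖ₑ) atTop (𝓝 0) := by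
    have h6 := h4.ennrpow_const (1 / 2 : ℝ)
    simp_rw [← ENNReal.rpow_natCast, ← ENNReal.rpow_mul] at h6
    simpa using h6
  have h7 : Tendsto (fun k => lowWave s f (φ k) t x) atTop (𝓝 (propagator s t f x)) := by
    rw [tendsto_iff_edist_tendsto_0]
    simpa only [edist_eq_enorm_sub] using h5
  exact h7.enorm.liminf_eq

variable {s : ℝ} (hs : 0 < s) (hd : 2 ≤ d)
include hs hd

theorem integral_transferDensityC_mul_schwartz (f : L2 d) (Ψ : 𝓢(SpaceTime d, ℂ)) :
    ∫ v : SpaceTime d, transferDensityC (s / (2 * Real.pi)) (fourierCorrelation f)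
        (spaceTimeSwap v) * (𝓕⁻ Ψ : 𝓢(SpaceTime d, ℂ)) v =
      ∫ t : ℝ, ∫ x : Space d, density s f t x * Ψ (WithLp.toLp 2 (t, x)) := by
  have h := integral_density_mul s f (𝓕⁻ Ψ : 𝓢(SpaceTime d, ℂ))
  rw [FourierTransform.fourier_fourierInv_eq] at h
  rw [h]
  refine (measurePreserving_spaceTimeSwap.integral_comp measurableEmbedding_spaceTimeSwap
      fun q : Space d × ℝ => transferDensityC (s / (2 * Real.pi)) (fourierCorrelation f) q *
        (𝓕⁻ Ψ : 𝓢(SpaceTime d, ℂ)) (WithLp.toLp 2 (q.2, q.1))).trans ?_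
  refine (integral_transferDensityC_mul (by positivity) (by simpa using hd)
    (measurable_fourierCorrelation f) continuous_decayWeight.measurable decayWeight_pos
    (integrable_fourierCorrelation f)
    (Ψ := fun q => (𝓕⁻ Ψ : 𝓢(SpaceTime d, ℂ)) (WithLp.toLp 2 (q.2, q.1)))
    (Continuous.measurable (by fun_prop)) ?_).2
  simp_rw [norm_fourierCorrelation]
  exact integrable_fourier_transferPoint f _ _

/-- For β = 0 the box norm is the `L²` norm of the Fourier transform of |u|², and ‖u‖₄² = ‖|u|²‖₂.
Finiteness makes that transform an `L²` function, whose inverse transform is identified with |u|² by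
testing. -/
theorem strichartzNorm_four_eq {f : L2 d} (hf : boxNorm 0 (density s f) ≠ ∞) :
    strichartzNorm s 4 f = boxNorm 0 (density s f) ^ (1 / 2 : ℝ) := by
  have hF := hasSpaceTimeFourier_transferDensityC hs hd f
  set h : SpaceTime d → ℂ := fun v =>
    transferDensityC (s / (2 * Real.pi)) (fourierCorrelation f) (spaceTimeSwap v) with hh
  have hbox : boxNorm 0 (density s f) = eLpNorm h 2 volume := by
    rw [hF.boxNorm_eq]
    simp [boxSymbol]
  have hL : MemLp h 2 := ⟨hF.1.aestronglyMeasurable, by rw [← hbox]; exact hf.lt_top⟩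
  obtain ⟨G, hG, hGu⟩ := exists_measurable_enorm_propagator s f
  set G' : ℝ × Space d → ℂ := fun z => (((G z).toReal ^ 2 : ℝ) : ℂ)
  have hG' : Measurable G' := by fun_prop
  have hGd : ∀ t, ∀ᵐ x, G' (t, x) = density s f t x := fun t => by
    filter_upwards [hGu t] with x hx
    simp only [G', density, hx, toReal_enorm]
  have hint : ∀ {w : ℝ × Space d → ℂ}, Measurable w → ∀ {C : ℝ}, 0 ≤ C →
      (∀ z, ‖w z‖ ≤ C * ((1 + ‖z.1‖) ^ 2)⁻¹) → Integrable fun z => G' z * w z := by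
    intro w hw C hC hwC
    refine ⟨(hG'.mul hw).aestronglyMeasurable, ?_⟩
    rw [HasFiniteIntegral]
    have h1 : Integrable fun t : ℝ => C * ((1 + ‖t‖) ^ 2)⁻¹ * ‖f‖ ^ 2 :=
      ((integrable_inv_one_add_norm_pow (by simp)).const_mul _).mul_const _
    refine lt_of_le_of_lt ?_ h1.lintegral_lt_top
    rw [Measure.volume_eq_prod, lintegral_prod _ (by fun_prop)]
    refine lintegral_mono fun t => ?_
    have h2 : 0 ≤ C * ((1 + ‖t‖) ^ 2)⁻¹ := by positivity
    calc ∫⁻ x, ‖G' (t, x) * w (t, x)‖ₑ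
        ≤ ∫⁻ x, ENNReal.ofReal (C * ((1 + ‖t‖) ^ 2)⁻¹) * ‖(propagator s t f : L2 d) x‖ₑ ^ 2 := by
          refine lintegral_mono_ae ?_
          filter_upwards [hGd t] with x hx
          rw [hx, enorm_mul, mul_comm]
          refine mul_le_mul' ?_ (le_of_eq ?_)
          · rw [← ofReal_norm]
            exact ENNReal.ofReal_le_ofReal (hwC (t, x))
          · rw [density, ← ofReal_norm, Complex.norm_real, Real.norm_of_nonneg (by positivity),
              ENNReal.ofReal_pow (norm_nonneg _), ofReal_norm]
      _ = _ := by
          rw [lintegral_const_mul' _ _ ENNReal.ofReal_ne_top, lintegral_enorm_sq_L2,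
            norm_propagator, ← ENNReal.ofReal_mul h2]
  have hGloc : LocallyIntegrable fun v : SpaceTime d => G' (WithLp.ofLp v) := by
    refine locallyIntegrable_iff.2 fun K hK => ?_
    have h1 := hint (w := fun z => ((((1 + ‖z.1‖) ^ 2)⁻¹ : ℝ) : ℂ)) (by fun_prop) zero_le_one
      (fun z => by rw [Complex.norm_real, Real.norm_of_nonneg (by positivity), one_mul])
    have h2 : Integrable fun v : SpaceTime d => G' (WithLp.ofLp v) *
        ((((1 + ‖v.fst‖) ^ 2)⁻¹ : ℝ) : ℂ) :=
      (WithLp.volume_preserving_ofLp ℝ (Space d)).integrable_comp_of_integrable h1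
    have h3 : Continuous fun v : SpaceTime d => (((1 + ‖v.fst‖) ^ 2 : ℝ) : ℂ) := by fun_prop
    refine (h2.integrableOn.mul_continuousOn h3.continuousOn hK).congr_fun (fun v _ => ?_)
      hK.measurableSet
    have h4 : ((1 + ‖v.fst‖) ^ 2 : ℝ) ≠ 0 := by positivity
    beta_reduce
    rw [mul_assoc, ← Complex.ofReal_mul, inv_mul_cancel₀ h4, Complex.ofReal_one, mul_one]
  set k : Lp ℂ 2 (volume : Measure (SpaceTime d)) := 𝓕⁻ (hL.toLp h) with hk
  have hkG : k =ᵐ[volume] fun v : SpaceTime d => G' (WithLp.ofLp v) := by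
    refine ae_eq_of_integral_mul_schwartz_eq ((Lp.memLp k).locallyIntegrable (by norm_num)) hGloc
      fun Ψ _ => ?_
    obtain ⟨C, hC0, hC⟩ := exists_schwartz_decay Ψ 2
    have h1 : Integrable fun z : ℝ × Space d => G' z * Ψ (WithLp.toLp 2 z) := by
      refine hint (Continuous.measurable (by fun_prop)) hC0 fun z => (hC _).trans ?_
      have h : ‖z.1‖ ≤ ‖(WithLp.toLp 2 z : SpaceTime d)‖ :=
        WithLp.norm_fst_le _ (WithLp.toLp 2 z : SpaceTime d)
      gcongr
    calc ∫ v, k v * Ψ v = ∫ v, (hL.toLp h) v * (𝓕⁻ Ψ : 𝓢(SpaceTime d, ℂ)) v :=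
          integral_fourierInv_L2_mul _ _
      _ = ∫ v, h v * (𝓕⁻ Ψ : 𝓢(SpaceTime d, ℂ)) v := by
          refine integral_congr_ae ?_
          filter_upwards [hL.coeFn_toLp] with v hv
          rw [hv]
      _ = ∫ t : ℝ, ∫ x : Space d, density s f t x * Ψ (WithLp.toLp 2 (t, x)) :=
          integral_transferDensityC_mul_schwartz hs hd f Ψ
      _ = ∫ t : ℝ, ∫ x : Space d, G' (t, x) * Ψ (WithLp.toLp 2 (t, x)) := by
          refine integral_congr_ae (Eventually.of_forall fun t => integral_congr_ae ?_)
          filter_upwards [hGd t] with x hx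
          rw [hx]
      _ = ∫ z : ℝ × Space d, G' z * Ψ (WithLp.toLp 2 z) := (integral_prod _ h1).symm
      _ = _ := integral_spaceTime fun v => G' (WithLp.ofLp v) * Ψ v
  have hnorm : eLpNorm (fun v : SpaceTime d => G' (WithLp.ofLp v)) 2 volume = eLpNorm h 2 volume := by
    rw [← eLpNorm_congr_ae hkG, ← eLpNorm_congr_ae hL.coeFn_toLp,
      ← ENNReal.ofReal_toReal (Lp.eLpNorm_ne_top k),
      ← ENNReal.ofReal_toReal (Lp.eLpNorm_ne_top (hL.toLp h)), ← Lp.norm_def, ← Lp.norm_def,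
      ← Lp.norm_fourier_eq k, hk, FourierTransform.fourier_fourierInv_eq]
  rw [hbox, ← hnorm, eLpNorm_eq_lintegral_rpow_enorm_toReal two_ne_zero ENNReal.ofNat_ne_top,
    ← ENNReal.rpow_mul, strichartzNorm]
  norm_num
  congr 1
  rw [(WithLp.volume_preserving_ofLp ℝ (Space d)).lintegral_comp
    (f := fun z => ‖G' z‖ₑ ^ 2) (by fun_prop), Measure.volume_eq_prod,
    lintegral_prod _ (by fun_prop)]
  refine lintegral_congr fun t => lintegral_congr_ae ?_
  filter_upwards [hGd t] with x hx
  rw [hx, density, ← ofReal_norm, ← ofReal_norm, Complex.norm_real,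
    Real.norm_of_nonneg (by positivity), ← ENNReal.ofReal_pow (by positivity),
    ← ENNReal.ofReal_pow (by positivity)]
  ring_nf

end Strichartz

end KleinGordon

namespace KleinGordon

set_option linter.unusedSectionVars false

/-! ### Strict upper bounds and almost sharp examples -/

noncomputable section Sharp

open Set Metric Module Filter Topology
open scoped NNReal ComplexConjugate

variable {d : ℕ}

/-- The modulus of the Fourier transform of `f`. -/
def fourierModulus (f : L2 d) (x : Space d) : ℝ := ‖(𝓕 f : L2 d) x‖

theorem measurable_fourierModulus (f : L2 d) : Measurable (fourierModulus f) :=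
  (measurable_fourier f).norm

theorem fourierModulus_nonneg (f : L2 d) (x : Space d) : 0 ≤ fourierModulus f x := norm_nonneg _

theorem fourierModulus_not_ae_zero {f : L2 d} (hf : f ≠ 0) : ¬ fourierModulus f =ᵐ[volume] 0 := by
  intro h
  have h1 : (𝓕 f : L2 d) = 0 := by
    rw [Lp.eq_zero_iff_ae_eq_zero]
    filter_upwards [h] with x hx
    exact norm_eq_zero.1 hx
  apply hf
  rw [← norm_eq_zero, ← Lp.norm_fourier_eq f, h1, norm_zero]

/-- The surface area of the unit sphere of `ℝ^d`. -/
def sphereArea (d : ℕ) : ℝ := 2 * Real.pi ^ ((d : ℝ) / 2) / Real.Gamma ((d : ℝ) / 2)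

theorem sphereArea_pos (hd : 2 ≤ d) : 0 < sphereArea d := by
  have hd' : (2 : ℝ) ≤ d := by exact_mod_cast hd
  have h1 := Real.Gamma_pos_of_pos (show 0 < (d : ℝ) / 2 by linarith)
  have := Real.pi_pos
  unfold sphereArea
  positivity

theorem toSphere_univ_eq (hd : 2 ≤ d) :
    (volume : Measure (Space d)).toSphere univ = ENNReal.ofReal (sphereArea d) := by
  have hd' : (2 : ℝ) ≤ d := by exact_mod_cast hd
  have : Nonempty (Fin d) := ⟨⟨0, by omega⟩⟩
  have hG := Real.Gamma_pos_of_pos (show 0 < (d : ℝ) / 2 by linarith)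
  rw [Measure.toSphere_apply_univ, EuclideanSpace.volume_ball, ENNReal.ofReal_one, one_pow, one_mul,
    finrank_euclideanSpace_fin, Fintype.card_fin, ← ENNReal.ofReal_natCast,
    ← ENNReal.ofReal_mul (by positivity), sphereArea, Real.Gamma_add_one (by positivity),
    Real.sqrt_eq_rpow, ← Real.rpow_natCast, ← Real.rpow_mul Real.pi_pos.le]
  congr 1
  rw [one_div_mul_eq_div]
  have : (d : ℝ) ≠ 0 := by positivity
  field_simp

variable {s : ℝ} (hs : 0 < s)

include hs

theorem sobolevNorm_sq {α : ℝ} {n : ℕ} (hα : α * 2 = n) (f : L2 d) :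
    sobolevNorm s α f ^ 2 = ∫⁻ x, ENNReal.ofReal ((2 * Real.pi) ^ n *
      (fourierModulus f x ^ 2 * energy (s / (2 * Real.pi)) x ^ n)) := by
  rw [sobolevNorm, eLpNorm_eq_lintegral_rpow_enorm_toReal two_ne_zero ENNReal.ofNat_ne_top,
    ← ENNReal.rpow_natCast, ← ENNReal.rpow_mul]
  norm_num
  refine lintegral_congr fun x => ?_
  have h0 : 0 ≤ symbol s x := Real.sqrt_nonneg _
  rw [← ofReal_norm, ← ofReal_norm, Complex.norm_real,
    Real.norm_of_nonneg (by positivity : 0 ≤ symbol s x ^ α), ← ENNReal.ofReal_mul (by positivity),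
    ← ENNReal.ofReal_pow (by positivity), mul_pow, ← Real.rpow_natCast _ 2, ← Real.rpow_mul h0]
  push_cast
  rw [hα, Real.rpow_natCast, symbol_eq, mul_pow, fourierModulus]
  congr 1
  ring

theorem integrable_of_sobolevNorm {α : ℝ} {n : ℕ} (hα : α * 2 = n) {f : L2 d}
    (hf : sobolevNorm s α f < ∞) :
    Integrable fun x => fourierModulus f x ^ 2 * energy (s / (2 * Real.pi)) x ^ n := by
  have hπ := Real.pi_pos
  have h0 : ∀ x, 0 ≤ fourierModulus f x ^ 2 * energy (s / (2 * Real.pi)) x ^ n := fun x =>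
    mul_nonneg (sq_nonneg _) (pow_nonneg (energy_nonneg _ _) _)
  have h := sobolevNorm_sq hs hα f
  have hg := measurable_fourierModulus f
  have h1 : Integrable fun x => (2 * Real.pi) ^ n *
      (fourierModulus f x ^ 2 * energy (s / (2 * Real.pi)) x ^ n) := by
    refine ⟨Measurable.aestronglyMeasurable (by fun_prop), ?_⟩
    rw [hasFiniteIntegral_iff_ofReal (Eventually.of_forall fun x =>
      mul_nonneg (by positivity) (h0 x)), ← h]
    exact ENNReal.pow_lt_top hf
  refine (h1.const_mul ((2 * Real.pi) ^ n)⁻¹).congr (Eventually.of_forall fun x => ?_)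
  have : (2 * Real.pi) ^ n ≠ 0 := by positivity
  beta_reduce
  rw [inv_mul_cancel_left₀ this]

theorem sobolevNorm_sq_eq_ofReal {α : ℝ} {n : ℕ} (hα : α * 2 = n) {f : L2 d}
    (hf : Integrable fun x => fourierModulus f x ^ 2 * energy (s / (2 * Real.pi)) x ^ n) :
    sobolevNorm s α f ^ 2 = ENNReal.ofReal ((2 * Real.pi) ^ n *
      ∫ x, fourierModulus f x ^ 2 * energy (s / (2 * Real.pi)) x ^ n) := by
  have hπ := Real.pi_pos
  rw [sobolevNorm_sq hs hα, ← integral_const_mul, ofReal_integral_eq_lintegral_ofReal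
    (hf.const_mul _) (Eventually.of_forall fun x => mul_nonneg (by positivity)
      (mul_nonneg (sq_nonneg _) (pow_nonneg (energy_nonneg _ _) _)))]

theorem sobolevNorm_lt_top {α : ℝ} {n : ℕ} (hα : α * 2 = n) {f : L2 d}
    (hf : Integrable fun x => fourierModulus f x ^ 2 * energy (s / (2 * Real.pi)) x ^ n) :
    sobolevNorm s α f < ∞ := by
  have h := sobolevNorm_sq_eq_ofReal hs hα hf
  by_contra h0
  rw [not_lt, top_le_iff] at h0
  rw [h0] at h
  simp at h

theorem toReal_sobolevNorm_sq {α : ℝ} {n : ℕ} (hα : α * 2 = n) {f : L2 d}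
    (hf : Integrable fun x => fourierModulus f x ^ 2 * energy (s / (2 * Real.pi)) x ^ n) :
    (sobolevNorm s α f).toReal ^ 2 = (2 * Real.pi) ^ n *
      ∫ x, fourierModulus f x ^ 2 * energy (s / (2 * Real.pi)) x ^ n := by
  have hπ := Real.pi_pos
  rw [← ENNReal.toReal_pow, sobolevNorm_sq_eq_ofReal hs hα hf, ENNReal.toReal_ofReal]
  exact mul_nonneg (by positivity) (integral_nonneg fun x =>
    mul_nonneg (sq_nonneg _) (pow_nonneg (energy_nonneg _ _) _))

theorem boxNorm_density_zero (hd : 2 ≤ d) (β : ℝ) : boxNorm β (density s (0 : L2 d)) = 0 := by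
  have h0 : (𝓕 (0 : L2 d) : L2 d) =ᵐ[volume] fun x => (((fun _ => 0 : Space d → ℝ) x : ℝ) : ℂ) := by
    have h1 : (𝓕 (0 : L2 d) : L2 d) = 0 := by
      rw [← norm_eq_zero, Lp.norm_fourier_eq, norm_zero]
    rw [h1]
    filter_upwards [Lp.coeFn_zero ℂ 2 (volume : Measure (Space d))] with x hx
    rw [hx, Pi.zero_apply, Complex.ofReal_zero]
  have hm : 0 < s / (2 * Real.pi) := by positivity
  rw [boxNorm_density_eq hs hd measurable_const (fun _ => le_rfl) h0]
  have h2 := lintegral_mul_transferDensity hm (V := Space d) (by simpa using hd)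
    (a := fun _ => 0) measurable_const (Ψ := fun _ => 1) measurable_const
  have h3 : transferDensity (s / (2 * Real.pi)) (fun _ : Space d × Space d => 0) =ᵐ[volume] 0 := by
    refine (lintegral_eq_zero_iff (by fun_prop)).1 ?_
    simpa using h2
  have h4 : ∫⁻ q, gapWeight (2 * β) q * transferDensity (s / (2 * Real.pi))
      (fun _ : Space d × Space d => 0) q ^ 2 = 0 := by
    rw [lintegral_eq_zero_iff (by fun_prop)]
    filter_upwards [h3] with q hq
    simp [hq]
  simp only [mul_zero, ENNReal.ofReal_zero, h4]
  norm_num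

variable (hd : 2 ≤ d) {β S : ℝ} {j : ℕ} (hβ : 2 * (2 * β) = 2 * j + 2 - d) (hS0 : 0 < S)
  (hS : ∀ e : Space d, ‖e‖ = 1 → ∫⁻ ω : sphere (0 : Space d) 1,
    ENNReal.ofReal ((‖(ω : Space d) - e‖ ^ 2) ^ (2 * β)) ∂(volume : Measure (Space d)).toSphere =
      ENNReal.ofReal S)
include hd hβ hS0 hS

/-- Combines `boxNorm_density_le`, the bilinear estimate and `momentumForm_lt`; the factor π/s is
1/(2m) for m = s/(2π). Only an upper bound Q for the momentum integral is required, so the total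
momentum may be discarded. -/
theorem boxNorm_density_lt {f : L2 d} (hf : f ≠ 0) {M Q : ℝ}
    (hQ : momentumMass (s / (2 * Real.pi)) j (fourierModulus f) ≤ ENNReal.ofReal Q)
    (hM : (2 * Real.pi) ^ (4 * β) * S * (Real.pi / s) * Q ≤ M ^ 2) (hM0 : 0 ≤ M) :
    boxNorm β (density s f) < ENNReal.ofReal M := by
  have hπ := Real.pi_pos
  have hm : 0 < s / (2 * Real.pi) := by positivity
  have : Nontrivial (Space d) := Module.nontrivial_of_finrank_pos (R := ℝ) (by simp; omega)
  have h1 : momentumForm (s / (2 * Real.pi)) j (fourierModulus f) <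
      ENNReal.ofReal (Real.pi / s) * ENNReal.ofReal Q := by
    refine (momentumForm_lt hm (measurable_fourierModulus f)
      (ne_top_of_le_ne_top ENNReal.ofReal_ne_top hQ) (fourierModulus_not_ae_zero hf)).trans_le ?_
    have h2 : 1 / (2 * (s / (2 * Real.pi))) = Real.pi / s := by field_simp
    rw [h2]
    gcongr
  have h3 := lintegral_gapWeight_mul_sq_le hm (V := Space d) (by simpa using hd) (by simpa using hβ) hS
    (measurable_fourierModulus f) (fourierModulus_nonneg f)
  have hK : 0 < (2 * Real.pi) ^ (4 * β) := by positivity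
  refine (boxNorm_density_le hs hd f β).trans_lt ?_
  have hlt : ENNReal.ofReal ((2 * Real.pi) ^ (4 * β)) *
      ∫⁻ q, gapWeight (2 * β) q * transferDensity (s / (2 * Real.pi))
        (fun p => ENNReal.ofReal (‖(𝓕 f : L2 d) p.1‖ * ‖(𝓕 f : L2 d) p.2‖)) q ^ 2 <
      ENNReal.ofReal (M ^ 2) := by
    calc _ ≤ ENNReal.ofReal ((2 * Real.pi) ^ (4 * β)) * (ENNReal.ofReal S *
          momentumForm (s / (2 * Real.pi)) j (fourierModulus f)) := mul_le_mul_right h3 _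
      _ < ENNReal.ofReal ((2 * Real.pi) ^ (4 * β)) * (ENNReal.ofReal S *
          (ENNReal.ofReal (Real.pi / s) * ENNReal.ofReal Q)) := by
          refine (ENNReal.mul_lt_mul_iff_right (by simpa using hK) ENNReal.ofReal_ne_top).2
            ((ENNReal.mul_lt_mul_iff_right (by simpa using hS0) ENNReal.ofReal_ne_top).2 h1)
      _ = ENNReal.ofReal ((2 * Real.pi) ^ (4 * β) * S * (Real.pi / s) * Q) := by
          rw [← ENNReal.ofReal_mul (by positivity), ← ENNReal.ofReal_mul (by positivity),
            ← ENNReal.ofReal_mul (by positivity)]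
          ring_nf
      _ ≤ _ := ENNReal.ofReal_le_ofReal hM
  refine (ENNReal.rpow_lt_rpow hlt (by norm_num)).trans_eq ?_
  rw [ENNReal.ofReal_rpow_of_nonneg (by positivity) (by norm_num), ← Real.sqrt_eq_rpow,
    Real.sqrt_sq hM0]

/-- The example has Fourier transform `expProfile`: the passage to the modulus and the bilinear
estimate are then equalities, and only the bound M ≥ 2m loses. As the norm is a square root, c² is
the fraction needed there. -/
theorem exists_le_boxNorm_density {c : ℝ} (hc0 : 0 < c) (hc1 : c < 1) : ∃ (a : ℝ) (f : L2 d),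
    0 < a ∧ f ≠ 0 ∧ fourierModulus f =ᵐ[volume] expProfile (s / (2 * Real.pi)) a ∧
    ∀ Q M : ℝ, momentumMass (s / (2 * Real.pi)) j (expProfile (s / (2 * Real.pi)) a : Space d → ℝ) =
        ENNReal.ofReal Q → (2 * Real.pi) ^ (4 * β) * S * (Real.pi / s) * Q = M ^ 2 → 0 ≤ M →
      ENNReal.ofReal (c * M) ≤ boxNorm β (density s f) := by
  have hπ := Real.pi_pos
  have hm : 0 < s / (2 * Real.pi) := by positivity
  have : Nontrivial (Space d) := Module.nontrivial_of_finrank_pos (R := ℝ) (by simp; omega)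
  have h2 : 1 / (2 * (s / (2 * Real.pi))) = Real.pi / s := by field_simp
  obtain ⟨a, ha, hform⟩ := exists_momentumForm_expProfile_ge (V := Space d) hm j
    (c := c ^ 2 * (Real.pi / s)) (by positivity) (by
      rw [h2]
      exact mul_lt_of_lt_one_left (by positivity) (by nlinarith))
  set g : Space d → ℝ := expProfile (s / (2 * Real.pi)) a with hg
  have hgm : Measurable g := measurable_expProfile _ _
  have hgpos : ∀ x, 0 < g x := fun x => div_pos (Real.exp_pos _) (energy_pos hm x)
  have hgL : MemLp (fun x => (g x : ℂ)) 2 := by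
    have h1 : MemLp g 2 := by
      rw [memLp_two_iff_integrable_sq hgm.aestronglyMeasurable]
      simpa using integrable_expProfile_sq (V := Space d) hm ha 0
    exact h1.ofReal
  have hf : (𝓕 (𝓕⁻ (hgL.toLp _) : L2 d) : L2 d) =ᵐ[volume] fun x => (g x : ℂ) := by
    rw [FourierTransform.fourier_fourierInv_eq]
    exact hgL.coeFn_toLp
  have hfg : fourierModulus (𝓕⁻ (hgL.toLp _) : L2 d) =ᵐ[volume] g := by
    filter_upwards [hf] with x hx
    rw [fourierModulus, hx, Complex.norm_real, Real.norm_of_nonneg (hgpos x).le]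
  refine ⟨a, 𝓕⁻ (hgL.toLp _), ha, fun h0 => ?_, hfg, fun Q M hQ hM hM0 => ?_⟩
  · have h1 : (hgL.toLp _ : L2 d) = 0 := by rw [← norm_eq_zero, ← norm_fourierInv_L2, h0, norm_zero]
    have h3 := hgL.coeFn_toLp
    rw [h1] at h3
    have h4 : ∀ᵐ x : Space d, False := by
      filter_upwards [h3, Lp.coeFn_zero ℂ 2 (volume : Measure (Space d))] with x h5 h6
      rw [h6] at h5
      exact (hgpos x).ne' (by simpa using h5.symm)
    rw [eventually_false_iff_eq_bot, ae_eq_bot] at h4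
    exact NeZero.ne _ h4
  · rw [boxNorm_density_eq hs hd hgm (fun x => (hgpos x).le) hf,
      lintegral_gapWeight_mul_sq_eq hm (by simpa using hd) (by simpa using hβ) hS (g := g) (a := a)
        (fun x => rfl)]
    rw [hQ] at hform
    have hK : 0 < (2 * Real.pi) ^ (4 * β) := by positivity
    calc ENNReal.ofReal (c * M) = ENNReal.ofReal ((c * M) ^ 2) ^ (1 / 2 : ℝ) := by
          rw [ENNReal.ofReal_rpow_of_nonneg (by positivity) (by norm_num), ← Real.sqrt_eq_rpow,
            Real.sqrt_sq (by positivity)]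
      _ ≤ _ := by
          refine ENNReal.rpow_le_rpow ?_ (by norm_num)
          refine le_trans (le_of_eq ?_) (mul_le_mul_right (mul_le_mul_right hform _) _)
          rw [← ENNReal.ofReal_mul (by positivity), ← ENNReal.ofReal_mul (by positivity),
            ← ENNReal.ofReal_mul (by positivity), mul_pow, ← hM]
          ring_nf

end Sharp

end KleinGordon

namespace KleinGordon

set_option linter.unusedSectionVars false

/-! ### Optimal constants and absence of extremisers -/

noncomputable section Optimality

open Set Metric Module Filter Topology
open scoped NNReal

variable {d : ℕ} {s : ℝ}

/-- Strict inequality for f ≠ 0 yields both the estimate and non-attainment; examples reaching every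
fraction c < 1 of the bound exclude a smaller constant. -/
theorem isOptimalConstant_and_noExtremisers {α C : ℝ} {A : L2 d → ℝ≥0∞} {B : L2 d → ℝ} (hC : 0 ≤ C)
    (hA : A 0 = 0) (hlt : ∀ f, f ≠ 0 → sobolevNorm s α f < ∞ → A f < ENNReal.ofReal (C * B f))
    (hge : ∀ c : ℝ, 0 < c → c < 1 → ∃ f, f ≠ 0 ∧ sobolevNorm s α f < ∞ ∧
      ENNReal.ofReal (c * (C * B f)) ≤ A f) :
    IsOptimalConstant s α A B C ∧ NoExtremisers s α A B C := by
  refine ⟨⟨⟨hC, fun f hf => ?_⟩, fun C' ⟨hC', h⟩ => ?_⟩, fun ⟨f, hf0, hf, h⟩ => (hlt f hf0 hf).ne h⟩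
  · rcases eq_or_ne f 0 with rfl | hf0
    · rw [hA]; exact zero_le
    · exact (hlt f hf0 hf).le
  · by_contra! hlt'
    have hC0 : 0 < C := hC'.trans_lt hlt'
    have h1 : C' / C < 1 := (div_lt_one hC0).2 hlt'
    have h0 : 0 ≤ C' / C := by positivity
    -- Any fraction strictly between C'/C and 1 contradicts the estimate with C'; the midpoint is
    -- taken.
    obtain ⟨f, hf0, hf, hc⟩ := hge ((C' / C + 1) / 2) (by linarith) (by linarith)
    have hB : 0 < C * B f := ENNReal.ofReal_pos.1 ((zero_le).trans_lt (hlt f hf0 hf))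
    have hB' : 0 < B f := pos_of_mul_pos_right hB hC
    have h2 := (ENNReal.ofReal_le_ofReal_iff (by positivity)).1 (hc.trans (h f hf))
    rw [← mul_assoc] at h2
    have h3 := le_of_mul_le_mul_right h2 hB'
    have h4 : (C' / C + 1) / 2 * C = (C' + C) / 2 := by field_simp
    linarith

theorem isOptimalConstant_sqrt {α C C' : ℝ} {A A' : L2 d → ℝ≥0∞} {B B' : L2 d → ℝ} (hC : 0 ≤ C')
    (hA' : A' 0 = 0)
    (hAA' : ∀ f, sobolevNorm s α f < ∞ → A f ≠ ∞ → A' f = A f ^ (1 / 2 : ℝ))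
    (hB : ∀ f, sobolevNorm s α f < ∞ → 0 ≤ C * B f)
    (hBB' : ∀ f, sobolevNorm s α f < ∞ → C' * B' f = (C * B f) ^ (1 / 2 : ℝ))
    (hlt : ∀ f, f ≠ 0 → sobolevNorm s α f < ∞ → A f < ENNReal.ofReal (C * B f))
    (hge : ∀ c : ℝ, 0 < c → c < 1 → ∃ f, f ≠ 0 ∧ sobolevNorm s α f < ∞ ∧
      ENNReal.ofReal (c * (C * B f)) ≤ A f) :
    IsOptimalConstant s α A' B' C' ∧ NoExtremisers s α A' B' C' := by
  refine isOptimalConstant_and_noExtremisers hC hA' (fun f hf0 hf => ?_) fun c hc0 hc1 => ?_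
  · have h := hlt f hf0 hf
    rw [hAA' f hf h.ne_top, hBB' f hf, ← ENNReal.ofReal_rpow_of_nonneg (hB f hf) (by norm_num)]
    exact ENNReal.rpow_lt_rpow h (by norm_num)
  · obtain ⟨f, hf0, hf, h⟩ := hge (c ^ 2) (by positivity) (by nlinarith)
    refine ⟨f, hf0, hf, ?_⟩
    rw [hAA' f hf (hlt f hf0 hf).ne_top, hBB' f hf]
    refine le_trans (le_of_eq ?_) (ENNReal.rpow_le_rpow h (by norm_num))
    rw [ENNReal.ofReal_rpow_of_nonneg (mul_nonneg (by positivity) (hB f hf)) (by norm_num),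
      Real.mul_rpow (by positivity) (hB f hf), ← Real.sqrt_eq_rpow, ← Real.sqrt_eq_rpow,
      Real.sqrt_sq hc0.le]

theorem sharpConstant_sq (hs : 0 < s) {z : ℝ} (hz : 0 < z) : sharpConstant d s z ^ 2 =
    (2 : ℝ) ^ (1 - (d : ℝ)) * Real.pi ^ ((2 - (d : ℝ)) / 2) / (s * Real.Gamma z) := by
  have hπ := Real.pi_pos
  have hG := Real.Gamma_pos_of_pos hz
  rw [sharpConstant, ← Real.sqrt_eq_rpow, Real.sq_sqrt (by positivity)]

theorem sharpConstant_nonneg (hs : 0 < s) {z : ℝ} (hz : 0 < z) : 0 ≤ sharpConstant d s z := by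
  have hπ := Real.pi_pos
  have hG := Real.Gamma_pos_of_pos hz
  unfold sharpConstant
  positivity

/-- Collects (2π)^(4β) from the symbol, the sphere area and 1/(2m) = π/s; P is ∫ |f̂|² e, so 2πP is
the squared norm. -/
theorem sharpConstant_null (hs : 0 < s) (hd : 2 ≤ d) (P : ℝ) :
    (2 * Real.pi) ^ (4 * ((2 - (d : ℝ)) / 4)) * sphereArea d * (Real.pi / s) * P ^ 2 =
      (sharpConstant d s ((d : ℝ) / 2) * (2 * Real.pi * P)) ^ 2 := by
  have hπ := Real.pi_pos
  have hd' : (2 : ℝ) ≤ d := by exact_mod_cast hd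
  have hz : 0 < (d : ℝ) / 2 := by linarith
  have hG := Real.Gamma_pos_of_pos hz
  rw [mul_pow, sharpConstant_sq hs hz, sphereArea,
    show 4 * ((2 - (d : ℝ)) / 4) = 1 + (1 - (d : ℝ)) by ring, Real.mul_rpow zero_le_two hπ.le,
    Real.rpow_add two_pos, Real.rpow_one,
    show (1 + (1 - (d : ℝ))) = (2 - (d : ℝ)) / 2 + (1 - (d : ℝ) / 2) by ring, Real.rpow_add hπ,
    Real.rpow_sub hπ 1, Real.rpow_one]
  have h1 : Real.pi ^ ((d : ℝ) / 2) ≠ 0 := by positivity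
  field_simp

/-- The 4/d is the mean squared-chord factor and 2⁻¹ comes from the formula for k²; (d/2)Γ(d/2) =
Γ(d/2 + 1) shifts the argument of Γ. -/
theorem sharpConstant_refined (hs : 0 < s) (hd : 2 ≤ d) (Q : ℝ) :
    (2 * Real.pi) ^ (4 * ((4 - (d : ℝ)) / 4)) * (4 / d * sphereArea d) * (Real.pi / s) *
        (2⁻¹ * Q) =
      sharpConstant d s (((d : ℝ) + 2) / 2) ^ 2 * ((2 * Real.pi) ^ 4 * Q) := by
  have hπ := Real.pi_pos
  have hd' : (2 : ℝ) ≤ d := by exact_mod_cast hd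
  have hz : 0 < (d : ℝ) / 2 := by linarith
  have hG := Real.Gamma_pos_of_pos hz
  rw [sharpConstant_sq hs (by linarith), sphereArea,
    show ((d : ℝ) + 2) / 2 = (d : ℝ) / 2 + 1 by ring, Real.Gamma_add_one hz.ne',
    show 4 * ((4 - (d : ℝ)) / 4) = 3 + (1 - (d : ℝ)) by ring, Real.mul_rpow zero_le_two hπ.le,
    Real.rpow_add two_pos,
    show (3 + (1 - (d : ℝ))) = (2 - (d : ℝ)) / 2 + (3 - (d : ℝ) / 2) by ring, Real.rpow_add hπ,
    Real.rpow_sub hπ 3, show (3 : ℝ) = ((3 : ℕ) : ℝ) by norm_num, Real.rpow_natCast, Real.rpow_natCast]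
  have h1 : Real.pi ^ ((d : ℝ) / 2) ≠ 0 := by positivity
  have h2 : (d : ℝ) ≠ 0 := by positivity
  field_simp
  ring

theorem sharpConstant_four (hs : 0 < s) :
    (16 * Real.pi * s) ^ (-(1 / 4) : ℝ) = sharpConstant 4 s (((4 : ℕ) + 2) / 2 : ℝ) ^ (1 / 2 : ℝ) := by
  have hπ := Real.pi_pos
  have hG : Real.Gamma ((((4 : ℕ) : ℝ) + 2) / 2) = 2 := by
    rw [show (((4 : ℕ) : ℝ) + 2) / 2 = (2 : ℕ) + 1 by norm_num, Real.Gamma_nat_eq_factorial]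
    norm_num
  have h1 : (2 : ℝ) ^ (1 - ((4 : ℕ) : ℝ)) = 1 / 8 := by
    rw [show 1 - ((4 : ℕ) : ℝ) = -((3 : ℕ) : ℝ) by norm_num, Real.rpow_neg zero_le_two,
      Real.rpow_natCast]
    norm_num
  have h2 : Real.pi ^ ((2 - ((4 : ℕ) : ℝ)) / 2) = Real.pi⁻¹ := by
    rw [show (2 - ((4 : ℕ) : ℝ)) / 2 = -1 by norm_num, Real.rpow_neg_one]
  rw [sharpConstant, hG, h1, h2, ← Real.rpow_mul (by positivity), Real.rpow_neg (by positivity),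
    ← Real.inv_rpow (by positivity)]
  congr 1
  · field_simp; norm_num
  · norm_num

theorem fourierModulus_sq_mul_energy_congr {f : L2 d} {a : ℝ} {m : ℝ}
    (hf : fourierModulus f =ᵐ[volume] expProfile m a) (n : ℕ) :
    (fun x => fourierModulus f x ^ 2 * energy m x ^ n) =ᵐ[volume]
      fun x => expProfile m a x ^ 2 * energy m x ^ n := by
  filter_upwards [hf] with x hx
  rw [hx]

variable (hs : 0 < s) (hd : 2 ≤ d)
include hs

theorem refinedQuantity_eq {f : L2 d}
    (hf1 : Integrable fun x => fourierModulus f x ^ 2 * energy (s / (2 * Real.pi)) x ^ 1)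
    (hf2 : Integrable fun x => fourierModulus f x ^ 2 * energy (s / (2 * Real.pi)) x ^ 2) :
    refinedQuantity s f = (2 * Real.pi) ^ 4 *
      ((∫ x, fourierModulus f x ^ 2 * energy (s / (2 * Real.pi)) x ^ 2) ^ 2 -
        (s / (2 * Real.pi)) ^ 2 *
          (∫ x, fourierModulus f x ^ 2 * energy (s / (2 * Real.pi)) x ^ 1) ^ 2) := by
  have hπ := Real.pi_pos
  have h1 := toReal_sobolevNorm_sq hs (α := 1 / 2) (n := 1) (by norm_num) hf1
  have h2 := toReal_sobolevNorm_sq hs (α := 1) (n := 2) (by norm_num) hf2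
  rw [refinedQuantity, show (4 : ℕ) = 2 * 2 from rfl, pow_mul, pow_mul, h1, h2]
  field_simp
  ring

theorem integrable_energy_one {g : Space d → ℝ} (hg : Measurable g)
    (h : Integrable fun x => g x ^ 2 * energy (s / (2 * Real.pi)) x ^ 2) :
    Integrable fun x => g x ^ 2 * energy (s / (2 * Real.pi)) x ^ 1 := by
  have hm : 0 < s / (2 * Real.pi) := by positivity
  set m := s / (2 * Real.pi)
  refine (h.const_mul m⁻¹).mono' (Measurable.aestronglyMeasurable (by fun_prop))
    (Eventually.of_forall fun x => ?_)
  have h1 := energy_pos hm x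
  rw [Real.norm_of_nonneg (by positivity), inv_mul_eq_div, le_div_iff₀ hm]
  have h2 := mass_le_energy (m := m) x
  have h3 : 0 ≤ g x ^ 2 * energy m x * (energy m x - m) :=
    mul_nonneg (by positivity) (by linarith)
  nlinarith

theorem refinedQuantity_nonneg {f : L2 d} (hf : sobolevNorm s 1 f < ∞) : 0 ≤ refinedQuantity s f := by
  have hπ := Real.pi_pos
  have hm : 0 < s / (2 * Real.pi) := by positivity
  have hf2 := integrable_of_sobolevNorm hs (α := 1) (n := 2) (by norm_num) hf
  have hf1 := integrable_energy_one hs (measurable_fourierModulus f) hf2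
  rw [refinedQuantity_eq hs hf1 hf2]
  set m := s / (2 * Real.pi)
  have h0 : 0 ≤ ∫ x, fourierModulus f x ^ 2 * energy m x ^ 1 := integral_nonneg fun x =>
    mul_nonneg (sq_nonneg _) (pow_nonneg (energy_nonneg _ _) _)
  have h1 : m * ∫ x, fourierModulus f x ^ 2 * energy m x ^ 1 ≤
      ∫ x, fourierModulus f x ^ 2 * energy m x ^ 2 := by
    rw [← integral_const_mul]
    refine integral_mono (hf1.const_mul m) hf2 fun x => ?_
    have h1 := energy_pos hm x
    have h2 := mass_le_energy (m := m) x
    have h3 : 0 ≤ fourierModulus f x ^ 2 * energy m x * (energy m x - m) :=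
      mul_nonneg (by positivity) (by linarith)
    beta_reduce
    nlinarith
  have h2 := pow_le_pow_left₀ (mul_nonneg hm.le h0) h1 2
  rw [mul_pow] at h2
  exact mul_nonneg (by positivity) (by linarith)

include hd

theorem boxNorm_null_lt (f : L2 d) (hf0 : f ≠ 0) (hf : sobolevNorm s (1 / 2) f < ∞) :
    boxNorm ((2 - (d : ℝ)) / 4) (density s f) <
      ENNReal.ofReal (sharpConstant d s ((d : ℝ) / 2) * (sobolevNorm s (1 / 2) f).toReal ^ 2) := by
  have hm : 0 < s / (2 * Real.pi) := by positivity
  have hd' : (2 : ℝ) ≤ d := by exact_mod_cast hd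
  have hf1 := integrable_of_sobolevNorm hs (α := 1 / 2) (n := 1) (by norm_num) hf
  have hP := toReal_sobolevNorm_sq hs (α := 1 / 2) (n := 1) (by norm_num) hf1
  simp only [pow_one] at hf1 hP
  refine boxNorm_density_lt hs hd (j := 0) (by push_cast; ring) (sphereArea_pos hd) (fun e he => ?_) hf0
    (momentumMass_zero hm hf1).le (le_of_eq ?_)
    (mul_nonneg (sharpConstant_nonneg hs (by linarith)) (by positivity))
  · rw [← toSphere_univ_eq hd, ← lintegral_sphere_norm_sub_rpow (by simpa using hd) he]
    refine lintegral_congr fun ω => ?_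
    rw [finrank_euclideanSpace_fin]
    ring_nf
  · rw [sharpConstant_null hs hd, hP]

theorem exists_le_boxNorm_null (c : ℝ) (hc0 : 0 < c) (hc1 : c < 1) :
    ∃ f : L2 d, f ≠ 0 ∧ sobolevNorm s (1 / 2) f < ∞ ∧
      ENNReal.ofReal (c * (sharpConstant d s ((d : ℝ) / 2) *
        (sobolevNorm s (1 / 2) f).toReal ^ 2)) ≤ boxNorm ((2 - (d : ℝ)) / 4) (density s f) := by
  have hm : 0 < s / (2 * Real.pi) := by positivity
  have hd' : (2 : ℝ) ≤ d := by exact_mod_cast hd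
  obtain ⟨a, f, ha, hf0, hf, hle⟩ := exists_le_boxNorm_density hs hd (j := 0)
    (β := (2 - (d : ℝ)) / 4) (by push_cast; ring) (sphereArea_pos hd) (fun e he => by
      rw [← toSphere_univ_eq hd, ← lintegral_sphere_norm_sub_rpow (by simpa using hd) he]
      refine lintegral_congr fun ω => ?_
      rw [finrank_euclideanSpace_fin]
      ring_nf) hc0 hc1
  have hg1 := integrable_expProfile_sq (V := Space d) hm ha 1
  have hcongr := fourierModulus_sq_mul_energy_congr hf 1
  have hf1 := hg1.congr hcongr.symm
  have hP := toReal_sobolevNorm_sq hs (α := 1 / 2) (n := 1) (by norm_num) hf1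
  rw [integral_congr_ae hcongr] at hP
  simp only [pow_one] at hg1 hP
  refine ⟨f, hf0, sobolevNorm_lt_top hs (n := 1) (by norm_num) hf1, hle _ _
    (momentumMass_zero hm hg1) ?_ (mul_nonneg (sharpConstant_nonneg hs (by linarith)) (by positivity))⟩
  rw [sharpConstant_null hs hd, hP]

theorem lintegral_sphere_refined (e : Space d) (he : ‖e‖ = 1) :
    ∫⁻ ω : sphere (0 : Space d) 1, ENNReal.ofReal ((‖(ω : Space d) - e‖ ^ 2) ^
        (2 * ((4 - (d : ℝ)) / 4))) ∂(volume : Measure (Space d)).toSphere =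
      ENNReal.ofReal (4 / d * sphereArea d) := by
  have h := lintegral_sphere_norm_sub_rpow' (by simpa using hd) he
  rw [ENNReal.ofReal_mul (by positivity), ← toSphere_univ_eq hd]
  rw [finrank_euclideanSpace_fin] at h
  rw [← h]
  refine lintegral_congr fun ω => ?_
  ring_nf

theorem boxNorm_refined_lt (f : L2 d) (hf0 : f ≠ 0) (hf : sobolevNorm s 1 f < ∞) :
    boxNorm ((4 - (d : ℝ)) / 4) (density s f) <
      ENNReal.ofReal (sharpConstant d s (((d : ℝ) + 2) / 2) *
        refinedQuantity s f ^ (1 / 2 : ℝ)) := by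
  have hπ := Real.pi_pos
  have hm : 0 < s / (2 * Real.pi) := by positivity
  have hd' : (2 : ℝ) ≤ d := by exact_mod_cast hd
  have hf2 := integrable_of_sobolevNorm hs (α := 1) (n := 2) (by norm_num) hf
  have hf1 := integrable_energy_one hs (measurable_fourierModulus f) hf2
  have hQ := refinedQuantity_eq hs hf1 hf2
  have hQ0 := refinedQuantity_nonneg hs hf
  have hmass := momentumMass_one hm hf2 (measurable_fourierModulus f)
  simp only [pow_one] at hQ
  refine boxNorm_density_lt hs hd (j := 1) (by push_cast; ring)
    (mul_pos (by positivity) (sphereArea_pos hd)) (lintegral_sphere_refined hs hd) hf0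
    (Q := 2⁻¹ * ((∫ x, fourierModulus f x ^ 2 * energy (s / (2 * Real.pi)) x ^ 2) ^ 2 -
        (s / (2 * Real.pi)) ^ 2 *
          (∫ x, fourierModulus f x ^ 2 * energy (s / (2 * Real.pi)) x) ^ 2))
    (hmass.le.trans (ENNReal.ofReal_le_ofReal ?_)) (le_of_eq ?_)
    (mul_nonneg (sharpConstant_nonneg hs (by linarith)) (by positivity))
  · gcongr
    -- The square of the total momentum is discarded.
    linarith [sq_nonneg ‖∫ x, (fourierModulus f x ^ 2 * energy (s / (2 * Real.pi)) x) • x‖]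
  · rw [sharpConstant_refined hs hd, ← hQ, mul_pow, ← Real.sqrt_eq_rpow, Real.sq_sqrt hQ0]

theorem exists_le_boxNorm_refined (c : ℝ) (hc0 : 0 < c) (hc1 : c < 1) :
    ∃ f : L2 d, f ≠ 0 ∧ sobolevNorm s 1 f < ∞ ∧
      ENNReal.ofReal (c * (sharpConstant d s (((d : ℝ) + 2) / 2) *
        refinedQuantity s f ^ (1 / 2 : ℝ))) ≤ boxNorm ((4 - (d : ℝ)) / 4) (density s f) := by
  have hπ := Real.pi_pos
  have hm : 0 < s / (2 * Real.pi) := by positivity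
  have hd' : (2 : ℝ) ≤ d := by exact_mod_cast hd
  obtain ⟨a, f, ha, hf0, hf, hle⟩ := exists_le_boxNorm_density hs hd (j := 1)
    (β := (4 - (d : ℝ)) / 4) (by push_cast; ring) (mul_pos (by positivity) (sphereArea_pos hd))
    (lintegral_sphere_refined hs hd) hc0 hc1
  have hg2 := integrable_expProfile_sq (V := Space d) hm ha 2
  have hc1 := fourierModulus_sq_mul_energy_congr hf 1
  have hc2 := fourierModulus_sq_mul_energy_congr hf 2
  have hf1 := (integrable_expProfile_sq hm ha 1).congr hc1.symm
  have hf2 := hg2.congr hc2.symm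
  have hsob : sobolevNorm s 1 f < ∞ := sobolevNorm_lt_top hs (n := 2) (by norm_num) hf2
  have hQ := refinedQuantity_eq hs hf1 hf2
  have hQ0 := refinedQuantity_nonneg hs hsob
  rw [integral_congr_ae hc1, integral_congr_ae hc2] at hQ
  have hmass := momentumMass_one hm hg2 (measurable_expProfile _ _)
  -- The profile is even, so the discarded total momentum is zero and nothing is lost.
  rw [integral_expProfile_smul, norm_zero] at hmass
  simp only [pow_one, ne_eq, OfNat.ofNat_ne_zero, not_false_eq_true, zero_pow, sub_zero] at hQ hmass
  refine ⟨f, hf0, hsob, hle _ _ hmass ?_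
    (mul_nonneg (sharpConstant_nonneg hs (by linarith)) (by positivity))⟩
  rw [sharpConstant_refined hs hd, ← hQ, mul_pow, ← Real.sqrt_eq_rpow, Real.sq_sqrt hQ0]

theorem strichartzNorm_four_zero : strichartzNorm s 4 (0 : L2 d) = 0 := by
  have h := boxNorm_density_zero hs hd (d := d) 0
  rw [strichartzNorm_four_eq hs hd (by simp [h]), h]
  norm_num

end Optimality

end KleinGordon

theorem mainTheorem3 (s : ℝ) (hs : 0 < s) :
    (∀ d : ℕ, 2 ≤ d →
      -- the null-form estimate, `(α, β) = (1/2, (2-d)/4)`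
      (KleinGordon.IsOptimalConstant (d := d) s (1 / 2)
          (fun f => KleinGordon.boxNorm ((2 - (d : ℝ)) / 4) (KleinGordon.density s f))
          (fun f => (KleinGordon.sobolevNorm s (1 / 2) f).toReal ^ 2)
          (KleinGordon.sharpConstant d s ((d : ℝ) / 2)) ∧
        KleinGordon.NoExtremisers (d := d) s (1 / 2)
          (fun f => KleinGordon.boxNorm ((2 - (d : ℝ)) / 4) (KleinGordon.density s f))
          (fun f => (KleinGordon.sobolevNorm s (1 / 2) f).toReal ^ 2)
          (KleinGordon.sharpConstant d s ((d : ℝ) / 2))) ∧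
      -- the refined estimate, `(α, β) = (1, (4-d)/4)`
      (KleinGordon.IsOptimalConstant (d := d) s 1
          (fun f => KleinGordon.boxNorm ((4 - (d : ℝ)) / 4) (KleinGordon.density s f))
          (fun f => KleinGordon.refinedQuantity s f ^ (1 / 2 : ℝ))
          (KleinGordon.sharpConstant d s (((d : ℝ) + 2) / 2)) ∧
        KleinGordon.NoExtremisers (d := d) s 1
          (fun f => KleinGordon.boxNorm ((4 - (d : ℝ)) / 4) (KleinGordon.density s f))
          (fun f => KleinGordon.refinedQuantity s f ^ (1 / 2 : ℝ))
          (KleinGordon.sharpConstant d s (((d : ℝ) + 2) / 2)))) ∧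
    -- the refined `L⁴` Strichartz estimate in dimension `d = 4`
    (KleinGordon.IsOptimalConstant (d := 4) s 1
        (fun f => KleinGordon.strichartzNorm s 4 f)
        (fun f => KleinGordon.refinedQuantity s f ^ (1 / 4 : ℝ))
        ((16 * Real.pi * s) ^ (-(1 / 4) : ℝ)) ∧
      KleinGordon.NoExtremisers (d := 4) s 1
        (fun f => KleinGordon.strichartzNorm s 4 f)
        (fun f => KleinGordon.refinedQuantity s f ^ (1 / 4 : ℝ))
        ((16 * Real.pi * s) ^ (-(1 / 4) : ℝ))) := by
  have hπ := Real.pi_pos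
  refine ⟨fun d hd => ⟨?_, ?_⟩, ?_⟩
  · exact KleinGordon.isOptimalConstant_and_noExtremisers
      (KleinGordon.sharpConstant_nonneg hs (by positivity))
      (KleinGordon.boxNorm_density_zero hs hd _) (KleinGordon.boxNorm_null_lt hs hd)
      (KleinGordon.exists_le_boxNorm_null hs hd)
  · exact KleinGordon.isOptimalConstant_and_noExtremisers
      (KleinGordon.sharpConstant_nonneg hs (by positivity))
      (KleinGordon.boxNorm_density_zero hs hd _) (KleinGordon.boxNorm_refined_lt hs hd)
      (KleinGordon.exists_le_boxNorm_refined hs hd)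
  · have h2 : 2 ≤ 4 := by norm_num
    -- In dimension four the multiplier |□|^β is trivial, so the refined estimate is one for the
    -- `L²` norm of |u|²; its square root is the `L⁴` estimate.
    have hβ : (4 - ((4 : ℕ) : ℝ)) / 4 = 0 := by norm_num
    have hC : 0 ≤ KleinGordon.sharpConstant 4 s ((((4 : ℕ) : ℝ) + 2) / 2) :=
      KleinGordon.sharpConstant_nonneg hs (by positivity)
    have hlt := KleinGordon.boxNorm_refined_lt hs h2
    have hge := KleinGordon.exists_le_boxNorm_refined hs h2
    rw [hβ] at hlt hge
    refine KleinGordon.isOptimalConstant_sqrt (by positivity)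
      (A := fun f : KleinGordon.L2 4 => KleinGordon.boxNorm 0 (KleinGordon.density s f))
      (B := fun f => KleinGordon.refinedQuantity s f ^ (1 / 2 : ℝ))
      (C := KleinGordon.sharpConstant 4 s ((((4 : ℕ) : ℝ) + 2) / 2))
      (KleinGordon.strichartzNorm_four_zero hs h2)
      (fun f _ hf => KleinGordon.strichartzNorm_four_eq hs h2 hf)
      (fun f hf => mul_nonneg hC (Real.rpow_nonneg (KleinGordon.refinedQuantity_nonneg hs hf) _))
      (fun f hf => ?_) hlt hge
    have hQ := KleinGordon.refinedQuantity_nonneg hs hf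
    rw [KleinGordon.sharpConstant_four hs, Real.mul_rpow hC (Real.rpow_nonneg hQ _),
      ← Real.rpow_mul hQ]
    norm_num
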